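/- Fix a coupling constant $\kappa>0$ and let $\Lambda>0$ and $R>\sqrt{3/\Lambda}$. For a $\mathcal C^1$ function $h=h(u,r)$ with $r\in[0,R]$ put $$\bar h(u,r)=\frac1r\int_0^r h(u,s)\,ds,\qquad g(u,r)=\exp\Big(\frac{\kappa}{2}\int_0^r\frac{(h-\bar h)^2(u,s)}{s}\,ds\Big),$$ $$\tilde g(u,r)=\frac1r\int_0^r g(u,s)(1-\Lambda s^2)\,ds,\qquad G=\frac12\,\partial_r\tilde g,\qquad D=\partial_u-\frac{\tilde g}{2}\,\partial_r ,$$ the averages being extended to $r=0$ by continuity, so that $\bar h(u,0)=h(u,0)$ and $\tilde g(u,0)=1$. Here $\mathcal C^k$ on a set with boundary means $\mathcal C^k$ up to the boundary. For $I\subset[0,\infty)$ let $\|h\|_{\mathcal C^0(I\times[0,R])}=\sup_{I\times[0,R]}|h|$ and $\|h\|_{X(I\times[0,R])}=\sup_{I\times[0,R]}|h|+\sup_{I\times[0,R]}|\partial_r h|$; for $f$ on $[0,R]$ let $\|f\|_{\mathcal C^0_R}=\sup_{[0,R]}|f|$ and $\|f\|_{X_R}=\sup_{[0,R]}|f|+\sup_{[0,R]}|f'|$.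 There exist $x^*>0$ and $C^*>0$, depending only on $\Lambda$ and $R$ (and on the fixed constant $\kappa$), such that the following holds. (1) For every integer $k\ge1$ and every $h_0\in\mathcal C^k([0,R])$ with $\|h_0\|_{X_R}\le x^*/(1+C^*)^2$, the initial value problem $$Dh=G\,(h-\bar h),\qquad h(0,r)=h_0(r),$$ has a unique solution $h\in\mathcal C^k([0,\infty)\times[0,R])$. Moreover $$\|h\|_{\mathcal C^0([0,\infty)\times[0,R])}=\|h_0\|_{\mathcal C^0_R},\qquad \|h\|_{X([0,\infty)\times[0,R])}\le(1+C^*)\,\|h_0\|_{X_R}.$$ (2) For every $U>0$ there is a constant $C>0$ depending only on $U$, $R$ and $\Lambda$ (and $\kappa$) such that, for every integer $k\ge 1$, if $h^1,h^2\in\mathcal C^k([0,\infty)\times[0,R])$ are solutions with initial data $h^1_0,h^2_0\in\mathcal C^k([0,R])$ both satisfying the smallness condition in (1), then $$\|h^1-h^2\|_{\mathcal C^0([0,U]\times[0,R])}\le C\,\|h^1_0-h^2_0\|_{\mathcal C^0_R}.$$ -/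

import Mathlib

open Set
open scoped ENNReal ContDiff

noncomputable section

namespace BondiScalar

/-- The average function `f̄(r) = (1/r) ∫₀ʳ f(s) ds`, with its continuous extension `f̄(0) = f(0)`
at the center. -/
def avg (f : ℝ → ℝ) (r : ℝ) : ℝ :=
  if r = 0 then f 0 else (1 / r) * ∫ s in (0 : ℝ)..r, f s

/-- `g = exp ((κ/2) ∫₀ʳ (h - h̄)² / s ds)` on a fixed cone, where `f = h(u, ·)`. -/
def g (κ : ℝ) (f : ℝ → ℝ) (r : ℝ) : ℝ :=
  Real.exp (κ / 2 * ∫ s in (0 : ℝ)..r, (f s - avg f s) ^ 2 / s)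

/-- `g̃`, the average of `g (1 - Λ r²)`, on a fixed cone. -/
def gTilde (κ Λ : ℝ) (f : ℝ → ℝ) (r : ℝ) : ℝ :=
  avg (fun s => g κ f s * (1 - Λ * s ^ 2)) r

/-- `G = (1/2) ∂_r g̃` on a fixed cone (one-sided derivatives at the endpoints of `[0, R]`). -/
def G (κ Λ R : ℝ) (f : ℝ → ℝ) (r : ℝ) : ℝ :=
  1 / 2 * derivWithin (gTilde κ Λ f) (Icc 0 R) r

/-- `∂_r h` on `[0, ∞) × [0, R]` (one-sided at `r = 0` and `r = R`). -/
def partialR (R : ℝ) (h : ℝ → ℝ → ℝ) (u r : ℝ) : ℝ :=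
  derivWithin (fun s => h u s) (Icc 0 R) r

/-- `∂_u h` on `[0, ∞) × [0, R]` (one-sided at `u = 0`). -/
def partialU (h : ℝ → ℝ → ℝ) (u r : ℝ) : ℝ :=
  derivWithin (fun v => h v r) (Ici 0) u

/-- The differential operator `D = ∂_u - (g̃/2) ∂_r` determined by `h`, applied to `h`. -/
def D (κ Λ R : ℝ) (h : ℝ → ℝ → ℝ) (u r : ℝ) : ℝ :=
  partialU h u r - gTilde κ Λ (h u) r / 2 * partialR R h u r

/-- `h` is a `C^k` solution on `[0, ∞) × [0, R]` of `Dh = G (h - h̄)`, `h(0, ·) = h₀`. -/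
structure IsSolution (κ Λ R : ℝ) (k : ℕ) (h₀ : ℝ → ℝ) (h : ℝ → ℝ → ℝ) : Prop where
  contDiffOn : ContDiffOn ℝ k (fun p : ℝ × ℝ => h p.1 p.2) (Ici 0 ×ˢ Icc 0 R)
  equation : ∀ u ∈ Ici (0 : ℝ), ∀ r ∈ Icc (0 : ℝ) R,
    D κ Λ R h u r = G κ Λ R (h u) r * (h u r - avg (h u) r)
  initial : ∀ r ∈ Icc (0 : ℝ) R, h 0 r = h₀ r

/-- The supremum of `|f|` over `[0, R]`, as an extended nonnegative real. -/
def normC0 (R : ℝ) (f : ℝ → ℝ) : ℝ≥0∞ :=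
  ⨆ r ∈ Icc (0 : ℝ) R, ENNReal.ofReal |f r|

/-- The `C¹` norm `sup |f| + sup |f'|` over `[0, R]`. -/
def normX (R : ℝ) (f : ℝ → ℝ) : ℝ≥0∞ :=
  normC0 R f + normC0 R (derivWithin f (Icc 0 R))

/-- The supremum of `|h|` over `I × [0, R]`, as an extended nonnegative real. -/
def normC0Strip (I : Set ℝ) (R : ℝ) (h : ℝ → ℝ → ℝ) : ℝ≥0∞ :=
  ⨆ u ∈ I, ⨆ r ∈ Icc (0 : ℝ) R, ENNReal.ofReal |h u r|

/-- The norm `sup |h| + sup |∂_r h|` over `I × [0, R]`. -/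
def normXStrip (I : Set ℝ) (R : ℝ) (h : ℝ → ℝ → ℝ) : ℝ≥0∞ :=
  normC0Strip I R h + normC0Strip I R (partialR R h)

end BondiScalar

end

/-!
The `1 / r` singularities of the problem disappear once the coefficients are expressed through
`v = ∂_r h`. Since `h - h̄ = r Q` with `Q = ∫₀¹ t v(tr) dt`, one has `g = exp (κ/2 ∫₀ʳ s Q²)`,
`∂_r (g (1 - Λ r²)) = r P` and `G = r M` with `M = ½ ∫₀¹ t² P(tr) dt`, where `P` and `M` are bounded
functions of the bounded quantity `Q`. The averages are moments `∫₀¹ tⁿ f(tr) dt`, which commute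
with `∂_r` up to a shift of `n`.

For `|v| ≤ ε` small, `M ≤ -Λ/6`, so `G ≤ 0`; moreover `g̃ = 1` at the center and `g̃ < 0` at `r = R`
because `R > √(3/Λ)`. Hence the characteristics `X' = -g̃/2` leave `[0, R]` through both ends, every
point of the strip is reached by one that starts at `u = 0`, and no boundary condition is needed.
Along characteristics, `h' = G (h - h̄)` with `G ≤ 0` gives `|h| ≤ sup |h₀|`
(`abs_le_of_linear_ode`), while `v' = 2 G v + F` with `|F|` bounded by a multiple of `sup |h₀|`. The
coefficient `2 G` degenerates at the center, but there `X' = -1/2` to leading order, so that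
`barrier ∘ X` is a supersolution of `y' = 2 G y + 1` (`one_le_barrier_term`). This is the source of
the time-independent constant `C*`, here `growthConst`.

The solution is the limit of the iteration that solves the linear transport equation with the
coefficients of the previous iterate (`IsIterate.exists_step`). The bounds on `h` and `v` are
preserved by a step. The coefficients are Lipschitz in `f` for the sup norm, at bounded `∂_r f`,
because `r Q = f - f̄` (`exists_coefficient_lipschitz`), so the iteration contracts in the norm
`sup e^{-lu} |h|` for `l` large (`exists_difference_estimate`). The derivatives of the iterates need
not be contracted: they solve linear transport equations with uniformly convergent coefficients, and
therefore converge to the solution `w` of the limiting equation (`IsTransport.tendsto`); then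
`w = ∂_r h` and the limit solves the nonlinear equation (`IsData.exists_solution`). The estimate for
differences also yields uniqueness and continuous dependence on the data (`exists_stability`), where
only one of the two solutions has to be small.

For the `C^k` regularity, `v` solves a linear transport equation whose coefficients are as smooth as
`h`, so it is as smooth as `h` until the regularity of the data is exhausted
(`Evolves.smoothStrip`). No derivative is lost, although `Q` is only as smooth as `v`: the
coefficients involve `Q` through expressions `r q₁ q₂` in which each `r qᵢ` is one derivative
smoother than `qᵢ`, and `r q₁ q₂ = (r q₁) (r q₂) / r` inherits the gain
(`IsCentered.id_mul_mul`).
-/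

namespace BondiScalar

open Filter Topology MeasureTheory

/-! ### Moments of functions on `[0, R]` and continuity on the strip -/

/-- The closed strip `[0, ∞) × [0, R]` on which solutions live. -/
def strip (R : ℝ) : Set (ℝ × ℝ) := Ici 0 ×ˢ Icc 0 R

/-- Joint continuity on the strip of a function of `(u, r)`. -/
def ContStrip (R : ℝ) (f : ℝ → ℝ → ℝ) : Prop :=
  ContinuousOn (fun p : ℝ × ℝ => f p.1 p.2) (strip R)

/-- The `n`-th moment `∫₀¹ tⁿ f(tr) dt`; the average `avg f` is the case `n = 0`, and moments
have no singularity at the center `r = 0`. -/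
noncomputable def moment (n : ℕ) (f : ℝ → ℝ) (r : ℝ) : ℝ :=
  ∫ t in (0 : ℝ)..1, t ^ n * f (t * r)

lemma mul_mem_Icc_of_mem {R r t : ℝ} (hr : r ∈ Icc 0 R) (ht : t ∈ Icc (0 : ℝ) 1) :
    t * r ∈ Icc 0 R :=
  ⟨mul_nonneg ht.1 hr.1, (mul_le_of_le_one_left hr.1 ht.2).trans hr.2⟩

lemma avg_eq_moment (f : ℝ → ℝ) (r : ℝ) : avg f r = moment 0 f r := by
  unfold avg moment
  split_ifs with h
  · simp [h]
  · have := intervalIntegral.integral_comp_mul_right (a := 0) (b := 1) f h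
    simp only [zero_mul, one_mul, smul_eq_mul] at this
    simp [this]

/-- Extension of a function from the strip to the plane, constant along the projection. -/
noncomputable def clampExt (R : ℝ) (f : ℝ → ℝ → ℝ) (u r : ℝ) : ℝ := f (max u 0) (max 0 (min r R))

lemma clampExt_eq {R u r : ℝ} (f : ℝ → ℝ → ℝ) (hu : 0 ≤ u) (hr : r ∈ Icc 0 R) :
    clampExt R f u r = f u r := by
  simp [clampExt, hu, hr.1, hr.2]

lemma clamp_mem {R : ℝ} (hR : 0 ≤ R) (r : ℝ) : max 0 (min r R) ∈ Icc 0 R :=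
  ⟨le_max_left _ _, max_le hR (min_le_right _ _)⟩

lemma ContStrip.continuous_clampExt {R : ℝ} (hR : 0 ≤ R) {f : ℝ → ℝ → ℝ} (hf : ContStrip R f) :
    Continuous (fun p : ℝ × ℝ => clampExt R f p.1 p.2) := by
  have h : Continuous (fun p : ℝ × ℝ => (max p.1 0, max 0 (min p.2 R))) := by fun_prop
  exact hf.comp_continuous h fun p =>
    ⟨show (0 : ℝ) ≤ max p.1 0 from le_max_right _ _, clamp_mem hR _⟩

lemma ContStrip.slice {R u : ℝ} {f : ℝ → ℝ → ℝ} (hf : ContStrip R f) (hu : 0 ≤ u) :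
    ContinuousOn (f u) (Icc 0 R) :=
  ContinuousOn.comp (t := strip R) hf (f := fun r => (u, r)) (by fun_prop) fun _ hr => ⟨hu, hr⟩

lemma ContStrip.slice_left {R r : ℝ} {f : ℝ → ℝ → ℝ} (hf : ContStrip R f) (hr : r ∈ Icc 0 R) :
    ContinuousOn (fun u => f u r) (Ici 0) :=
  ContinuousOn.comp (t := strip R) hf (f := fun u => (u, r)) (by fun_prop) fun _ hu => ⟨hu, hr⟩

lemma ContStrip.of_slice {R : ℝ} {f : ℝ → ℝ} (hf : ContinuousOn f (Icc 0 R)) :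
    ContStrip R (fun _ r => f r) :=
  ContinuousOn.comp (t := Icc 0 R) hf (f := fun p : ℝ × ℝ => p.2) (by fun_prop) fun _ hp => hp.2

lemma ContStrip.add {R : ℝ} {f k : ℝ → ℝ → ℝ} (hf : ContStrip R f) (hk : ContStrip R k) :
    ContStrip R (fun u r => f u r + k u r) := ContinuousOn.add hf hk

lemma ContStrip.sub {R : ℝ} {f k : ℝ → ℝ → ℝ} (hf : ContStrip R f) (hk : ContStrip R k) :
    ContStrip R (fun u r => f u r - k u r) := ContinuousOn.sub hf hk

lemma ContStrip.mul {R : ℝ} {f k : ℝ → ℝ → ℝ} (hf : ContStrip R f) (hk : ContStrip R k) :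
    ContStrip R (fun u r => f u r * k u r) := ContinuousOn.mul hf hk

lemma ContStrip.const_mul {R : ℝ} {f : ℝ → ℝ → ℝ} (c : ℝ) (hf : ContStrip R f) :
    ContStrip R (fun u r => c * f u r) := ContinuousOn.mul continuousOn_const hf

lemma ContStrip.neg {R : ℝ} {f : ℝ → ℝ → ℝ} (hf : ContStrip R f) :
    ContStrip R (fun u r => - f u r) := ContinuousOn.neg hf

lemma contStrip_radial (R : ℝ) {φ : ℝ → ℝ} (hφ : Continuous φ) :
    ContStrip R (fun _ r => φ r) :=
  (hφ.comp continuous_snd).continuousOn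

lemma ContStrip.congr {R : ℝ} {f k : ℝ → ℝ → ℝ} (hf : ContStrip R f)
    (h : ∀ u, 0 ≤ u → ∀ r ∈ Icc 0 R, k u r = f u r) : ContStrip R k :=
  ContinuousOn.congr hf fun p hp => h p.1 hp.1 p.2 hp.2

lemma moment_congr {R r : ℝ} {n : ℕ} {f k : ℝ → ℝ} (hr : r ∈ Icc 0 R)
    (h : ∀ s ∈ Icc 0 R, f s = k s) : moment n f r = moment n k r := by
  unfold moment
  refine intervalIntegral.integral_congr fun t ht => ?_
  rw [uIcc_of_le zero_le_one] at ht
  simp only [h _ (mul_mem_Icc_of_mem hr ht)]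

lemma ContStrip.moment {R : ℝ} {f : ℝ → ℝ → ℝ} (hR : 0 ≤ R) (hf : ContStrip R f) (n : ℕ) :
    ContStrip R (fun u r => moment n (f u) r) := by
  have h := hf.continuous_clampExt hR
  have h1 : Continuous (fun p : ℝ × ℝ => ∫ t in (0 : ℝ)..1, t ^ n * clampExt R f p.1 (t * p.2)) := by
    apply intervalIntegral.continuous_parametric_intervalIntegral_of_continuous'
    have : Continuous (fun q : (ℝ × ℝ) × ℝ => clampExt R f q.1.1 (q.2 * q.1.2)) :=
      h.comp (f := fun q : (ℝ × ℝ) × ℝ => (q.1.1, q.2 * q.1.2)) (by fun_prop)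
    simp only [Function.uncurry_def]
    fun_prop
  refine ContinuousOn.congr h1.continuousOn fun p hp => ?_
  exact moment_congr (n := n) hp.2 fun s hs => (clampExt_eq f hp.1 hs).symm

lemma continuousOn_moment {R : ℝ} {f : ℝ → ℝ} (hR : 0 ≤ R) (hf : ContinuousOn f (Icc 0 R)) (n : ℕ) :
    ContinuousOn (moment n f) (Icc 0 R) :=
  ((ContStrip.of_slice hf).moment hR n).slice le_rfl

lemma continuousOn_moment_integrand {R r : ℝ} {f : ℝ → ℝ} (hf : ContinuousOn f (Icc 0 R)) (n : ℕ)
    (hr : r ∈ Icc 0 R) : ContinuousOn (fun t => t ^ n * f (t * r)) (Icc 0 1) := by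
  have : ContinuousOn (fun t => f (t * r)) (Icc 0 1) :=
    hf.comp (by fun_prop) fun t ht => mul_mem_Icc_of_mem hr ht
  exact (by fun_prop : ContinuousOn (fun t : ℝ => t ^ n) (Icc 0 1)).mul this

lemma intervalIntegrable_moment {R r : ℝ} {f : ℝ → ℝ} (hf : ContinuousOn f (Icc 0 R)) (n : ℕ)
    (hr : r ∈ Icc 0 R) : IntervalIntegrable (fun t => t ^ n * f (t * r)) volume 0 1 :=
  ContinuousOn.intervalIntegrable (by
    rw [uIcc_of_le zero_le_one]; exact continuousOn_moment_integrand hf n hr)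

lemma moment_mono {R r : ℝ} {f k : ℝ → ℝ} (hf : ContinuousOn f (Icc 0 R))
    (hk : ContinuousOn k (Icc 0 R)) (n : ℕ) (hr : r ∈ Icc 0 R) (h : ∀ s ∈ Icc 0 R, f s ≤ k s) :
    moment n f r ≤ moment n k r := by
  refine intervalIntegral.integral_mono_on zero_le_one (intervalIntegrable_moment hf n hr)
    (intervalIntegrable_moment hk n hr) fun t ht => ?_
  exact mul_le_mul_of_nonneg_left (h _ (mul_mem_Icc_of_mem hr ht)) (pow_nonneg ht.1 n)

lemma moment_const (n : ℕ) (C r : ℝ) : moment n (fun _ => C) r = C / (n + 1) := by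
  simp only [moment, intervalIntegral.integral_mul_const, integral_pow]
  simp
  ring

lemma abs_moment_le {R r C : ℝ} {f : ℝ → ℝ} (hf : ContinuousOn f (Icc 0 R)) (n : ℕ)
    (hr : r ∈ Icc 0 R) (h : ∀ s ∈ Icc 0 R, |f s| ≤ C) : |moment n f r| ≤ C / (n + 1) := by
  rw [abs_le]
  constructor
  · have := moment_mono (f := fun _ => -C) continuousOn_const hf n hr fun s hs =>
      (abs_le.1 (h s hs)).1
    rwa [moment_const, neg_div] at this
  · have := moment_mono (k := fun _ => C) hf continuousOn_const n hr fun s hs =>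
      (abs_le.1 (h s hs)).2
    rwa [moment_const] at this

lemma moment_sub {R r : ℝ} {f k : ℝ → ℝ} (hf : ContinuousOn f (Icc 0 R))
    (hk : ContinuousOn k (Icc 0 R)) (n : ℕ) (hr : r ∈ Icc 0 R) :
    moment n (fun s => f s - k s) r = moment n f r - moment n k r := by
  unfold moment
  rw [← intervalIntegral.integral_sub (intervalIntegrable_moment hf n hr)
    (intervalIntegrable_moment hk n hr)]
  simp only [mul_sub]

lemma moment_id_mul (n : ℕ) (f : ℝ → ℝ) (r : ℝ) :
    moment n (fun s => s * f s) r = r * moment (n + 1) f r := by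
  unfold moment
  rw [← intervalIntegral.integral_const_mul]
  congr 1; ext t; ring

lemma moment_at_zero (n : ℕ) (f : ℝ → ℝ) : moment n f 0 = f 0 / (n + 1) := by
  simp only [moment, mul_zero, intervalIntegral.integral_mul_const, integral_pow]
  simp
  ring

lemma pow_succ_mul_moment (n : ℕ) (f : ℝ → ℝ) (r : ℝ) :
    r ^ (n + 1) * moment n f r = ∫ s in (0 : ℝ)..r, s ^ n * f s := by
  rcases eq_or_ne r 0 with rfl | h
  · simp
  · have := intervalIntegral.integral_comp_mul_right (a := 0) (b := 1)
      (fun s => s ^ n * f s) h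
    simp only [zero_mul, one_mul, smul_eq_mul] at this
    have h2 : (∫ s in (0 : ℝ)..r, s ^ n * f s) = r * ∫ t in (0 : ℝ)..1, (t * r) ^ n * f (t * r) := by
      rw [this]; field_simp
    rw [h2, moment, ← intervalIntegral.integral_const_mul, ← intervalIntegral.integral_const_mul]
    congr 1; ext t; ring

lemma hasDerivWithinAt_integral {R r : ℝ} {f : ℝ → ℝ} (hf : ContinuousOn f (Icc 0 R))
    (hr : r ∈ Icc 0 R) : HasDerivWithinAt (fun x => ∫ s in (0 : ℝ)..x, f s) (f r) (Icc 0 R) r := by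
  have : Fact (r ∈ Icc 0 R) := ⟨hr⟩
  refine intervalIntegral.integral_hasDerivWithinAt_right ?_ ?_ (hf r hr)
  · exact (hf.mono (by rw [uIcc_of_le hr.1]; exact Icc_subset_Icc_right hr.2)).intervalIntegrable
  · exact hf.stronglyMeasurableAtFilter_nhdsWithin measurableSet_Icc r

/-- `r ∫₀¹ tⁿ f(tr) dt = r⁻ⁿ ∫₀ʳ sⁿ f(s) ds` is differentiable up to the center as soon as `f` is
continuous. -/
lemma hasDerivWithinAt_id_mul_moment {R r : ℝ} {f : ℝ → ℝ} (hR : 0 < R)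
    (hf : ContinuousOn f (Icc 0 R)) (n : ℕ) (hr : r ∈ Icc 0 R) :
    HasDerivWithinAt (fun x => x * moment n f x) (f r - n * moment n f r) (Icc 0 R) r := by
  rcases hr.1.eq_or_lt with rfl | h0
  · rw [moment_at_zero]
    have hc := continuousOn_moment hR.le hf n 0 hr
    rw [hasDerivWithinAt_iff_tendsto_slope]
    have : f 0 - n * (f 0 / (n + 1)) = moment n f 0 := by
      rw [moment_at_zero]; field_simp; ring
    rw [this]
    refine (hc.tendsto.mono_left (nhdsWithin_mono _ sdiff_subset)).congr' ?_
    filter_upwards [self_mem_nhdsWithin] with x hx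
    have hx0 : x ≠ 0 := hx.2
    simp [slope_def_field, hx0]
  · have hsf : ContinuousOn (fun s => s ^ n * f s) (Icc 0 R) := by fun_prop
    have h1 := hasDerivWithinAt_integral hsf hr
    have h2 : HasDerivWithinAt (fun x : ℝ => (x ^ n)⁻¹) (-(n * r ^ (n - 1)) / (r ^ n) ^ 2) (Icc 0 R) r :=
      ((hasDerivAt_pow n r).inv (pow_ne_zero n h0.ne')).hasDerivWithinAt
    have h3 := h2.mul h1
    have heq : ∀ x ∈ Icc 0 R, x ≠ 0 →
        x * moment n f x = (x ^ n)⁻¹ * ∫ s in (0 : ℝ)..x, s ^ n * f s := by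
      intro x _ hx0
      rw [← pow_succ_mul_moment]
      field_simp
      ring
    have hev : (fun x => x * moment n f x) =ᶠ[𝓝[Icc 0 R] r]
        fun x => (x ^ n)⁻¹ * ∫ s in (0 : ℝ)..x, s ^ n * f s := by
      filter_upwards [self_mem_nhdsWithin, mem_nhdsWithin_of_mem_nhds (isOpen_ne.mem_nhds h0.ne')]
        with x hx hx0 using heq x hx hx0
    refine (h3.congr_of_eventuallyEq hev (heq r hr h0.ne')).congr_deriv ?_
    rw [← pow_succ_mul_moment]
    rcases n with _ | n
    · simp
    · simp only [Nat.add_sub_cancel]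
      push_cast
      field_simp
      ring

/-- Integration by parts for moments. -/
lemma succ_mul_moment {R r : ℝ} {f f' : ℝ → ℝ} (hf' : ContinuousOn f' (Icc 0 R))
    (h : ∀ s ∈ Icc 0 R, HasDerivWithinAt f (f' s) (Icc 0 R) s) (n : ℕ) (hr : r ∈ Icc 0 R) :
    (n + 1) * moment n f r = f r - r * moment (n + 1) f' r := by
  have hf : ContinuousOn f (Icc 0 R) := fun s hs => (h s hs).continuousWithinAt
  have hc := continuousOn_moment_integrand hf (n + 1) hr
  have hd : ∀ t ∈ Ioo (0 : ℝ) 1, HasDerivWithinAt (fun t => t ^ (n + 1) * f (t * r))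
      ((n + 1) * (t ^ n * f (t * r)) + r * (t ^ (n + 1) * f' (t * r))) (Ioi t) t := by
    intro t ht
    have h1 : HasDerivWithinAt (fun t => t * r) r (Icc 0 1) t := by
      simpa using (hasDerivAt_mul_const r (x := t)).hasDerivWithinAt
    have h2 := (h _ (mul_mem_Icc_of_mem hr (Ioo_subset_Icc_self ht))).comp t h1
      fun t ht => mul_mem_Icc_of_mem hr ht
    have h3 := ((hasDerivAt_pow (n + 1) t).hasDerivWithinAt (s := Icc (0 : ℝ) 1)).mul h2
    refine ((h3.hasDerivAt (Icc_mem_nhds ht.1 ht.2)).hasDerivWithinAt).congr_deriv ?_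
    simp
    ring
  have hi : IntervalIntegrable
      (fun t => (n + 1) * (t ^ n * f (t * r)) + r * (t ^ (n + 1) * f' (t * r))) volume 0 1 :=
    ((intervalIntegrable_moment hf n hr).const_mul _).add
      ((intervalIntegrable_moment hf' (n + 1) hr).const_mul _)
  have := intervalIntegral.integral_eq_sub_of_hasDeriv_right_of_le zero_le_one hc hd hi
  rw [intervalIntegral.integral_add ((intervalIntegrable_moment hf n hr).const_mul _)
      ((intervalIntegrable_moment hf' (n + 1) hr).const_mul _),
    intervalIntegral.integral_const_mul, intervalIntegral.integral_const_mul] at this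
  simp only [one_pow, one_mul, zero_mul, ne_eq, Nat.add_eq_zero_iff, one_ne_zero, and_false,
    not_false_eq_true, zero_pow, sub_zero] at this
  unfold moment
  linarith

lemma hasDerivWithinAt_moment {R r : ℝ} {f f' : ℝ → ℝ} (hR : 0 < R)
    (hf' : ContinuousOn f' (Icc 0 R))
    (h : ∀ s ∈ Icc 0 R, HasDerivWithinAt f (f' s) (Icc 0 R) s) (n : ℕ) (hr : r ∈ Icc 0 R) :
    HasDerivWithinAt (moment n f) (moment (n + 1) f' r) (Icc 0 R) r := by
  have hn : (n + 1 : ℝ) ≠ 0 := by positivity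
  have h1 := ((h r hr).sub (hasDerivWithinAt_id_mul_moment hR hf' (n + 1) hr)).div_const (n + 1 : ℝ)
  have heq : ∀ x ∈ Icc 0 R, moment n f x = (f x - x * moment (n + 1) f' x) / (n + 1 : ℝ) :=
    fun x hx => by rw [← succ_mul_moment hf' h n hx]; field_simp
  refine (h1.congr heq (heq r hr)).congr_deriv ?_
  push_cast
  field_simp
  ring

/-! ### The metric functions in terms of the radial derivative -/

/-- The radial derivative `∂_r f̄` of the average, as a functional of `v = ∂_r f`;
it satisfies `f - f̄ = r ∂_r f̄`. -/
noncomputable def meanSlope (v : ℝ → ℝ) (r : ℝ) : ℝ := moment 1 v r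

/-- The metric function `g` as a functional of `v = ∂_r f`. -/
noncomputable def metricG (κ : ℝ) (v : ℝ → ℝ) (r : ℝ) : ℝ :=
  Real.exp (κ / 2 * (r * moment 0 (fun s => s * meanSlope v s ^ 2) r))

/-- The function `P` determined by `∂_r (g (1 - Λ r²)) = r P`. -/
noncomputable def metricP (κ Λ : ℝ) (v : ℝ → ℝ) (r : ℝ) : ℝ :=
  (κ / 2 * meanSlope v r ^ 2 * (1 - Λ * r ^ 2) - 2 * Λ) * metricG κ v r

/-- The function `M` determined by `G = r M`. -/
noncomputable def metricM (κ Λ : ℝ) (v : ℝ → ℝ) (r : ℝ) : ℝ :=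
  1 / 2 * moment 2 (metricP κ Λ v) r

/-- The coefficient `g̃ / 2` of `-∂_r` in the operator `D`. -/
noncomputable def speed (κ Λ : ℝ) (v : ℝ → ℝ) (r : ℝ) : ℝ :=
  1 / 2 * moment 0 (fun s => metricG κ v s * (1 - Λ * s ^ 2)) r

/-- The derivative `∂_r G`. -/
noncomputable def derivG (κ Λ : ℝ) (v : ℝ → ℝ) (r : ℝ) : ℝ :=
  metricP κ Λ v r / 2 - 2 * metricM κ Λ v r

/-- The source `(∂_r G - G / r) (h - h̄)` in the equation `D v = 2 G v + (∂_r G - G / r) (h - h̄)`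
satisfied by `v = ∂_r h`. -/
noncomputable def forcing (κ Λ : ℝ) (v : ℝ → ℝ) (r : ℝ) : ℝ :=
  (metricP κ Λ v r / 2 - 3 * metricM κ Λ v r) * (r * meanSlope v r)

section Continuity

variable {κ Λ R : ℝ} {v : ℝ → ℝ → ℝ}

lemma ContStrip.meanSlope (hR : 0 ≤ R) (hv : ContStrip R v) :
    ContStrip R (fun u r => meanSlope (v u) r) := hv.moment hR 1

lemma ContStrip.metricG (hR : 0 ≤ R) (hv : ContStrip R v) :
    ContStrip R (fun u r => metricG κ (v u) r) := by
  have h1 : ContStrip R (fun u r => r * BondiScalar.meanSlope (v u) r ^ 2) :=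
    (contStrip_radial R continuous_id).mul ((ContStrip.meanSlope hR hv).pow 2)
  have h2 := (contStrip_radial R continuous_id).mul (h1.moment hR 0)
  exact Real.continuous_exp.comp_continuousOn (h2.const_mul (κ / 2))

lemma contStrip_weight (Λ R : ℝ) : ContStrip R (fun _ r => 1 - Λ * r ^ 2) :=
  contStrip_radial R (by fun_prop)

lemma ContStrip.metricP (hR : 0 ≤ R) (hv : ContStrip R v) :
    ContStrip R (fun u r => metricP κ Λ (v u) r) := by
  have h1 : ContStrip R (fun u r => κ / 2 * BondiScalar.meanSlope (v u) r ^ 2) :=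
    ContStrip.const_mul _ ((ContStrip.meanSlope hR hv).pow 2)
  exact ((h1.mul (contStrip_weight Λ R)).sub (contStrip_radial R continuous_const)).mul
    (ContStrip.metricG hR hv)

lemma ContStrip.metricM (hR : 0 ≤ R) (hv : ContStrip R v) :
    ContStrip R (fun u r => metricM κ Λ (v u) r) :=
  ((ContStrip.metricP hR hv).moment hR 2).const_mul _

lemma ContStrip.speed (hR : 0 ≤ R) (hv : ContStrip R v) :
    ContStrip R (fun u r => speed κ Λ (v u) r) :=
  (((ContStrip.metricG hR hv).mul (contStrip_weight Λ R)).moment hR 0).const_mul _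

lemma ContStrip.id_mul_metricM (hR : 0 ≤ R) (hv : ContStrip R v) :
    ContStrip R (fun u r => r * BondiScalar.metricM κ Λ (v u) r) :=
  (contStrip_radial R continuous_id).mul (ContStrip.metricM hR hv)

lemma ContStrip.derivG (hR : 0 ≤ R) (hv : ContStrip R v) :
    ContStrip R (fun u r => derivG κ Λ (v u) r) :=
  (ContinuousOn.div_const (ContStrip.metricP hR hv) 2).sub
    ((ContStrip.metricM hR hv).const_mul 2)

lemma ContStrip.forcing (hR : 0 ≤ R) (hv : ContStrip R v) :
    ContStrip R (fun u r => forcing κ Λ (v u) r) :=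
  ContStrip.mul (ContinuousOn.sub (ContinuousOn.div_const (ContStrip.metricP hR hv) 2)
    ((ContStrip.metricM hR hv).const_mul 3))
    ((contStrip_radial R continuous_id).mul (ContStrip.meanSlope hR hv))

end Continuity

section Slice

variable {κ Λ R r : ℝ} {v f : ℝ → ℝ}

lemma continuousOn_meanSlope (hR : 0 ≤ R) (hv : ContinuousOn v (Icc 0 R)) :
    ContinuousOn (meanSlope v) (Icc 0 R) := continuousOn_moment hR hv 1

lemma continuousOn_metricG (κ : ℝ) (hR : 0 ≤ R) (hv : ContinuousOn v (Icc 0 R)) :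
    ContinuousOn (metricG κ v) (Icc 0 R) :=
  (ContStrip.metricG hR (ContStrip.of_slice hv)).slice le_rfl

lemma continuousOn_metricP (κ Λ : ℝ) (hR : 0 ≤ R) (hv : ContinuousOn v (Icc 0 R)) :
    ContinuousOn (metricP κ Λ v) (Icc 0 R) :=
  (ContStrip.metricP hR (ContStrip.of_slice hv)).slice le_rfl

lemma hasDerivWithinAt_metricG (κ : ℝ) (hR : 0 < R) (hv : ContinuousOn v (Icc 0 R))
    (hr : r ∈ Icc 0 R) :
    HasDerivWithinAt (metricG κ v) (κ / 2 * (r * meanSlope v r ^ 2) * metricG κ v r)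
      (Icc 0 R) r := by
  have hc : ContinuousOn (fun s => s * meanSlope v s ^ 2) (Icc 0 R) :=
    continuousOn_id.mul ((continuousOn_meanSlope hR.le hv).pow 2)
  have h := ((hasDerivWithinAt_id_mul_moment hR hc 0 hr).const_mul (κ / 2)).exp
  refine h.congr_deriv ?_
  simp [metricG]
  ring

lemma hasDerivWithinAt_metricG_mul_weight (κ Λ : ℝ) (hR : 0 < R) (hv : ContinuousOn v (Icc 0 R))
    (hr : r ∈ Icc 0 R) :
    HasDerivWithinAt (fun s => metricG κ v s * (1 - Λ * s ^ 2)) (r * metricP κ Λ v r)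
      (Icc 0 R) r := by
  have h1 : HasDerivAt (fun s : ℝ => 1 - Λ * s ^ 2) (-(Λ * (2 * r))) r := by
    simpa using ((hasDerivAt_pow 2 r).const_mul Λ).const_sub 1
  refine ((hasDerivWithinAt_metricG κ hR hv hr).mul h1.hasDerivWithinAt).congr_deriv ?_
  unfold metricP
  ring

/-- `∂_r (g̃ / 2) = G`. -/
lemma hasDerivWithinAt_speed (κ Λ : ℝ) (hR : 0 < R) (hv : ContinuousOn v (Icc 0 R))
    (hr : r ∈ Icc 0 R) :
    HasDerivWithinAt (speed κ Λ v) (r * metricM κ Λ v r) (Icc 0 R) r := by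
  have h := hasDerivWithinAt_moment hR (continuousOn_id.mul (continuousOn_metricP κ Λ hR.le hv))
    (fun s hs => hasDerivWithinAt_metricG_mul_weight κ Λ hR hv hs) 0 hr
  refine (h.const_mul (1 / 2)).congr_deriv ?_
  have := moment_id_mul 1 (metricP κ Λ v) r
  simp only [zero_add, metricM]
  rw [show (id * metricP κ Λ v) = fun s => s * metricP κ Λ v s from rfl, this]
  ring

lemma hasDerivWithinAt_id_mul_metricM (κ Λ : ℝ) (hR : 0 < R) (hv : ContinuousOn v (Icc 0 R))
    (hr : r ∈ Icc 0 R) :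
    HasDerivWithinAt (fun s => s * metricM κ Λ v s) (derivG κ Λ v r) (Icc 0 R) r := by
  have h := (hasDerivWithinAt_id_mul_moment hR (continuousOn_metricP κ Λ hR.le hv) 2 hr).const_mul
    (1 / 2)
  refine (h.congr_deriv ?_).congr (fun s _ => ?_) ?_
  · unfold derivG metricM; push_cast; ring
  · unfold metricM; ring
  · unfold metricM; ring

/-- `v` is continuous on `[0, R]` and is the derivative of `f` there. -/
structure IsSlice (R : ℝ) (f v : ℝ → ℝ) : Prop where
  continuousOn : ContinuousOn v (Icc 0 R)
  hasDeriv : ∀ r ∈ Icc 0 R, HasDerivWithinAt f (v r) (Icc 0 R) r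

lemma IsSlice.continuousOn_fun (h : IsSlice R f v) : ContinuousOn f (Icc 0 R) :=
  fun s hs => (h.hasDeriv s hs).continuousWithinAt

lemma IsSlice.sub_moment (h : IsSlice R f v) (hr : r ∈ Icc 0 R) :
    f r - moment 0 f r = r * meanSlope v r := by
  have := succ_mul_moment h.continuousOn h.hasDeriv 0 hr
  simp only [Nat.cast_zero, zero_add, one_mul] at this
  rw [this, meanSlope]
  ring

lemma IsSlice.sub_avg (h : IsSlice R f v) (hr : r ∈ Icc 0 R) :
    f r - avg f r = r * meanSlope v r := by
  rw [avg_eq_moment, h.sub_moment hr]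

lemma IsSlice.hasDerivWithinAt_moment (h : IsSlice R f v) (hR : 0 < R) (hr : r ∈ Icc 0 R) :
    HasDerivWithinAt (moment 0 f) (meanSlope v r) (Icc 0 R) r :=
  BondiScalar.hasDerivWithinAt_moment hR h.continuousOn h.hasDeriv 0 hr

lemma IsSlice.g_eq (κ : ℝ) (h : IsSlice R f v) (hr : r ∈ Icc 0 R) : g κ f r = metricG κ v r := by
  have := pow_succ_mul_moment 0 (fun s => s * meanSlope v s ^ 2) r
  simp only [zero_add, pow_one, pow_zero, one_mul] at this
  rw [g, metricG, this]
  congr 2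
  refine intervalIntegral.integral_congr fun s hs => ?_
  rw [uIcc_of_le hr.1] at hs
  rw [h.sub_avg ⟨hs.1, hs.2.trans hr.2⟩]
  rcases eq_or_ne s 0 with rfl | h0
  · simp
  · field_simp

lemma IsSlice.gTilde_eq (κ Λ : ℝ) (h : IsSlice R f v) (hr : r ∈ Icc 0 R) :
    gTilde κ Λ f r = 2 * speed κ Λ v r := by
  rw [gTilde, avg_eq_moment, speed]
  rw [moment_congr hr fun s hs => by rw [h.g_eq κ hs]]
  ring

lemma IsSlice.G_eq (κ Λ : ℝ) (hR : 0 < R) (h : IsSlice R f v) (hr : r ∈ Icc 0 R) :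
    G κ Λ R f r = r * metricM κ Λ v r := by
  have h1 : HasDerivWithinAt (gTilde κ Λ f) (2 * (r * metricM κ Λ v r)) (Icc 0 R) r :=
    ((hasDerivWithinAt_speed κ Λ hR h.continuousOn hr).const_mul 2).congr
      (fun s hs => h.gTilde_eq κ Λ hs) (h.gTilde_eq κ Λ hr)
  rw [G, h1.derivWithin (uniqueDiffOn_Icc hR r hr)]
  ring

end Slice

section Bounds

variable {κ Λ R ε r : ℝ} {v : ℝ → ℝ}

/-- An upper bound of `g` when `|∂_r f| ≤ ε`. -/
noncomputable def gMax (κ R ε : ℝ) : ℝ := Real.exp (κ / 2 * (R * (R * (ε / 2) ^ 2)))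

/-- An upper bound of `|P|` when `|∂_r f| ≤ ε`. -/
noncomputable def pMax (κ Λ R ε : ℝ) : ℝ :=
  (κ / 2 * (ε / 2) ^ 2 * (1 + Λ * R ^ 2) + 2 * Λ) * gMax κ R ε

lemma gMax_pos : 0 < gMax κ R ε := Real.exp_pos _

lemma pMax_pos (hκ : 0 < κ) (hΛ : 0 < Λ) : 0 < pMax κ Λ R ε :=
  mul_pos (by positivity) gMax_pos

lemma abs_weight_le (hΛ : 0 < Λ) (hr : r ∈ Icc 0 R) : |1 - Λ * r ^ 2| ≤ 1 + Λ * R ^ 2 := by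
  have : r ^ 2 ≤ R ^ 2 := pow_le_pow_left₀ hr.1 hr.2 2
  have h1 := mul_le_mul_of_nonneg_left this hΛ.le
  have h2 : 0 ≤ Λ * r ^ 2 := by positivity
  rw [abs_le]; constructor <;> linarith

lemma abs_meanSlope_le (hv : ContinuousOn v (Icc 0 R)) (hε : ∀ s ∈ Icc 0 R, |v s| ≤ ε)
    (hr : r ∈ Icc 0 R) : |meanSlope v r| ≤ ε / 2 := by
  have := abs_moment_le hv 1 hr hε
  norm_num at this
  exact this

lemma meanSlope_sq_le (hv : ContinuousOn v (Icc 0 R)) (hε : ∀ s ∈ Icc 0 R, |v s| ≤ ε)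
    (hr : r ∈ Icc 0 R) : meanSlope v r ^ 2 ≤ (ε / 2) ^ 2 :=
  sq_le_sq' (by linarith [(abs_le.1 (abs_meanSlope_le hv hε hr)).1])
    (abs_le.1 (abs_meanSlope_le hv hε hr)).2

lemma exponent_mem (hκ : 0 < κ) (hR : 0 ≤ R) (hv : ContinuousOn v (Icc 0 R))
    (hε : ∀ s ∈ Icc 0 R, |v s| ≤ ε) (hr : r ∈ Icc 0 R) :
    κ / 2 * (r * moment 0 (fun s => s * meanSlope v s ^ 2) r) ∈
      Icc 0 (κ / 2 * (R * (R * (ε / 2) ^ 2))) := by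
  have hc : ContinuousOn (fun s => s * meanSlope v s ^ 2) (Icc 0 R) :=
    continuousOn_id.mul ((continuousOn_meanSlope hR hv).pow 2)
  have h0 := moment_mono (f := fun _ => 0) continuousOn_const hc 0 hr fun s hs =>
    mul_nonneg hs.1 (sq_nonneg _)
  have h1 := moment_mono (k := fun _ => R * (ε / 2) ^ 2) hc continuousOn_const 0 hr fun s hs =>
    mul_le_mul hs.2 (meanSlope_sq_le hv hε hs) (sq_nonneg _) hR
  rw [moment_const] at h0 h1
  simp only [Nat.cast_zero, zero_add, div_one] at h0 h1
  constructor
  · have := hr.1; positivity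
  · gcongr
    exact hr.2

lemma one_le_metricG (hκ : 0 < κ) (hR : 0 ≤ R) (hv : ContinuousOn v (Icc 0 R))
    (hε : ∀ s ∈ Icc 0 R, |v s| ≤ ε) (hr : r ∈ Icc 0 R) : 1 ≤ metricG κ v r :=
  Real.one_le_exp (exponent_mem hκ hR hv hε hr).1

lemma metricG_le (hκ : 0 < κ) (hR : 0 ≤ R) (hv : ContinuousOn v (Icc 0 R))
    (hε : ∀ s ∈ Icc 0 R, |v s| ≤ ε) (hr : r ∈ Icc 0 R) : metricG κ v r ≤ gMax κ R ε :=
  Real.exp_le_exp.2 (exponent_mem hκ hR hv hε hr).2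

lemma metricG_pos : 0 < metricG κ v r := Real.exp_pos _

lemma abs_metricP_le (hκ : 0 < κ) (hΛ : 0 < Λ) (hR : 0 ≤ R) (hv : ContinuousOn v (Icc 0 R))
    (hε : ∀ s ∈ Icc 0 R, |v s| ≤ ε) (hr : r ∈ Icc 0 R) : |metricP κ Λ v r| ≤ pMax κ Λ R ε := by
  rw [metricP, pMax, abs_mul, abs_of_pos metricG_pos]
  refine mul_le_mul ?_ (metricG_le hκ hR hv hε hr) metricG_pos.le (by positivity)
  refine (abs_sub _ _).trans ?_
  rw [abs_mul, abs_of_nonneg (by positivity : 0 ≤ κ / 2 * meanSlope v r ^ 2),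
    abs_of_pos (by positivity : 0 < 2 * Λ)]
  have h1 := meanSlope_sq_le hv hε hr
  have h2 := abs_weight_le hΛ hr
  gcongr

lemma abs_metricM_le (hκ : 0 < κ) (hΛ : 0 < Λ) (hR : 0 ≤ R) (hv : ContinuousOn v (Icc 0 R))
    (hε : ∀ s ∈ Icc 0 R, |v s| ≤ ε) (hr : r ∈ Icc 0 R) :
    |metricM κ Λ v r| ≤ pMax κ Λ R ε / 6 := by
  have := abs_moment_le (continuousOn_metricP κ Λ hR hv) 2 hr fun s hs =>
    abs_metricP_le hκ hΛ hR hv hε hs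
  rw [metricM, abs_mul, abs_of_pos (by norm_num : (0 : ℝ) < 1 / 2)]
  norm_num at this
  linarith

lemma abs_id_mul_metricM_le (hκ : 0 < κ) (hΛ : 0 < Λ) (hR : 0 ≤ R) (hv : ContinuousOn v (Icc 0 R))
    (hε : ∀ s ∈ Icc 0 R, |v s| ≤ ε) (hr : r ∈ Icc 0 R) :
    |r * metricM κ Λ v r| ≤ R * pMax κ Λ R ε := by
  rw [abs_mul, abs_of_nonneg hr.1]
  have h := abs_metricM_le hκ hΛ hR hv hε hr
  have := pMax_pos (R := R) (ε := ε) hκ hΛ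
  exact mul_le_mul hr.2 (by linarith) (abs_nonneg _) hR

lemma abs_derivG_le (hκ : 0 < κ) (hΛ : 0 < Λ) (hR : 0 ≤ R) (hv : ContinuousOn v (Icc 0 R))
    (hε : ∀ s ∈ Icc 0 R, |v s| ≤ ε) (hr : r ∈ Icc 0 R) :
    |derivG κ Λ v r| ≤ 5 / 6 * pMax κ Λ R ε := by
  have h1 := abs_le.1 (abs_metricP_le hκ hΛ hR hv hε hr)
  have h2 := abs_le.1 (abs_metricM_le hκ hΛ hR hv hε hr)
  rw [derivG, abs_le]
  constructor <;> linarith [h1.1, h1.2, h2.1, h2.2]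

lemma abs_speed_le (hκ : 0 < κ) (hΛ : 0 < Λ) (hR : 0 ≤ R) (hv : ContinuousOn v (Icc 0 R))
    (hε : ∀ s ∈ Icc 0 R, |v s| ≤ ε) (hr : r ∈ Icc 0 R) :
    |speed κ Λ v r| ≤ gMax κ R ε * (1 + Λ * R ^ 2) := by
  have hc : ContinuousOn (fun s => metricG κ v s * (1 - Λ * s ^ 2)) (Icc 0 R) :=
    (continuousOn_metricG κ hR hv).mul (by fun_prop)
  have := abs_moment_le hc 0 hr (C := gMax κ R ε * (1 + Λ * R ^ 2)) fun s hs => by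
    rw [abs_mul, abs_of_pos metricG_pos]
    exact mul_le_mul (metricG_le hκ hR hv hε hs) (abs_weight_le hΛ hs) (abs_nonneg _) gMax_pos.le
  rw [speed, abs_mul, abs_of_pos (by norm_num : (0 : ℝ) < 1 / 2)]
  norm_num at this
  have h0 : 0 ≤ gMax κ R ε * (1 + Λ * R ^ 2) := mul_nonneg gMax_pos.le (by positivity)
  linarith

end Bounds

/-! ### Signs of the coefficients for small data -/

section Signs

variable {κ Λ R ε r : ℝ} {v : ℝ → ℝ}

/-- The smallness condition on the bound `ε` for `|∂_r h|`. It makes `G` nonpositive and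
`g̃` negative at `r = R`, which lies outside the cosmological horizon. -/
structure IsSmall (κ Λ R ε : ℝ) : Prop where
  pos : 0 < ε
  le_lambda : κ / 2 * (ε / 2) ^ 2 * gMax κ R ε ≤ Λ
  le_horizon : κ / 2 * (ε / 2) ^ 2 * gMax κ R ε ≤ (Λ * R ^ 2 - 3) / R ^ 2

lemma exists_isSmall (κ : ℝ) (hΛ : 0 < Λ) (hR : 0 < R) (h3 : 3 < Λ * R ^ 2) :
    ∃ ε, IsSmall κ Λ R ε := by
  have hc : Continuous (fun ε : ℝ => κ / 2 * (ε / 2) ^ 2 * gMax κ R ε) := by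
    unfold gMax; fun_prop
  have h0 : Tendsto (fun ε : ℝ => κ / 2 * (ε / 2) ^ 2 * gMax κ R ε) (𝓝[>] 0) (𝓝 0) := by
    have := hc.tendsto 0
    simp only [zero_div, ne_eq, OfNat.ofNat_ne_zero, not_false_eq_true, zero_pow, mul_zero,
      zero_mul] at this
    exact this.mono_left nhdsWithin_le_nhds
  have h1 : 0 < (Λ * R ^ 2 - 3) / R ^ 2 := div_pos (by linarith) (by positivity)
  obtain ⟨ε, ⟨ha, hb⟩, hc⟩ :=
    ((h0.eventually_le_const hΛ).and (h0.eventually_le_const h1)).and self_mem_nhdsWithin |>.exists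
  exact ⟨ε, hc, ha, hb⟩

lemma metricP_le (hκ : 0 < κ) (hΛ : 0 < Λ) (hR : 0 ≤ R) (hv : ContinuousOn v (Icc 0 R))
    (hε : ∀ s ∈ Icc 0 R, |v s| ≤ ε) (hr : r ∈ Icc 0 R) :
    metricP κ Λ v r ≤ -2 * Λ + κ / 2 * (ε / 2) ^ 2 * gMax κ R ε := by
  have h1 := one_le_metricG hκ hR hv hε hr
  have h2 := metricG_le hκ hR hv hε hr
  have h3 := meanSlope_sq_le hv hε hr
  have h4 : κ / 2 * meanSlope v r ^ 2 * metricG κ v r ≤ κ / 2 * (ε / 2) ^ 2 * gMax κ R ε := by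
    gcongr
  have h5 : 0 ≤ κ / 2 * meanSlope v r ^ 2 * metricG κ v r * (Λ * r ^ 2) :=
    mul_nonneg (mul_nonneg (by positivity) metricG_pos.le) (by positivity)
  have h6 := mul_le_mul_of_nonneg_left h1 hΛ.le
  have : metricP κ Λ v r = κ / 2 * meanSlope v r ^ 2 * metricG κ v r
      - κ / 2 * meanSlope v r ^ 2 * metricG κ v r * (Λ * r ^ 2) - 2 * (Λ * metricG κ v r) := by
    unfold metricP; ring
  linarith

lemma metricM_le (hκ : 0 < κ) (hΛ : 0 < Λ) (hR : 0 ≤ R) (hv : ContinuousOn v (Icc 0 R))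
    (hε : ∀ s ∈ Icc 0 R, |v s| ≤ ε) (hr : r ∈ Icc 0 R) :
    metricM κ Λ v r ≤ (-2 * Λ + κ / 2 * (ε / 2) ^ 2 * gMax κ R ε) / 6 := by
  have := moment_mono (continuousOn_metricP κ Λ hR hv) continuousOn_const 2 hr fun s hs =>
    metricP_le hκ hΛ hR hv hε hs
  rw [moment_const] at this
  norm_num at this
  rw [metricM]
  linarith

lemma metricM_le_neg (hκ : 0 < κ) (hΛ : 0 < Λ) (hR : 0 ≤ R) (hs : IsSmall κ Λ R ε)
    (hv : ContinuousOn v (Icc 0 R)) (hε : ∀ s ∈ Icc 0 R, |v s| ≤ ε) (hr : r ∈ Icc 0 R) :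
    metricM κ Λ v r ≤ -Λ / 6 := by
  have := metricM_le hκ hΛ hR hv hε hr
  linarith [hs.le_lambda]

/-- Comparison of `g̃ / 2` with the solution of `∂_r (g̃ / 2) = r A`. -/
lemma speed_le_of_metricM_le (hR : 0 < R) (hv : ContinuousOn v (Icc 0 R)) {A : ℝ}
    (hA : ∀ s ∈ Icc 0 R, metricM κ Λ v s ≤ A) (hr : r ∈ Icc 0 R) :
    speed κ Λ v r ≤ speed κ Λ v 0 + A * r ^ 2 / 2 := by
  have hd := fun s (hs : s ∈ Icc 0 R) => hasDerivWithinAt_speed κ Λ hR hv hs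
  refine image_le_of_deriv_right_le_deriv_boundary (a := 0) (b := R)
    (f' := fun s => s * metricM κ Λ v s)
    (B := fun s => speed κ Λ v 0 + A * s ^ 2 / 2) (B' := fun s => s * A)
    (fun s hs => (hd s hs).continuousWithinAt)
    (fun s hs => (hd s (Ico_subset_Icc_self hs)).mono_of_mem_nhdsWithin
      (Icc_mem_nhdsGE_of_mem hs)) (by simp) (by fun_prop) (fun s _ => ?_) (fun s hs => ?_) hr
  · have := (((hasDerivAt_pow 2 s).const_mul A).div_const 2).const_add (speed κ Λ v 0)
    refine this.hasDerivWithinAt.congr_deriv ?_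
    simp; ring
  · exact mul_le_mul_of_nonneg_left (hA s (Ico_subset_Icc_self hs)) hs.1

lemma le_speed_of_le_metricM (hR : 0 < R) (hv : ContinuousOn v (Icc 0 R)) {A : ℝ}
    (hA : ∀ s ∈ Icc 0 R, A ≤ metricM κ Λ v s) (hr : r ∈ Icc 0 R) :
    speed κ Λ v 0 + A * r ^ 2 / 2 ≤ speed κ Λ v r := by
  have hd := fun s (hs : s ∈ Icc 0 R) => hasDerivWithinAt_speed κ Λ hR hv hs
  refine image_le_of_deriv_right_le_deriv_boundary (a := 0) (b := R)
    (B' := fun s => s * metricM κ Λ v s)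
    (f := fun s => speed κ Λ v 0 + A * s ^ 2 / 2) (f' := fun s => s * A)
    (by fun_prop) (fun s _ => ?_) (by simp) (fun s hs => (hd s hs).continuousWithinAt)
    (fun s hs => (hd s (Ico_subset_Icc_self hs)).mono_of_mem_nhdsWithin
      (Icc_mem_nhdsGE_of_mem hs)) (fun s hs => ?_) hr
  · have := (((hasDerivAt_pow 2 s).const_mul A).div_const 2).const_add (speed κ Λ v 0)
    refine this.hasDerivWithinAt.congr_deriv ?_
    simp; ring
  · exact mul_le_mul_of_nonneg_left (hA s (Ico_subset_Icc_self hs)) hs.1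

lemma speed_zero (κ Λ : ℝ) (v : ℝ → ℝ) : speed κ Λ v 0 = 1 / 2 := by
  simp [speed, moment_at_zero, metricG]

lemma speed_outer_le (hκ : 0 < κ) (hΛ : 0 < Λ) (hR : 0 < R) (hs : IsSmall κ Λ R ε)
    (hv : ContinuousOn v (Icc 0 R)) (hε : ∀ s ∈ Icc 0 R, |v s| ≤ ε) :
    speed κ Λ v R ≤ -((Λ * R ^ 2 - 3) / 12) := by
  have h := speed_le_of_metricM_le hR hv (fun s hs => metricM_le hκ hΛ hR.le hv hε hs)
    (right_mem_Icc.2 hR.le)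
  rw [speed_zero] at h
  have h1 := hs.le_horizon
  rw [le_div_iff₀ (by positivity)] at h1
  linarith

/-- The weight `φ` for which `φ ∘ X` is a supersolution of `y' = 2 G y + 1` along the
characteristics `X`; it bounds the growth of `∂_r h` uniformly in time. -/
noncomputable def barrier (κ Λ R ε : ℝ) (r : ℝ) : ℝ :=
  R * pMax κ Λ R ε / Λ + 4 * (R - r)

lemma barrier_ge (hr : r ∈ Icc 0 R) : R * pMax κ Λ R ε / Λ ≤ barrier κ Λ R ε r := by
  unfold barrier; linarith [hr.2]

lemma barrier_le (hr : r ∈ Icc 0 R) :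
    barrier κ Λ R ε r ≤ R * pMax κ Λ R ε / Λ + 4 * R := by
  unfold barrier; linarith [hr.1]

/-- With `X' = -g̃ / 2`, the right side is `(φ ∘ X)' - 2 G (φ ∘ X)` for `φ = barrier`. The term
`4 (g̃ / 2)` supplies the positivity near the center, where `G` vanishes, and the constant term of
`barrier`, multiplied by `-2 G`, compensates for the sign change of `g̃` farther out. -/
lemma one_le_barrier_term (hκ : 0 < κ) (hΛ : 0 < Λ) (hR : 0 < R) (hs : IsSmall κ Λ R ε)
    (hv : ContinuousOn v (Icc 0 R)) (hε : ∀ s ∈ Icc 0 R, |v s| ≤ ε) (hr : r ∈ Icc 0 R) :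
    1 ≤ 4 * speed κ Λ v r - 2 * (r * metricM κ Λ v r) * barrier κ Λ R ε r := by
  have hP := pMax_pos (R := R) (ε := ε) hκ hΛ
  have h1 := le_speed_of_le_metricM (A := -(pMax κ Λ R ε / 6)) hR hv
    (fun s hs => (abs_le.1 (abs_metricM_le hκ hΛ hR.le hv hε hs)).1) hr
  rw [speed_zero] at h1
  have h2 : r * metricM κ Λ v r * barrier κ Λ R ε r
      ≤ r * (-Λ / 6) * (R * pMax κ Λ R ε / Λ) := by
    have a1 := mul_le_mul_of_nonneg_left (metricM_le_neg hκ hΛ hR.le hs hv hε hr) hr.1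
    have a2 := barrier_ge (κ := κ) (Λ := Λ) (ε := ε) hr
    have a3 : r * (-Λ / 6) ≤ 0 := mul_nonpos_of_nonneg_of_nonpos hr.1 (by linarith)
    have a4 : 0 ≤ R * pMax κ Λ R ε / Λ := by positivity
    calc r * metricM κ Λ v r * barrier κ Λ R ε r
        ≤ r * (-Λ / 6) * barrier κ Λ R ε r := mul_le_mul_of_nonneg_right a1 (a4.trans a2)
      _ ≤ _ := mul_le_mul_of_nonpos_left a2 a3
  have h3 : r * (-Λ / 6) * (R * pMax κ Λ R ε / Λ) = -(r * R * pMax κ Λ R ε / 6) := by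
    field_simp
  rw [h3] at h2
  have h4 : r ^ 2 * pMax κ Λ R ε ≤ r * R * pMax κ Λ R ε := by
    rw [sq]; exact mul_le_mul_of_nonneg_right (mul_le_mul_of_nonneg_left hr.2 hr.1) hP.le
  have h5 : 0 ≤ r ^ 2 * pMax κ Λ R ε := by positivity
  linarith

end Signs

/-! ### Lipschitz dependence of the coefficients on the field -/

section Lipschitz

variable {κ Λ R ε N r : ℝ} {f₁ f₂ v₁ v₂ : ℝ → ℝ}

lemma abs_moment_sub_moment_le {C : ℝ} {f k : ℝ → ℝ} (hf : ContinuousOn f (Icc 0 R))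
    (hk : ContinuousOn k (Icc 0 R)) (n : ℕ) (hr : r ∈ Icc 0 R)
    (h : ∀ s ∈ Icc 0 R, |f s - k s| ≤ C) : |moment n f r - moment n k r| ≤ C / (n + 1) := by
  rw [← moment_sub hf hk n hr]
  exact abs_moment_le (hf.sub hk) n hr h

lemma abs_exp_sub_exp_le {a b c : ℝ} (ha : a ≤ c) (hb : b ≤ c) :
    |Real.exp a - Real.exp b| ≤ Real.exp c * |a - b| := by
  have h := Convex.norm_image_sub_le_of_norm_hasDerivWithin_le (f := Real.exp) (f' := Real.exp)
    (s := Iic c) (C := Real.exp c) (x := b) (y := a)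
    (fun x _ => (Real.hasDerivAt_exp x).hasDerivWithinAt)
    (fun x hx => by
      rw [Real.norm_eq_abs, Real.abs_exp]
      exact Real.exp_le_exp.2 hx) (convex_Iic c) hb ha
  exact h

/-- Two functions on `[0, R]` at uniform distance at most `N`, with derivatives bounded by `ε`. -/
structure IsClosePair (R ε N : ℝ) (f₁ f₂ v₁ v₂ : ℝ → ℝ) : Prop where
  slice₁ : IsSlice R f₁ v₁
  slice₂ : IsSlice R f₂ v₂
  bound₁ : ∀ s ∈ Icc 0 R, |v₁ s| ≤ ε
  bound₂ : ∀ s ∈ Icc 0 R, |v₂ s| ≤ ε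
  close : ∀ s ∈ Icc 0 R, |f₁ s - f₂ s| ≤ N

namespace IsClosePair

lemma abs_moment_sub_le (h : IsClosePair R ε N f₁ f₂ v₁ v₂) (hr : r ∈ Icc 0 R) :
    |moment 0 f₁ r - moment 0 f₂ r| ≤ N := by
  simpa using abs_moment_sub_moment_le h.slice₁.continuousOn_fun h.slice₂.continuousOn_fun 0 hr
    h.close

lemma abs_id_mul_meanSlope_sub_le (h : IsClosePair R ε N f₁ f₂ v₁ v₂) (hr : r ∈ Icc 0 R) :
    |r * meanSlope v₁ r - r * meanSlope v₂ r| ≤ 2 * N := by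
  rw [← h.slice₁.sub_moment hr, ← h.slice₂.sub_moment hr]
  have h1 := abs_le.1 (h.abs_moment_sub_le hr)
  have h2 := abs_le.1 (h.close r hr)
  rw [abs_le]
  constructor <;> linarith [h1.1, h1.2, h2.1, h2.2]

lemma abs_id_mul_meanSlope_sq_sub_le (h : IsClosePair R ε N f₁ f₂ v₁ v₂) (hr : r ∈ Icc 0 R) :
    |r * meanSlope v₁ r ^ 2 - r * meanSlope v₂ r ^ 2| ≤ 2 * N * ε := by
  have h1 := h.abs_id_mul_meanSlope_sub_le hr
  have h2 : |meanSlope v₁ r + meanSlope v₂ r| ≤ ε := by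
    have := abs_meanSlope_le h.slice₁.continuousOn h.bound₁ hr
    have := abs_meanSlope_le h.slice₂.continuousOn h.bound₂ hr
    exact (abs_add_le _ _).trans (by linarith)
  rw [show r * meanSlope v₁ r ^ 2 - r * meanSlope v₂ r ^ 2 =
    (r * meanSlope v₁ r - r * meanSlope v₂ r) * (meanSlope v₁ r + meanSlope v₂ r) by ring, abs_mul]
  exact mul_le_mul h1 h2 (abs_nonneg _) ((abs_nonneg _).trans h1)

lemma abs_metricG_sub_le (hκ : 0 < κ) (hR : 0 ≤ R) (h : IsClosePair R ε N f₁ f₂ v₁ v₂)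
    (hr : r ∈ Icc 0 R) :
    |metricG κ v₁ r - metricG κ v₂ r| ≤ gMax κ R ε * (κ * R * ε) * N := by
  have hc : ∀ {v : ℝ → ℝ}, ContinuousOn v (Icc 0 R) →
      ContinuousOn (fun s => s * meanSlope v s ^ 2) (Icc 0 R) := fun hv =>
    continuousOn_id.mul ((continuousOn_meanSlope hR hv).pow 2)
  have hc1 := hc h.slice₁.continuousOn
  have hc2 := hc h.slice₂.continuousOn
  have h1 := abs_moment_sub_moment_le hc1 hc2 0 hr fun s hs => h.abs_id_mul_meanSlope_sq_sub_le hs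
  refine (abs_exp_sub_exp_le (exponent_mem hκ hR h.slice₁.continuousOn h.bound₁ hr).2
    (exponent_mem hκ hR h.slice₂.continuousOn h.bound₂ hr).2).trans ?_
  rw [← gMax, mul_assoc (gMax κ R ε)]
  refine mul_le_mul_of_nonneg_left ?_ gMax_pos.le
  rw [← mul_sub, ← mul_sub, abs_mul, abs_mul, abs_of_nonneg hr.1,
    abs_of_pos (by positivity : 0 < κ / 2)]
  simp only [Nat.cast_zero, zero_add, div_one] at h1
  calc κ / 2 * (r * _) ≤ κ / 2 * (R * (2 * N * ε)) := by
        refine mul_le_mul_of_nonneg_left ?_ (by positivity)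
        exact mul_le_mul hr.2 h1 (abs_nonneg _) hR
    _ = κ * R * ε * N := by ring

/-- `P` depends on `f` through `Q = (f - f̄) / r`, so it is only `r P` that is Lipschitz in the sup
norm of `f`. -/
lemma exists_id_mul_metricP (κ Λ R ε : ℝ) (hκ : 0 < κ) (hΛ : 0 < Λ) (hR : 0 ≤ R) :
    ∃ L, 0 ≤ L ∧ ∀ N f₁ f₂ v₁ v₂, IsClosePair R ε N f₁ f₂ v₁ v₂ → ∀ r ∈ Icc 0 R,
      |r * metricP κ Λ v₁ r - r * metricP κ Λ v₂ r| ≤ L * N := by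
  set W := 1 + Λ * R ^ 2
  have hW : 0 ≤ W := by positivity
  refine ⟨|κ * W * ε * gMax κ R ε
    + (κ / 2 * R * (ε / 2) ^ 2 * W + 2 * Λ * R) * (gMax κ R ε * (κ * R * ε))|, abs_nonneg _, ?_⟩
  intro N f₁ f₂ v₁ v₂ h r hr
  have hN : 0 ≤ N := (abs_nonneg _).trans (h.close r hr)
  have hW' := abs_weight_le hΛ hr
  have h1 := h.abs_id_mul_meanSlope_sq_sub_le hr
  have h2 := h.abs_metricG_sub_le hκ hR hr
  have h3 := metricG_le hκ hR h.slice₁.continuousOn h.bound₁ hr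
  have h4 := meanSlope_sq_le h.slice₂.continuousOn h.bound₂ hr
  have hε : 0 ≤ ε := (abs_nonneg _).trans (h.bound₁ r hr)
  set T := fun v : ℝ → ℝ => κ / 2 * (r * meanSlope v r ^ 2) * (1 - Λ * r ^ 2) - 2 * Λ * r with hT
  have e1 : |T v₁ - T v₂| ≤ κ * W * ε * N := by
    have : T v₁ - T v₂ = κ / 2 * (r * meanSlope v₁ r ^ 2 - r * meanSlope v₂ r ^ 2)
        * (1 - Λ * r ^ 2) := by simp only [hT]; ring
    rw [this, abs_mul, abs_mul, abs_of_pos (by positivity : 0 < κ / 2)]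
    calc _ ≤ κ / 2 * (2 * N * ε) * W := by gcongr
      _ = _ := by ring
  have e2 : |T v₂| ≤ κ / 2 * R * (ε / 2) ^ 2 * W + 2 * Λ * R := by
    refine (abs_sub _ _).trans ?_
    rw [abs_mul, abs_mul, abs_mul (2 * Λ), abs_of_pos (by positivity : 0 < κ / 2),
      abs_of_nonneg (mul_nonneg hr.1 (sq_nonneg _)), abs_of_pos (by positivity : 0 < 2 * Λ),
      abs_of_nonneg hr.1, mul_assoc (κ / 2) R]
    have := hr.2
    have := hr.1
    gcongr
  have e3 : r * metricP κ Λ v₁ r - r * metricP κ Λ v₂ r =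
      (T v₁ - T v₂) * metricG κ v₁ r + T v₂ * (metricG κ v₁ r - metricG κ v₂ r) := by
    simp only [hT, metricP]; ring
  rw [e3]
  refine (abs_add_le _ _).trans ?_
  rw [abs_mul, abs_mul, abs_of_pos metricG_pos]
  calc _ ≤ κ * W * ε * N * gMax κ R ε
        + (κ / 2 * R * (ε / 2) ^ 2 * W + 2 * Λ * R) * (gMax κ R ε * (κ * R * ε) * N) := by
        gcongr
        exact metricG_pos.le
    _ = (κ * W * ε * gMax κ R ε
    + (κ / 2 * R * (ε / 2) ^ 2 * W + 2 * Λ * R) * (gMax κ R ε * (κ * R * ε))) * N := by ring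
    _ ≤ _ := mul_le_mul_of_nonneg_right (le_abs_self _) hN

end IsClosePair

/-- The coefficients `g̃ / 2`, `G` and the forcing of the linearised equation depend on `f` in a
Lipschitz way for the uniform norm, as long as `∂_r f` remains bounded. -/
theorem exists_coefficient_lipschitz (κ Λ R ε : ℝ) (hκ : 0 < κ) (hΛ : 0 < Λ) (hR : 0 ≤ R) :
    ∃ L, 0 ≤ L ∧ ∀ N f₁ f₂ v₁ v₂, IsClosePair R ε N f₁ f₂ v₁ v₂ → ∀ r ∈ Icc 0 R,
      |speed κ Λ v₁ r - speed κ Λ v₂ r| ≤ L * N ∧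
      |r * metricM κ Λ v₁ r - r * metricM κ Λ v₂ r| ≤ L * N ∧
      |forcing κ Λ v₁ r - forcing κ Λ v₂ r| ≤ L * N := by
  obtain ⟨L, hL, h⟩ := IsClosePair.exists_id_mul_metricP κ Λ R ε hκ hΛ hR
  have hP := pMax_pos (R := R) (ε := ε) hκ hΛ
  have hG := gMax_pos (κ := κ) (R := R) (ε := ε)
  set A := |gMax κ R ε * (κ * R * ε)| * (1 + Λ * R ^ 2) with hA
  have hA0 : 0 ≤ A := by positivity
  refine ⟨A + L + (2 * L * |ε| + 2 * pMax κ Λ R ε), by positivity, ?_⟩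
  intro N f₁ f₂ v₁ v₂ hp r hr
  have hN : 0 ≤ N := (abs_nonneg _).trans (hp.close r hr)
  have hε : 0 ≤ ε := (abs_nonneg _).trans (hp.bound₁ r hr)
  have hLN : 0 ≤ L * N := mul_nonneg hL hN
  have hAN : 0 ≤ A * N := mul_nonneg hA0 hN
  have hEN : 0 ≤ (2 * L * |ε| + 2 * pMax κ Λ R ε) * N := mul_nonneg (by positivity) hN
  have c1 := continuousOn_metricP κ Λ hR hp.slice₁.continuousOn
  have c2 := continuousOn_metricP κ Λ hR hp.slice₂.continuousOn
  have hM : |r * metricM κ Λ v₁ r - r * metricM κ Λ v₂ r| ≤ L * N / 4 := by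
    have a := abs_moment_sub_moment_le (f := fun s => s * metricP κ Λ v₁ s)
      (k := fun s => s * metricP κ Λ v₂ s) (continuousOn_id.mul c1) (continuousOn_id.mul c2) 1 hr
      fun s hs => h N f₁ f₂ v₁ v₂ hp s hs
    rw [moment_id_mul, moment_id_mul] at a
    have e : r * metricM κ Λ v₁ r - r * metricM κ Λ v₂ r =
        1 / 2 * (r * moment 2 (metricP κ Λ v₁) r - r * moment 2 (metricP κ Λ v₂) r) := by
      simp only [metricM]; ring
    rw [e, abs_mul, abs_of_pos (by norm_num : (0 : ℝ) < 1 / 2)]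
    norm_num at a
    linarith
  refine ⟨?_, ?_, ?_⟩
  · have w : ContinuousOn (fun s : ℝ => 1 - Λ * s ^ 2) (Icc 0 R) := by fun_prop
    have g1 := (continuousOn_metricG κ hR hp.slice₁.continuousOn).mul w
    have g2 := (continuousOn_metricG κ hR hp.slice₂.continuousOn).mul w
    have a := abs_moment_sub_moment_le (f := fun s => metricG κ v₁ s * (1 - Λ * s ^ 2))
      (k := fun s => metricG κ v₂ s * (1 - Λ * s ^ 2)) g1 g2 0 hr (C := A * N) fun s hs => by
      have := hp.abs_metricG_sub_le hκ hR hs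
      rw [← sub_mul, abs_mul, hA]
      calc _ ≤ (gMax κ R ε * (κ * R * ε) * N) * (1 + Λ * R ^ 2) := by
            gcongr
            exact abs_weight_le hΛ hs
        _ ≤ (|gMax κ R ε * (κ * R * ε)| * N) * (1 + Λ * R ^ 2) := by
            gcongr
            exact le_abs_self _
        _ = _ := by ring
    simp only [Nat.cast_zero, zero_add, div_one] at a
    rw [speed, speed, ← mul_sub, abs_mul, abs_of_pos (by norm_num : (0 : ℝ) < 1 / 2)]
    linarith
  · linarith
  · have a1 := h N f₁ f₂ v₁ v₂ hp r hr
    have q1 := abs_meanSlope_le hp.slice₁.continuousOn hp.bound₁ hr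
    have q2 := hp.abs_id_mul_meanSlope_sub_le hr
    have p2 := abs_le.1 (abs_metricP_le hκ hΛ hR hp.slice₂.continuousOn hp.bound₂ hr)
    have m2 := abs_le.1 (abs_metricM_le hκ hΛ hR hp.slice₂.continuousOn hp.bound₂ hr)
    have j2 : |metricP κ Λ v₂ r / 2 - 3 * metricM κ Λ v₂ r| ≤ pMax κ Λ R ε := by
      rw [abs_le]; constructor <;> linarith [p2.1, p2.2, m2.1, m2.2]
    have e : forcing κ Λ v₁ r - forcing κ Λ v₂ r =
        ((r * metricP κ Λ v₁ r - r * metricP κ Λ v₂ r) / 2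
          - 3 * (r * metricM κ Λ v₁ r - r * metricM κ Λ v₂ r)) * meanSlope v₁ r
        + (metricP κ Λ v₂ r / 2 - 3 * metricM κ Λ v₂ r)
          * (r * meanSlope v₁ r - r * meanSlope v₂ r) := by
      simp only [forcing]; ring
    have t1 : |(r * metricP κ Λ v₁ r - r * metricP κ Λ v₂ r) / 2
          - 3 * (r * metricM κ Λ v₁ r - r * metricM κ Λ v₂ r)| ≤ 2 * (L * N) := by
      have x := abs_le.1 a1
      have y := abs_le.1 hM
      rw [abs_le]; constructor <;> linarith [x.1, x.2, y.1, y.2]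
    rw [e]
    refine (abs_add_le _ _).trans ?_
    rw [abs_mul, abs_mul]
    calc _ ≤ 2 * (L * N) * (ε / 2) + pMax κ Λ R ε * (2 * N) := by gcongr
      _ ≤ 2 * (L * N) * |ε| + pMax κ Λ R ε * (2 * N) := by
          rw [abs_of_nonneg hε]; gcongr; linarith
      _ ≤ _ := by linarith

end Lipschitz

/-! ### Characteristics -/

/-- Speeds `c` for which the characteristics `X' = -c(τ, X)` leave `[0, R]` through both ends, so
that no boundary condition is needed in the transport equation `∂_u v - c ∂_r v = S`. -/
structure IsAdmissible (R K L : ℝ) (c : ℝ → ℝ → ℝ) : Prop where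
  pos : 0 < R
  K_nonneg : 0 ≤ K
  L_nonneg : 0 ≤ L
  cont : ContStrip R c
  lipschitz : ∀ u, 0 ≤ u → ∀ r ∈ Icc 0 R, ∀ s ∈ Icc 0 R, |c u r - c u s| ≤ K * |r - s|
  bound : ∀ u, 0 ≤ u → ∀ r ∈ Icc 0 R, |c u r| ≤ L
  inner : ∀ u, 0 ≤ u → 0 < c u 0
  outer : ∀ u, 0 ≤ u → c u R < 0

/-- `X` is a characteristic of the speed `c` on the time interval `[0, u]` that stays in `[0, R]`. -/
structure IsChar (R : ℝ) (c : ℝ → ℝ → ℝ) (u : ℝ) (X : ℝ → ℝ) : Prop where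
  mem : ∀ τ ∈ Icc 0 u, X τ ∈ Icc 0 R
  deriv : ∀ τ ∈ Icc 0 u, HasDerivWithinAt X (-c τ (X τ)) (Icc 0 u) τ

lemma gronwallBound_le {δ K ε x : ℝ} (hK : 0 ≤ K) (hε : 0 ≤ ε) (hx : 0 ≤ x) :
    gronwallBound δ K ε x ≤ (δ + ε * x) * Real.exp (K * x) := by
  have h1 : 1 ≤ Real.exp (K * x) := Real.one_le_exp (by positivity)
  rcases hK.eq_or_lt with rfl | hK
  · simp [gronwallBound_K0]
  · rw [gronwallBound_of_K_ne_0 hK.ne', add_mul, mul_assoc ε]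
    have h2 : Real.exp (K * x) - 1 ≤ K * x * Real.exp (K * x) := by
      have h3 := Real.add_one_le_exp (-(K * x))
      have h4 : Real.exp (-(K * x)) * Real.exp (K * x) = 1 := by rw [← Real.exp_add]; simp
      nlinarith [Real.exp_pos (K * x)]
    refine add_le_add le_rfl ?_
    rw [div_mul_eq_mul_div, div_le_iff₀ hK]
    calc ε * (Real.exp (K * x) - 1) ≤ ε * (K * x * Real.exp (K * x)) := by gcongr
      _ = _ := by ring

lemma hasDerivWithinAt_Ici_of_Icc {f : ℝ → ℝ} {f' a b t : ℝ} (h : HasDerivWithinAt f f' (Icc a b) t)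
    (ht : t ∈ Ico a b) : HasDerivWithinAt f f' (Ici t) t :=
  h.mono_of_mem_nhdsWithin (Icc_mem_nhdsGE_of_mem ht)

namespace IsChar

variable {R u : ℝ} {c : ℝ → ℝ → ℝ} {X : ℝ → ℝ}

lemma mono (h : IsChar R c u X) {w : ℝ} (hw : w ≤ u) : IsChar R c w X where
  mem τ hτ := h.mem τ ⟨hτ.1, hτ.2.trans hw⟩
  deriv τ hτ := (h.deriv τ ⟨hτ.1, hτ.2.trans hw⟩).mono (Icc_subset_Icc_right hw)

lemma continuousOn (h : IsChar R c u X) : ContinuousOn X (Icc 0 u) :=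
  fun τ hτ => (h.deriv τ hτ).continuousWithinAt

lemma sub_mem {τ : ℝ} (hτ : τ ∈ Icc 0 u) : u - τ ∈ Icc 0 u := ⟨by linarith [hτ.2], by linarith [hτ.1]⟩

lemma reverse (h : IsChar R c u X) {τ : ℝ} (hτ : τ ∈ Icc 0 u) :
    HasDerivWithinAt (fun σ => X (u - σ)) (c (u - τ) (X (u - τ))) (Icc 0 u) τ := by
  have h1 : HasDerivWithinAt (fun σ => u - σ) (-1) (Icc 0 u) τ :=
    ((hasDerivAt_id τ).const_sub u).hasDerivWithinAt
  refine ((h.deriv _ (sub_mem hτ)).comp τ h1 fun σ hσ => sub_mem hσ).congr_deriv ?_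
  ring

lemma abs_sub_le {K L : ℝ} (hc : IsAdmissible R K L c) (h : IsChar R c u X) {s t : ℝ}
    (hs : s ∈ Icc 0 u) (ht : t ∈ Icc 0 u) : |X t - X s| ≤ L * |t - s| := by
  refine Convex.norm_image_sub_le_of_norm_hasDerivWithin_le (s := Icc 0 u) h.deriv (fun τ hτ => ?_)
    (convex_Icc 0 u) hs ht
  rw [norm_neg]
  exact hc.bound τ hτ.1 _ (h.mem τ hτ)

/-- Characteristics depend continuously on the speed and on their end point, backwards in time. -/
lemma abs_sub_le_of_speed_le {K L η : ℝ} {c₁ : ℝ → ℝ → ℝ} {X₁ : ℝ → ℝ}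
    (hc : IsAdmissible R K L c) (h : IsChar R c u X) (h₁ : IsChar R c₁ u X₁) (hη : 0 ≤ η)
    (hcc : ∀ τ ∈ Icc 0 u, ∀ x ∈ Icc 0 R, |c₁ τ x - c τ x| ≤ η) {τ : ℝ} (hτ : τ ∈ Icc 0 u) :
    |X₁ τ - X τ| ≤ (|X₁ u - X u| + η * (u - τ)) * Real.exp (K * (u - τ)) := by
  have hK : ((⟨K, hc.K_nonneg⟩ : NNReal) : ℝ) = K := rfl
  have key := dist_le_of_approx_trajectories_ODE_of_mem (a := 0) (b := u)
    (v := fun σ x => c (u - σ) x) (s := fun _ => Icc 0 R) (K := ⟨K, hc.K_nonneg⟩)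
    (f := fun σ => X₁ (u - σ)) (g := fun σ => X (u - σ))
    (f' := fun σ => c₁ (u - σ) (X₁ (u - σ))) (g' := fun σ => c (u - σ) (X (u - σ)))
    (εf := η) (εg := 0) (δ := |X₁ u - X u|)
    (fun σ hσ => LipschitzOnWith.of_dist_le_mul fun x hx y hy =>
      hc.lipschitz _ (sub_mem (Ico_subset_Icc_self hσ)).1 x hx y hy)
    (fun σ hσ => (h₁.reverse hσ).continuousWithinAt)
    (fun σ hσ => hasDerivWithinAt_Ici_of_Icc (h₁.reverse (Ico_subset_Icc_self hσ)) hσ)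
    (fun σ hσ => hcc _ (sub_mem (Ico_subset_Icc_self hσ)) _
      (h₁.mem _ (sub_mem (Ico_subset_Icc_self hσ))))
    (fun σ hσ => h₁.mem _ (sub_mem (Ico_subset_Icc_self hσ)))
    (fun σ hσ => (h.reverse hσ).continuousWithinAt)
    (fun σ hσ => hasDerivWithinAt_Ici_of_Icc (h.reverse (Ico_subset_Icc_self hσ)) hσ)
    (fun σ _ => by simp)
    (fun σ hσ => h.mem _ (sub_mem (Ico_subset_Icc_self hσ)))
    (by simp [Real.dist_eq]) (u - τ) (sub_mem hτ)
  simp only [sub_sub_cancel, sub_zero, add_zero, Real.dist_eq] at key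
  exact key.trans (gronwallBound_le hc.K_nonneg hη (sub_mem hτ).1)

lemma unique {K L : ℝ} (hc : IsAdmissible R K L c) (h : IsChar R c u X) {X₁ : ℝ → ℝ}
    (h₁ : IsChar R c u X₁) (hu : X₁ u = X u) {τ : ℝ} (hτ : τ ∈ Icc 0 u) : X₁ τ = X τ := by
  have := h.abs_sub_le_of_speed_le hc h₁ le_rfl (fun _ _ _ _ => by simp) hτ
  rw [hu] at this
  simp only [sub_self, abs_zero, zero_mul, add_zero] at this
  exact sub_eq_zero.1 (abs_nonpos_iff.1 this)

end IsChar

lemma abs_zero_max_sub_le (a b : ℝ) : |max 0 a - max 0 b| ≤ |a - b| := by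
  rw [max_comm 0 a, max_comm 0 b]
  exact abs_max_sub_max_le_abs _ _ _

lemma abs_clamp_sub_le (R x y : ℝ) : |max 0 (min x R) - max 0 (min y R)| ≤ |x - y| :=
  (abs_zero_max_sub_le _ _).trans ((abs_min_sub_min_le_max x R y R).trans (by simp))

/-- Through every point of the strip passes a backward characteristic; it cannot reach the ends of
`[0, R]` because the speed points outwards there. -/
lemma IsAdmissible.exists_isChar {R K L : ℝ} {c : ℝ → ℝ → ℝ} (hc : IsAdmissible R K L c)
    {u r : ℝ} (hu : 0 ≤ u) (hr : r ∈ Icc 0 R) : ∃ X, IsChar R c u X ∧ X u = r := by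
  have hcl := clamp_mem hc.pos.le
  have hpl : IsPicardLindelof (fun σ x => clampExt R c (u - σ) x)
      (⟨0, left_mem_Icc.2 hu⟩ : Icc 0 u) r ⟨L * u, mul_nonneg hc.L_nonneg hu⟩ 0
      ⟨L, hc.L_nonneg⟩ ⟨K, hc.K_nonneg⟩ := by
    refine ⟨fun t ht => LipschitzOnWith.of_dist_le_mul fun x _ y _ => ?_, fun x _ => ?_,
      fun t ht x _ => ?_, ?_⟩
    · exact (hc.lipschitz _ (le_max_right _ _) _ (hcl x) _ (hcl y)).trans
        (mul_le_mul_of_nonneg_left (abs_clamp_sub_le R x y) hc.K_nonneg)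
    · exact ((hc.cont.continuous_clampExt hc.pos.le).comp
        (f := fun σ : ℝ => (u - σ, x)) (by fun_prop)).continuousOn
    · exact hc.bound _ (le_max_right _ _) _ (hcl x)
    · simp only [sub_zero, sub_self, max_eq_left hu, NNReal.coe_zero]
      exact le_rfl
  obtain ⟨α, h0, hα⟩ := hpl.exists_eq_forall_mem_Icc_hasDerivWithinAt₀
  have hcont : ContinuousOn α (Icc 0 u) := fun σ hσ => (hα σ hσ).continuousWithinAt
  have hα' := fun σ (hσ : σ ∈ Ico 0 u) =>
    hasDerivWithinAt_Ici_of_Icc (hα σ (Ico_subset_Icc_self hσ)) hσ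
  have hmem : ∀ σ ∈ Icc 0 u, α σ ∈ Icc 0 R := by
    intro σ hσ
    constructor
    · have := image_le_of_deriv_right_lt_deriv_boundary (f := fun σ => -α σ)
        (B := fun _ => 0) (B' := fun _ => 0) hcont.neg
        (fun σ hσ => (hα' σ hσ).neg) (by simpa [h0] using hr.1) (fun x => hasDerivAt_const _ _)
        (fun x hx h => ?_) hσ
      · simpa using this
      · have hx0 : α x = 0 := by simpa using h
        simp only [hx0]
        rw [clampExt_eq c (IsChar.sub_mem (Ico_subset_Icc_self hx)).1 (left_mem_Icc.2 hc.pos.le)]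
        linarith [hc.inner _ (IsChar.sub_mem (Ico_subset_Icc_self hx)).1]
    · refine image_le_of_deriv_right_lt_deriv_boundary (f := α)
        (B := fun _ => R) (B' := fun _ => 0) hcont hα' (by simpa [h0] using hr.2)
        (fun x => hasDerivAt_const _ _) (fun x hx h => ?_) hσ
      rw [h, clampExt_eq c (IsChar.sub_mem (Ico_subset_Icc_self hx)).1 (right_mem_Icc.2 hc.pos.le)]
      exact hc.outer _ (IsChar.sub_mem (Ico_subset_Icc_self hx)).1
  refine ⟨fun τ => α (u - τ), ⟨fun τ hτ => hmem _ (IsChar.sub_mem hτ), fun τ hτ => ?_⟩, by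
    simpa using h0⟩
  have h1 : HasDerivWithinAt (fun σ => u - σ) (-1) (Icc 0 u) τ :=
    ((hasDerivAt_id τ).const_sub u).hasDerivWithinAt
  refine ((hα _ (IsChar.sub_mem hτ)).comp τ h1 fun σ hσ => IsChar.sub_mem hσ).congr_deriv ?_
  rw [sub_sub_cancel, clampExt_eq c hτ.1 (hmem _ (IsChar.sub_mem hτ))]
  ring

/-! ### Linear transport equations: existence -/

/-- `v` is continuous on the strip and has derivative `S` along all characteristics of `c`, that is,
`v` solves `∂_u v - c ∂_r v = S` in the sense of characteristics. -/
structure IsTransport (R : ℝ) (c S v : ℝ → ℝ → ℝ) : Prop where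
  cont : ContStrip R v
  deriv : ∀ u X, IsChar R c u X → ∀ τ ∈ Icc 0 u,
    HasDerivWithinAt (fun t => v t (X t)) (S τ (X τ)) (Icc 0 u) τ

/-- The solution at time `τ` of the ODE `y' = α y + β`, `y 0 = y₀`. -/
noncomputable def linearODE (α β : ℝ → ℝ) (y₀ τ : ℝ) : ℝ :=
  Real.exp (∫ s in (0 : ℝ)..τ, α s) *
    (y₀ + ∫ s in (0 : ℝ)..τ, β s * Real.exp (-∫ t in (0 : ℝ)..s, α t))

lemma hasDerivAt_linearODE {α β : ℝ → ℝ} (hα : Continuous α) (hβ : Continuous β) (y₀ τ : ℝ) :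
    HasDerivAt (linearODE α β y₀) (α τ * linearODE α β y₀ τ + β τ) τ := by
  have h1 : ∀ s, HasDerivAt (fun s => ∫ t in (0 : ℝ)..s, α t) (α s) s := fun s =>
    intervalIntegral.integral_hasDerivAt_right (hα.intervalIntegrable _ _)
      (hα.stronglyMeasurableAtFilter _ _) hα.continuousAt
  have hA : Continuous (fun s => ∫ t in (0 : ℝ)..s, α t) :=
    continuous_iff_continuousAt.2 fun s => (h1 s).continuousAt
  have hβ' : Continuous (fun s => β s * Real.exp (-∫ t in (0 : ℝ)..s, α t)) := by fun_prop
  have h2 := (intervalIntegral.integral_hasDerivAt_right (hβ'.intervalIntegrable 0 τ)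
      (hβ'.stronglyMeasurableAtFilter _ _) hβ'.continuousAt).const_add y₀
  refine ((h1 τ).exp.mul h2).congr_deriv ?_
  have h3 : Real.exp (∫ t in (0 : ℝ)..τ, α t) * Real.exp (-∫ t in (0 : ℝ)..τ, α t) = 1 := by
    rw [← Real.exp_add]; simp
  unfold linearODE
  linear_combination β τ * h3

lemma linearODE_congr {α β α' β' : ℝ → ℝ} {y₀ τ : ℝ} (hτ : 0 ≤ τ)
    (hα : ∀ s ∈ Icc 0 τ, α s = α' s) (hβ : ∀ s ∈ Icc 0 τ, β s = β' s) :
    linearODE α β y₀ τ = linearODE α' β' y₀ τ := by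
  have h : ∀ s ∈ Icc 0 τ, ∫ t in (0 : ℝ)..s, α t = ∫ t in (0 : ℝ)..s, α' t := fun s hs =>
    intervalIntegral.integral_congr fun t ht => by
      rw [uIcc_of_le hs.1] at ht
      exact hα t ⟨ht.1, ht.2.trans hs.2⟩
  unfold linearODE
  rw [h τ (right_mem_Icc.2 hτ)]
  congr 2
  refine intervalIntegral.integral_congr fun s hs => ?_
  rw [uIcc_of_le hτ] at hs
  simp only [h s hs, hβ s hs]

lemma abs_clamp_time_sub_le (s t u w : ℝ) :
    |max 0 (min s u) - max 0 (min t w)| ≤ |s - t| + |u - w| := by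
  refine (abs_zero_max_sub_le _ _).trans
    ((abs_min_sub_min_le_max s u t w).trans ?_)
  exact max_le (by linarith [abs_nonneg (u - w)]) (by linarith [abs_nonneg (s - t)])

/-- The backward characteristics through all points of the plane, after projection of the end point
to the strip and of the time to the domain of the characteristic. They form a jointly continuous
family. -/
lemma IsAdmissible.exists_continuous_flow {R K L : ℝ} {c : ℝ → ℝ → ℝ} (hc : IsAdmissible R K L c) :
    ∃ Φ : ℝ → ℝ → ℝ → ℝ, Continuous (fun q : ℝ × ℝ × ℝ => Φ q.1 q.2.1 q.2.2) ∧
      ∀ u, 0 ≤ u → ∀ r ∈ Icc 0 R, IsChar R c u (Φ u r) ∧ Φ u r u = r := by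
  choose! X hX using fun u r (h : 0 ≤ u ∧ r ∈ Icc 0 R) => hc.exists_isChar h.1 h.2
  set u' : ℝ → ℝ := fun u => max u 0
  set r' : ℝ → ℝ := fun r => max 0 (min r R)
  have hX' : ∀ u r, IsChar R c (u' u) (X (u' u) (r' r)) ∧ X (u' u) (r' r) (u' u) = r' r :=
    fun u r => hX _ _ ⟨le_max_right _ _, clamp_mem hc.pos.le r⟩
  set Φ : ℝ → ℝ → ℝ → ℝ := fun u r s => X (u' u) (r' r) (max 0 (min s (u' u))) with hΦ
  have huu : ∀ u w, |u' u - u' w| ≤ |u - w| := fun u w => abs_max_sub_max_le_abs _ _ _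
  have est1 : ∀ u₁ r₁ s₁ u₂ r₂ s₂, u' u₁ ≤ u' u₂ → |Φ u₁ r₁ s₁ - Φ u₂ r₂ s₂| ≤
      L * (|s₁ - s₂| + |u₁ - u₂|)
        + (|r₁ - r₂| + L * |u₁ - u₂|) * Real.exp (K * max (u' u₁) (u' u₂)) := by
    intro u₁ r₁ s₁ u₂ r₂ s₂ h12
    obtain ⟨c1, e1⟩ := hX' u₁ r₁
    obtain ⟨c2, e2⟩ := hX' u₂ r₂
    have h10 : 0 ≤ u' u₁ := le_max_right _ _
    have h20 : 0 ≤ u' u₂ := le_max_right _ _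
    have m1 := clamp_mem h10 s₁
    have m2 := clamp_mem h20 s₂
    have m12 : max 0 (min s₁ (u' u₁)) ∈ Icc 0 (u' u₂) := ⟨m1.1, m1.2.trans h12⟩
    have a1 := c2.abs_sub_le hc m2 m12
    have a2 := (c2.mono h12).abs_sub_le_of_speed_le hc c1 le_rfl (fun _ _ _ _ => by simp) m1
    have a3 := c2.abs_sub_le hc (s := u' u₂) (t := u' u₁) (right_mem_Icc.2 h20) ⟨h10, h12⟩
    have a4 := abs_clamp_time_sub_le s₁ s₂ (u' u₁) (u' u₂)
    have a5 := huu u₁ u₂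
    have a6 : |X (u' u₁) (r' r₁) (u' u₁) - X (u' u₂) (r' r₂) (u' u₁)| ≤
        |r₁ - r₂| + L * |u₁ - u₂| := by
      have b1 := abs_clamp_sub_le R r₁ r₂
      have b2 := mul_le_mul_of_nonneg_left a5 hc.L_nonneg
      rw [e1]
      rw [e2] at a3
      calc |r' r₁ - X (u' u₂) (r' r₂) (u' u₁)|
          = |(r' r₁ - r' r₂) - (X (u' u₂) (r' r₂) (u' u₁) - r' r₂)| := by ring_nf
        _ ≤ |r' r₁ - r' r₂| + |X (u' u₂) (r' r₂) (u' u₁) - r' r₂| := abs_sub _ _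
        _ ≤ _ := by linarith
    simp only [zero_mul, add_zero] at a2
    have a7 : Real.exp (K * (u' u₁ - max 0 (min s₁ (u' u₁)))) ≤
        Real.exp (K * max (u' u₁) (u' u₂)) := by
      refine Real.exp_le_exp.2 (mul_le_mul_of_nonneg_left ?_ hc.K_nonneg)
      linarith [m1.1, le_max_left (u' u₁) (u' u₂)]
    calc |Φ u₁ r₁ s₁ - Φ u₂ r₂ s₂| ≤
        |X (u' u₂) (r' r₂) (max 0 (min s₁ (u' u₁))) - X (u' u₂) (r' r₂) (max 0 (min s₂ (u' u₂)))|
        + |X (u' u₁) (r' r₁) (max 0 (min s₁ (u' u₁)))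
            - X (u' u₂) (r' r₂) (max 0 (min s₁ (u' u₁)))| := by
          rw [add_comm]; exact abs_sub_le _ _ _
      _ ≤ _ := by
          refine add_le_add (a1.trans (mul_le_mul_of_nonneg_left (by linarith) hc.L_nonneg))
            (a2.trans (mul_le_mul a6 a7 (Real.exp_pos _).le ?_))
          have := hc.L_nonneg
          positivity
  have est : ∀ u₁ r₁ s₁ u₂ r₂ s₂, |Φ u₁ r₁ s₁ - Φ u₂ r₂ s₂| ≤
      L * (|s₁ - s₂| + |u₁ - u₂|)
        + (|r₁ - r₂| + L * |u₁ - u₂|) * Real.exp (K * max (u' u₁) (u' u₂)) := by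
    intro u₁ r₁ s₁ u₂ r₂ s₂
    rcases le_total (u' u₁) (u' u₂) with h | h
    · exact est1 _ _ _ _ _ _ h
    · have := est1 u₂ r₂ s₂ u₁ r₁ s₁ h
      rwa [abs_sub_comm, abs_sub_comm s₂, abs_sub_comm u₂, abs_sub_comm r₂, max_comm] at this
  refine ⟨Φ, ?_, fun u hu r hr => ?_⟩
  · rw [continuous_iff_continuousAt]
    rintro ⟨u, r, s⟩
    rw [ContinuousAt, tendsto_iff_dist_tendsto_zero]
    have hlim : Tendsto (fun q : ℝ × ℝ × ℝ => L * (|q.2.2 - s| + |q.1 - u|)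
        + (|q.2.1 - r| + L * |q.1 - u|) * Real.exp (K * max (u' q.1) (u' u)))
        (𝓝 (u, r, s)) (𝓝 0) := by
      have : Continuous (fun q : ℝ × ℝ × ℝ => L * (|q.2.2 - s| + |q.1 - u|)
        + (|q.2.1 - r| + L * |q.1 - u|) * Real.exp (K * max (u' q.1) (u' u))) := by
        simp only [u']; fun_prop
      simpa using this.tendsto (u, r, s)
    exact squeeze_zero (fun _ => dist_nonneg) (fun q => est _ _ _ _ _ _) hlim
  · have e1 : u' u = u := max_eq_left hu
    have e2 : r' r = r := by simp only [r']; rw [min_eq_left hr.2, max_eq_right hr.1]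
    have hc1 := hX' u r
    rw [e1, e2] at hc1
    have e3 : ∀ s ∈ Icc 0 u, Φ u r s = X u r s := fun s hs => by
      simp only [hΦ]; rw [e1, e2, min_eq_left hs.2, max_eq_right hs.1]
    refine ⟨⟨fun τ hτ => by rw [e3 τ hτ]; exact hc1.1.mem τ hτ, fun τ hτ => ?_⟩, ?_⟩
    · rw [e3 τ hτ]
      exact (hc1.1.deriv τ hτ).congr e3 (e3 τ hτ)
    · rw [e3 u (right_mem_Icc.2 hu)]; exact hc1.2

/-- Existence for linear transport equations, by integration along characteristics. -/
theorem IsAdmissible.exists_isTransport {R K L : ℝ} {c a b : ℝ → ℝ → ℝ} {v₀ : ℝ → ℝ}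
    (hc : IsAdmissible R K L c) (ha : ContStrip R a) (hb : ContStrip R b)
    (hv₀ : ContinuousOn v₀ (Icc 0 R)) :
    ∃ v, IsTransport R c (fun u r => a u r * v u r + b u r) v ∧ ∀ r ∈ Icc 0 R, v 0 r = v₀ r := by
  obtain ⟨Φ, hΦc, hΦ⟩ := hc.exists_continuous_flow
  have hA := ha.continuous_clampExt hc.pos.le
  have hB := hb.continuous_clampExt hc.pos.le
  have hV := (ContStrip.of_slice hv₀).continuous_clampExt hc.pos.le
  set A := clampExt R a
  set B := clampExt R b
  set V := clampExt R (fun _ r => v₀ r) 0 with hVdef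
  set v : ℝ → ℝ → ℝ := fun u r => linearODE (fun s => A s (Φ u r s)) (fun s => B s (Φ u r s))
    (V (Φ u r 0)) u with hv
  have cA : Continuous (fun q : (ℝ × ℝ) × ℝ => A q.2 (Φ q.1.1 q.1.2 q.2)) :=
    hA.comp (f := fun q : (ℝ × ℝ) × ℝ => (q.2, Φ q.1.1 q.1.2 q.2))
      (continuous_snd.prodMk (hΦc.comp (f := fun q : (ℝ × ℝ) × ℝ => (q.1.1, q.1.2, q.2))
        (by fun_prop)))
  have cB : Continuous (fun q : (ℝ × ℝ) × ℝ => B q.2 (Φ q.1.1 q.1.2 q.2)) :=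
    hB.comp (f := fun q : (ℝ × ℝ) × ℝ => (q.2, Φ q.1.1 q.1.2 q.2))
      (continuous_snd.prodMk (hΦc.comp (f := fun q : (ℝ × ℝ) × ℝ => (q.1.1, q.1.2, q.2))
        (by fun_prop)))
  have cI : Continuous (fun q : (ℝ × ℝ) × ℝ => ∫ t in (0 : ℝ)..q.2, A t (Φ q.1.1 q.1.2 t)) :=
    intervalIntegral.continuous_parametric_intervalIntegral_of_continuous
      (f := fun (q : (ℝ × ℝ) × ℝ) t => A t (Φ q.1.1 q.1.2 t))
      (cA.comp (f := fun q : ((ℝ × ℝ) × ℝ) × ℝ => (q.1.1, q.2)) (by fun_prop)) continuous_snd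
  have cJ : Continuous (fun p : ℝ × ℝ => ∫ s in (0 : ℝ)..p.1,
      B s (Φ p.1 p.2 s) * Real.exp (-∫ t in (0 : ℝ)..s, A t (Φ p.1 p.2 t))) :=
    intervalIntegral.continuous_parametric_intervalIntegral_of_continuous
      (f := fun (p : ℝ × ℝ) s => B s (Φ p.1 p.2 s) *
        Real.exp (-∫ t in (0 : ℝ)..s, A t (Φ p.1 p.2 t)))
      (cB.mul (Real.continuous_exp.comp cI.neg)) continuous_fst
  have cV : Continuous (fun p : ℝ × ℝ => V (Φ p.1 p.2 0)) :=
    hV.comp (f := fun p : ℝ × ℝ => (0, Φ p.1 p.2 0))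
      (continuous_const.prodMk (hΦc.comp (f := fun p : ℝ × ℝ => (p.1, p.2, 0)) (by fun_prop)))
  have cv : Continuous (fun p : ℝ × ℝ => v p.1 p.2) :=
    (Real.continuous_exp.comp (cI.comp (f := fun p : ℝ × ℝ => ((p.1, p.2), p.1))
      (by fun_prop))).mul (cV.add cJ)
  refine ⟨v, ⟨cv.continuousOn, fun u X hX τ hτ => ?_⟩, fun r hr => ?_⟩
  · have hu : 0 ≤ u := hτ.1.trans hτ.2
    -- the characteristic is made constant outside `[0, u]` to have continuous coefficients
    set Y : ℝ → ℝ := fun s => X (max 0 (min s u)) with hY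
    have hYc : Continuous Y := hX.continuousOn.comp_continuous (by fun_prop) (clamp_mem hu)
    have hYX : ∀ s ∈ Icc 0 u, Y s = X s := fun s hs => by
      simp only [hY]; rw [min_eq_left hs.2, max_eq_right hs.1]
    have cα : Continuous (fun s => A s (Y s)) :=
      hA.comp (f := fun s => (s, Y s)) (by fun_prop)
    have cβ : Continuous (fun s => B s (Y s)) :=
      hB.comp (f := fun s => (s, Y s)) (by fun_prop)
    have heq : ∀ t ∈ Icc 0 u, v t (X t) =
        linearODE (fun s => A s (Y s)) (fun s => B s (Y s)) (V (X 0)) t := by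
      intro t ht
      obtain ⟨h1, h2⟩ := hΦ t ht.1 (X t) (hX.mem t ht)
      have h3 : ∀ s ∈ Icc 0 t, Φ t (X t) s = X s := fun s hs =>
        (hX.mono ht.2).unique hc h1 h2 hs
      simp only [hv]
      rw [h3 0 (left_mem_Icc.2 ht.1)]
      refine linearODE_congr ht.1 (fun s hs => ?_) (fun s hs => ?_) <;>
      rw [h3 s hs, hYX s ⟨hs.1, hs.2.trans ht.2⟩]
    have hd := (hasDerivAt_linearODE cα cβ (V (X 0)) τ).hasDerivWithinAt (s := Icc 0 u)
    refine (hd.congr heq (heq τ hτ)).congr_deriv ?_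
    rw [← heq τ hτ, hYX τ hτ]
    simp only [A, B]
    rw [clampExt_eq a hτ.1 (hX.mem τ hτ), clampExt_eq b hτ.1 (hX.mem τ hτ)]
  · have h2 := (hΦ 0 le_rfl r hr).2
    simp only [hv, linearODE, intervalIntegral.integral_same, Real.exp_zero, one_mul, add_zero, h2,
      hVdef]
    exact clampExt_eq (fun _ r => v₀ r) le_rfl hr

/-! ### Linear transport equations: regularity, comparison and stability -/

section Compactness

variable {R : ℝ} {f : ℝ → ℝ → ℝ}

lemma ContStrip.continuousOn_Icc (hf : ContStrip R f) (U : ℝ) :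
    ContinuousOn (fun p : ℝ × ℝ => f p.1 p.2) (Icc 0 U ×ˢ Icc 0 R) :=
  ContinuousOn.mono hf (prod_mono Icc_subset_Ici_self Subset.rfl)

lemma ContStrip.exists_bound (hf : ContStrip R f) (U : ℝ) :
    ∃ C, 0 ≤ C ∧ ∀ τ ∈ Icc 0 U, ∀ x ∈ Icc 0 R, |f τ x| ≤ C := by
  obtain ⟨C, hC⟩ := (isCompact_Icc.prod isCompact_Icc).exists_bound_of_continuousOn
    (hf.continuousOn_Icc U)
  exact ⟨|C|, abs_nonneg _, fun τ hτ x hx => (hC (τ, x) ⟨hτ, hx⟩).trans (le_abs_self _)⟩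

lemma ContStrip.exists_unif_cont (hf : ContStrip R f) (U : ℝ) {ε : ℝ} (hε : 0 < ε) :
    ∃ d, 0 < d ∧ ∀ τ ∈ Icc 0 U, ∀ x ∈ Icc 0 R, ∀ y ∈ Icc 0 R, |x - y| < d →
      |f τ x - f τ y| ≤ ε := by
  have h := (isCompact_Icc.prod isCompact_Icc).uniformContinuousOn_of_continuous
    (hf.continuousOn_Icc U)
  obtain ⟨d, hd, H⟩ := Metric.uniformContinuousOn_iff.1 h ε hε
  refine ⟨d, hd, fun τ hτ x hx y hy hxy => ?_⟩
  have := H (τ, x) ⟨hτ, hx⟩ (τ, y) ⟨hτ, hy⟩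
    (by simpa [Prod.dist_eq, Real.dist_eq, hd] using hxy)
  exact this.le

end Compactness

/-- Mean value inequality for a function whose derivative is close to a constant. -/
lemma abs_sub_sub_mul_le {s : Set ℝ} {f f' : ℝ → ℝ} {m ε x y : ℝ}
    (hf : ∀ x ∈ s, HasDerivWithinAt f (f' x) s x) (hb : ∀ x ∈ s, |f' x - m| ≤ ε)
    (hs : Convex ℝ s) (hx : x ∈ s) (hy : y ∈ s) : |f y - f x - m * (y - x)| ≤ ε * |y - x| := by
  have h := Convex.norm_image_sub_le_of_norm_hasDerivWithin_le (f := fun z => f z - m * z)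
    (fun z hz => ((hf z hz).sub ((hasDerivAt_id z).const_mul m).hasDerivWithinAt).congr_deriv
      (by rw [mul_one])) hb hs hx hy
  have e : f y - f x - m * (y - x) = f y - m * y - (f x - m * x) := by ring
  rw [e]
  exact h

lemma hasDerivWithinAt_of_forall {s : Set ℝ} {f : ℝ → ℝ} {m x : ℝ}
    (h : ∀ η, 0 < η → ∃ d, 0 < d ∧ ∀ y ∈ s, |y - x| < d →
      |f y - f x - m * (y - x)| ≤ η * |y - x|) : HasDerivWithinAt f m s x := by
  rw [hasDerivWithinAt_iff_isLittleO, Asymptotics.isLittleO_iff]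
  intro η hη
  obtain ⟨d, hd, H⟩ := h η hη
  filter_upwards [self_mem_nhdsWithin, mem_nhdsWithin_of_mem_nhds (Metric.ball_mem_nhds x hd)]
    with y hy hyd
  have := H y hy hyd
  simpa [mul_comm] using this

lemma ContStrip.exists_unif_diff {R : ℝ} {f f' : ℝ → ℝ → ℝ} (hf' : ContStrip R f')
    (hf : ∀ u, 0 ≤ u → ∀ r ∈ Icc 0 R, HasDerivWithinAt (f u) (f' u r) (Icc 0 R) r)
    (U : ℝ) {ε : ℝ} (hε : 0 < ε) :
    ∃ d, 0 < d ∧ ∀ τ ∈ Icc 0 U, ∀ x ∈ Icc 0 R, ∀ y ∈ Icc 0 R, |y - x| < d →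
      |f τ y - f τ x - f' τ x * (y - x)| ≤ ε * |y - x| := by
  obtain ⟨d, hd, H⟩ := hf'.exists_unif_cont U hε
  refine ⟨d, hd, fun τ hτ x hx y hy hxy => ?_⟩
  refine abs_sub_sub_mul_le (s := Icc 0 R ∩ Metric.ball x d) (f' := f' τ)
    (fun z hz => (hf τ hτ.1 z hz.1).mono inter_subset_left)
    (fun z hz => H τ hτ z hz.1 x hx hz.2) ((convex_Icc 0 R).inter (convex_ball x d))
    ⟨hx, Metric.mem_ball_self hd⟩ ⟨hy, hxy⟩

/-- The radial derivative of a solution of a linear transport equation solves the differentiated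
equation. The derivative is not assumed to exist: it is compared with the solution `w` of the
differentiated equation along neighbouring characteristics. -/
theorem IsTransport.hasDerivWithinAt {R K L : ℝ} {c c' a a' b b' v w : ℝ → ℝ → ℝ}
    (hc : IsAdmissible R K L c) (hc' : ContStrip R c')
    (hcd : ∀ u, 0 ≤ u → ∀ r ∈ Icc 0 R, HasDerivWithinAt (c u) (c' u r) (Icc 0 R) r)
    (ha : ContStrip R a) (ha' : ContStrip R a')
    (had : ∀ u, 0 ≤ u → ∀ r ∈ Icc 0 R, HasDerivWithinAt (a u) (a' u r) (Icc 0 R) r)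
    (hb' : ContStrip R b')
    (hbd : ∀ u, 0 ≤ u → ∀ r ∈ Icc 0 R, HasDerivWithinAt (b u) (b' u r) (Icc 0 R) r)
    (hv : IsTransport R c (fun u r => a u r * v u r + b u r) v)
    (hw : IsTransport R c (fun u r => (a u r + c' u r) * w u r + (a' u r * v u r + b' u r)) w)
    (h0 : ∀ r ∈ Icc 0 R, HasDerivWithinAt (v 0) (w 0 r) (Icc 0 R) r)
    {u r : ℝ} (hu : 0 ≤ u) (hr : r ∈ Icc 0 R) :
    HasDerivWithinAt (v u) (w u r) (Icc 0 R) r := by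
  obtain ⟨A, hA0, hA⟩ := ha.exists_bound u
  obtain ⟨A', hA'0, hA'⟩ := ha'.exists_bound u
  obtain ⟨V, hV0, hV⟩ := hv.cont.exists_bound u
  obtain ⟨W, hW0, hW⟩ := hw.cont.exists_bound u
  set B := Real.exp (K * u)
  set C := V + A' + 2 + W
  set C' := (B + C * B * u) * Real.exp (A * u) with hC'
  have hB0 : 0 < B := Real.exp_pos _
  have hC0 : 0 < C := by positivity
  have hC'0 : 0 < C' := by positivity
  obtain ⟨X₁, hX₁, e₁⟩ := hc.exists_isChar hu hr
  refine hasDerivWithinAt_of_forall fun η hη => ?_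
  set ε := min 1 (η / C')
  have hε : 0 < ε := lt_min one_pos (div_pos hη hC'0)
  obtain ⟨d1, hd1, H1⟩ := ha'.exists_unif_diff had u hε
  obtain ⟨d2, hd2, H2⟩ := hb'.exists_unif_diff hbd u hε
  obtain ⟨d3, hd3, H3⟩ := hc'.exists_unif_diff hcd u hε
  obtain ⟨d4, hd4, H4⟩ := hv.cont.exists_unif_cont u hε
  obtain ⟨d5, hd5, H5⟩ := (ContStrip.of_slice (hw.cont.slice le_rfl)).exists_unif_diff
    (f := fun _ => v 0) (fun _ _ => h0) u hε
  set d := min d1 (min d2 (min d3 (min d4 d5))) with hd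
  have hdpos : 0 < d := by simp only [hd, lt_min_iff]; tauto
  refine ⟨d / B, div_pos hdpos hB0, fun y hy hyr => ?_⟩
  obtain ⟨X₂, hX₂, e₂⟩ := hc.exists_isChar hu hy
  have hρ : |y - r| * B < d := (lt_div_iff₀ hB0).1 hyr
  have hδ : ∀ τ ∈ Icc 0 u, |X₂ τ - X₁ τ| ≤ |y - r| * B := fun τ hτ => by
    have := hX₁.abs_sub_le_of_speed_le hc hX₂ le_rfl (fun _ _ _ _ => by simp) hτ
    rw [e₁, e₂, zero_mul, add_zero] at this
    refine this.trans (mul_le_mul_of_nonneg_left (Real.exp_le_exp.2 ?_) (abs_nonneg _))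
    exact mul_le_mul_of_nonneg_left (by linarith [hτ.1]) hc.K_nonneg
  set z : ℝ → ℝ := fun τ => v τ (X₂ τ) - v τ (X₁ τ) - w τ (X₁ τ) * (X₂ τ - X₁ τ) with hz
  set z' : ℝ → ℝ := fun τ => a τ (X₂ τ) * v τ (X₂ τ) + b τ (X₂ τ)
    - (a τ (X₁ τ) * v τ (X₁ τ) + b τ (X₁ τ))
    - (((a τ (X₁ τ) + c' τ (X₁ τ)) * w τ (X₁ τ) + (a' τ (X₁ τ) * v τ (X₁ τ) + b' τ (X₁ τ)))
        * (X₂ τ - X₁ τ) + w τ (X₁ τ) * (-c τ (X₂ τ) - -c τ (X₁ τ))) with hz'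
  have hzd : ∀ τ ∈ Icc 0 u, HasDerivWithinAt z (z' τ) (Icc 0 u) τ := fun τ hτ =>
    ((hv.deriv u X₂ hX₂ τ hτ).sub (hv.deriv u X₁ hX₁ τ hτ)).sub
      ((hw.deriv u X₁ hX₁ τ hτ).mul ((hX₂.deriv τ hτ).sub (hX₁.deriv τ hτ)))
  have hz'b : ∀ τ ∈ Icc 0 u, |z' τ| ≤ A * |z τ| + ε * C * (|y - r| * B) := by
    intro τ hτ
    have m1 := hX₁.mem τ hτ
    have m2 := hX₂.mem τ hτ
    have hdτ := (hδ τ hτ).trans_lt hρ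
    simp only [hd, lt_min_iff] at hdτ
    have E1 := H1 τ hτ _ m1 _ m2 hdτ.1
    have E2 := H2 τ hτ _ m1 _ m2 hdτ.2.1
    have E3 := H3 τ hτ _ m1 _ m2 hdτ.2.2.1
    have E4 := H4 τ hτ _ m2 _ m1 hdτ.2.2.2.1
    have E5 : |a τ (X₂ τ) - a τ (X₁ τ)| ≤ (A' + 1) * |X₂ τ - X₁ τ| := by
      have : a τ (X₂ τ) - a τ (X₁ τ) = (a τ (X₂ τ) - a τ (X₁ τ) - a' τ (X₁ τ) * (X₂ τ - X₁ τ))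
        + a' τ (X₁ τ) * (X₂ τ - X₁ τ) := by ring
      rw [this]
      refine (abs_add_le _ _).trans ?_
      rw [abs_mul]
      have g1 := mul_le_mul_of_nonneg_right (hA' τ hτ _ m1) (abs_nonneg (X₂ τ - X₁ τ))
      have g2 := mul_le_mul_of_nonneg_right (min_le_left 1 (η / C')) (abs_nonneg (X₂ τ - X₁ τ))
      linarith
    have key : z' τ = a τ (X₁ τ) * z τ
        + (a τ (X₂ τ) - a τ (X₁ τ) - a' τ (X₁ τ) * (X₂ τ - X₁ τ)) * v τ (X₁ τ)
        + (a τ (X₂ τ) - a τ (X₁ τ)) * (v τ (X₂ τ) - v τ (X₁ τ))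
        + (b τ (X₂ τ) - b τ (X₁ τ) - b' τ (X₁ τ) * (X₂ τ - X₁ τ))
        + w τ (X₁ τ) * (c τ (X₂ τ) - c τ (X₁ τ) - c' τ (X₁ τ) * (X₂ τ - X₁ τ)) := by
      simp only [hz, hz']; ring
    have g0 : |a τ (X₁ τ) * z τ| ≤ A * |z τ| := by
      rw [abs_mul]; exact mul_le_mul_of_nonneg_right (hA τ hτ _ m1) (abs_nonneg _)
    have g1 : |(a τ (X₂ τ) - a τ (X₁ τ) - a' τ (X₁ τ) * (X₂ τ - X₁ τ)) * v τ (X₁ τ)|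
        ≤ ε * |X₂ τ - X₁ τ| * V := by
      rw [abs_mul]; exact mul_le_mul E1 (hV τ hτ _ m1) (abs_nonneg _) (by positivity)
    have g2 : |(a τ (X₂ τ) - a τ (X₁ τ)) * (v τ (X₂ τ) - v τ (X₁ τ))|
        ≤ (A' + 1) * |X₂ τ - X₁ τ| * ε := by
      rw [abs_mul]; exact mul_le_mul E5 E4 (abs_nonneg _) (by positivity)
    have g3 : |w τ (X₁ τ) * (c τ (X₂ τ) - c τ (X₁ τ) - c' τ (X₁ τ) * (X₂ τ - X₁ τ))|
        ≤ W * (ε * |X₂ τ - X₁ τ|) := by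
      rw [abs_mul]; exact mul_le_mul (hW τ hτ _ m1) E3 (abs_nonneg _) hW0
    have g4 : ε * C * |X₂ τ - X₁ τ| ≤ ε * C * (|y - r| * B) :=
      mul_le_mul_of_nonneg_left (hδ τ hτ) (by positivity)
    rw [key]
    refine (abs_add_le _ _).trans ?_
    have t1 := abs_add_le (a τ (X₁ τ) * z τ
        + (a τ (X₂ τ) - a τ (X₁ τ) - a' τ (X₁ τ) * (X₂ τ - X₁ τ)) * v τ (X₁ τ)
        + (a τ (X₂ τ) - a τ (X₁ τ)) * (v τ (X₂ τ) - v τ (X₁ τ)))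
        (b τ (X₂ τ) - b τ (X₁ τ) - b' τ (X₁ τ) * (X₂ τ - X₁ τ))
    have t2 := abs_add_three (a τ (X₁ τ) * z τ)
      ((a τ (X₂ τ) - a τ (X₁ τ) - a' τ (X₁ τ) * (X₂ τ - X₁ τ)) * v τ (X₁ τ))
      ((a τ (X₂ τ) - a τ (X₁ τ)) * (v τ (X₂ τ) - v τ (X₁ τ)))
    have t3 : ε * C * |X₂ τ - X₁ τ| = ε * |X₂ τ - X₁ τ| * V + (A' + 1) * |X₂ τ - X₁ τ| * ε
      + ε * |X₂ τ - X₁ τ| + W * (ε * |X₂ τ - X₁ τ|) := by simp only [C]; ring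
    linarith
  have hz0 : |z 0| ≤ ε * (|y - r| * B) := by
    have m0 : (0 : ℝ) ∈ Icc 0 u := left_mem_Icc.2 hu
    have hdτ := (hδ 0 m0).trans_lt hρ
    simp only [hd, lt_min_iff] at hdτ
    exact (H5 0 m0 _ (hX₁.mem 0 m0) _ (hX₂.mem 0 m0) hdτ.2.2.2.2).trans
      (mul_le_mul_of_nonneg_left (hδ 0 m0) hε.le)
  have hgr := norm_le_gronwallBound_of_norm_deriv_right_le (f := z) (f' := z')
    (fun τ hτ => (hzd τ hτ).continuousWithinAt)
    (fun τ hτ => hasDerivWithinAt_Ici_of_Icc (hzd τ (Ico_subset_Icc_self hτ)) hτ) hz0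
    (fun τ hτ => hz'b τ (Ico_subset_Icc_self hτ)) u (right_mem_Icc.2 hu)
  have hfin := hgr.trans (gronwallBound_le hA0 (by positivity) (by simpa using hu))
  have hzu : z u = v u y - v u r - w u r * (y - r) := by simp only [hz]; rw [e₁, e₂]
  rw [hzu, sub_zero] at hfin
  refine hfin.trans ?_
  have h3 : ε * C' ≤ η := by
    have := min_le_right 1 (η / C')
    calc ε * C' ≤ η / C' * C' := mul_le_mul_of_nonneg_right this hC'0.le
      _ = η := by field_simp
  calc _ = ε * C' * |y - r| := by rw [hC']; ring
    _ ≤ _ := mul_le_mul_of_nonneg_right h3 (abs_nonneg _)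

/-- A solution in the sense of characteristics that is differentiable in `r` is differentiable
in `u` and solves the equation classically. -/
theorem IsTransport.hasDerivWithinAt_time {R K L : ℝ} {c S v w : ℝ → ℝ → ℝ}
    (hc : IsAdmissible R K L c) (hS : ContStrip R S) (hv : IsTransport R c S v)
    (hw : ContStrip R w)
    (hvw : ∀ u, 0 ≤ u → ∀ r ∈ Icc 0 R, HasDerivWithinAt (v u) (w u r) (Icc 0 R) r)
    {u r : ℝ} (hu : 0 ≤ u) (hr : r ∈ Icc 0 R) :
    HasDerivWithinAt (fun t => v t r) (c u r * w u r + S u r) (Ici 0) u := by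
  have hL := hc.L_nonneg
  have hloc : ∀ {f : ℝ → ℝ → ℝ}, ContStrip R f → ∀ ε, 0 < ε → ∃ d, 0 < d ∧ ∀ t x, 0 ≤ t →
      x ∈ Icc 0 R → |t - u| < d → |x - r| < d → |f t x - f u r| ≤ ε := by
    intro f hf ε hε
    obtain ⟨d, hd, H⟩ := Metric.continuousWithinAt_iff.1 (hf (u, r) ⟨hu, hr⟩) ε hε
    exact ⟨d, hd, fun t x ht hx h1 h2 => (H (x := (t, x)) ⟨ht, hx⟩ (by
      simpa [Prod.dist_eq, Real.dist_eq] using ⟨h1, h2⟩)).le⟩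
  refine hasDerivWithinAt_of_forall fun η hη => ?_
  set C := 1 + L + |w u r| with hC
  have hC0 : 0 < C := by positivity
  set ε := η / C with hε'
  have hε : 0 < ε := div_pos hη hC0
  obtain ⟨d1, hd1, H1⟩ := hloc hS ε hε
  obtain ⟨d2, hd2, H2⟩ := hloc hc.cont ε hε
  obtain ⟨d3, hd3, H3⟩ := hloc hw ε hε
  set d := min d1 (min d2 d3) with hd
  have hdpos : 0 < d := by simp only [hd, lt_min_iff]; tauto
  have main : ∀ u₁ u₂, 0 ≤ u₁ → u₁ ≤ u₂ → |u₁ - u| < d / (2 * (L + 1)) →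
      |u₂ - u| < d / (2 * (L + 1)) →
      |v u₂ r - v u₁ r - (c u r * w u r + S u r) * (u₂ - u₁)| ≤ η * |u₂ - u₁| := by
    intro u₁ u₂ h1 h12 hd1' hd2'
    have h2 : 0 ≤ u₂ := h1.trans h12
    obtain ⟨X, hX, eX⟩ := hc.exists_isChar h2 hr
    have hsub : Icc u₁ u₂ ⊆ Icc 0 u₂ := Icc_subset_Icc_left h1
    have hdd : d / (2 * (L + 1)) ≤ d / 2 := by
      apply div_le_div_of_nonneg_left hdpos.le (by norm_num); linarith
    have htime : ∀ τ ∈ Icc u₁ u₂, |τ - u| < d := fun τ hτ => by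
      have x1 := abs_lt.1 hd1'
      have x2 := abs_lt.1 hd2'
      rw [abs_lt]; constructor <;> linarith [hτ.1, hτ.2]
    have hXr : ∀ τ ∈ Icc u₁ u₂, |X τ - r| ≤ L * |u₂ - u₁| := fun τ hτ => by
      have := hX.abs_sub_le hc (right_mem_Icc.2 h2) (hsub hτ)
      rw [eX] at this
      refine this.trans (mul_le_mul_of_nonneg_left ?_ hL)
      rw [abs_sub_comm, abs_of_nonneg (by linarith [hτ.2]), abs_of_nonneg (by linarith)]
      linarith [hτ.1]
    have hLd : L * |u₂ - u₁| < d := by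
      have : |u₂ - u₁| < d / (L + 1) := by
        have x1 := abs_lt.1 hd1'
        have x2 := abs_lt.1 hd2'
        have : d / (L + 1) = d / (2 * (L + 1)) + d / (2 * (L + 1)) := by field_simp; ring
        rw [this, abs_lt]; constructor <;> linarith [x1.1, x1.2, x2.1, x2.2]
      rw [lt_div_iff₀ (by positivity)] at this
      nlinarith [abs_nonneg (u₂ - u₁)]
    have hspace : ∀ τ ∈ Icc u₁ u₂, |X τ - r| < d := fun τ hτ => (hXr τ hτ).trans_lt hLd
    simp only [hd, lt_min_iff] at htime hspace
    have l1 : u₁ ∈ Icc u₁ u₂ := left_mem_Icc.2 h12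
    have l2 : u₂ ∈ Icc u₁ u₂ := right_mem_Icc.2 h12
    have E1 := abs_sub_sub_mul_le (s := Icc u₁ u₂) (m := S u r) (ε := ε)
      (fun τ hτ => (hv.deriv u₂ X hX τ (hsub hτ)).mono hsub)
      (fun τ hτ => H1 τ (X τ) (hsub hτ).1 (hX.mem τ (hsub hτ)) (htime τ hτ).1 (hspace τ hτ).1)
      (convex_Icc _ _) l1 l2
    have E2 := abs_sub_sub_mul_le (s := Icc u₁ u₂) (m := -c u r) (ε := ε)
      (fun τ hτ => (hX.deriv τ (hsub hτ)).mono hsub)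
      (fun τ hτ => by
        rw [neg_sub_neg, abs_sub_comm]
        exact H2 τ (X τ) (hsub hτ).1 (hX.mem τ (hsub hτ)) (htime τ hτ).2.1 (hspace τ hτ).2.1)
      (convex_Icc _ _) l1 l2
    have E3 := abs_sub_sub_mul_le (s := Icc 0 R ∩ Metric.ball r d3) (m := w u r) (ε := ε)
      (fun x hx => (hvw u₁ h1 x hx.1).mono inter_subset_left)
      (fun x hx => H3 u₁ x h1 hx.1 (htime u₁ l1).2.2 hx.2)
      ((convex_Icc _ _).inter (convex_ball _ _)) ⟨hr, Metric.mem_ball_self hd3⟩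
      ⟨hX.mem u₁ (hsub l1), (hspace u₁ l1).2.2⟩
    rw [eX] at E1 E2
    have E4 := mul_le_mul_of_nonneg_left (hXr u₁ l1) hε.le
    have E5 : |w u r * (r - X u₁ - -c u r * (u₂ - u₁))| ≤ |w u r| * (ε * |u₂ - u₁|) := by
      rw [abs_mul]; exact mul_le_mul_of_nonneg_left E2 (abs_nonneg _)
    have key : v u₂ r - v u₁ r - (c u r * w u r + S u r) * (u₂ - u₁) =
        (v u₂ r - v u₁ (X u₁) - S u r * (u₂ - u₁))
        + (v u₁ (X u₁) - v u₁ r - w u r * (X u₁ - r))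
        + -(w u r * (r - X u₁ - -c u r * (u₂ - u₁))) := by ring
    rw [key]
    refine (abs_add_three _ _ _).trans ?_
    rw [abs_neg]
    calc _ ≤ ε * |u₂ - u₁| + ε * (L * |u₂ - u₁|) + |w u r| * (ε * |u₂ - u₁|) :=
          add_le_add (add_le_add E1 (E3.trans E4)) E5
      _ = ε * C * |u₂ - u₁| := by rw [hC]; ring
      _ = η * |u₂ - u₁| := by rw [hε']; field_simp
  have hdL : 0 < d / (2 * (L + 1)) := by positivity
  refine ⟨d / (2 * (L + 1)), hdL, fun t ht htu => ?_⟩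
  have hself : |u - u| < d / (2 * (L + 1)) := by simpa using hdL
  rcases le_total u t with h | h
  · exact main u t hu h hself htu
  · have := main t u ht h htu hself
    rw [abs_sub_comm u t] at this
    rw [← abs_neg]
    convert this using 2
    ring

/-- Comparison principle for linear ordinary differential equations with dissipation. -/
lemma le_of_linear_ode {u : ℝ} {f α β B B' : ℝ → ℝ}
    (hf : ∀ τ ∈ Icc 0 u, HasDerivWithinAt f (α τ * f τ + β τ) (Icc 0 u) τ)
    (hB : ∀ τ ∈ Icc 0 u, HasDerivWithinAt B (B' τ) (Icc 0 u) τ)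
    (hα : ∀ τ ∈ Icc 0 u, α τ ≤ 0) (hβ : ∀ τ ∈ Icc 0 u, α τ * B τ + β τ ≤ B' τ)
    (h0 : f 0 ≤ B 0) {τ : ℝ} (hτ : τ ∈ Icc 0 u) : f τ ≤ B τ := by
  have key : ∀ η, 0 < η → f τ ≤ B τ + η * (1 + τ) := by
    intro η hη
    have hB2 : ∀ t ∈ Icc 0 u, HasDerivWithinAt (fun t => B t + η * (1 + t)) (B' t + η)
        (Icc 0 u) t := fun t ht =>
      ((hB t ht).add (((hasDerivAt_id t).const_add 1).const_mul η).hasDerivWithinAt).congr_deriv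
        (by rw [mul_one])
    refine image_le_of_deriv_right_lt_deriv_boundary' (a := 0) (b := u)
      (B := fun t => B t + η * (1 + t)) (B' := fun t => B' t + η)
      (fun t ht => (hf t ht).continuousWithinAt)
      (fun t ht => hasDerivWithinAt_Ici_of_Icc (hf t (Ico_subset_Icc_self ht)) ht)
      (by simp only [add_zero, mul_one]; linarith)
      (fun t ht => (hB2 t ht).continuousWithinAt)
      (fun t ht => hasDerivWithinAt_Ici_of_Icc (hB2 t (Ico_subset_Icc_self ht)) ht)
      (fun t ht heq => ?_) hτ
    have ht' := Ico_subset_Icc_self ht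
    have h1 := hβ t ht'
    have h2 : α t * (η * (1 + t)) ≤ 0 :=
      mul_nonpos_of_nonpos_of_nonneg (hα t ht') (mul_nonneg hη.le (by linarith [ht.1]))
    rw [heq]
    linarith
  have h1 : 0 < 1 + τ := by linarith [hτ.1]
  refine le_of_forall_pos_le_add fun η hη => ?_
  have := key (η / (1 + τ)) (div_pos hη h1)
  rwa [div_mul_cancel₀ _ h1.ne'] at this

lemma abs_le_of_linear_ode {u : ℝ} {f α β B B' : ℝ → ℝ}
    (hf : ∀ τ ∈ Icc 0 u, HasDerivWithinAt f (α τ * f τ + β τ) (Icc 0 u) τ)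
    (hB : ∀ τ ∈ Icc 0 u, HasDerivWithinAt B (B' τ) (Icc 0 u) τ)
    (hα : ∀ τ ∈ Icc 0 u, α τ ≤ 0) (hβ : ∀ τ ∈ Icc 0 u, α τ * B τ + |β τ| ≤ B' τ)
    (h0 : |f 0| ≤ B 0) {τ : ℝ} (hτ : τ ∈ Icc 0 u) : |f τ| ≤ B τ := by
  rw [abs_le] at h0 ⊢
  constructor
  · have := le_of_linear_ode (f := fun t => -f t) (β := fun t => -β t)
      (fun t ht => (hf t ht).neg.congr_deriv (by ring)) hB hα
      (fun t ht => by linarith [hβ t ht, neg_le_abs (β t)]) (by linarith) hτ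
    linarith
  · exact le_of_linear_ode hf hB hα (fun t ht => by linarith [hβ t ht, le_abs_self (β t)]) h0.2 hτ

/-- Uniform convergence on `[0, U] × [0, R]` for all `U`. -/
def TendstoStrip (R : ℝ) (f : ℕ → ℝ → ℝ → ℝ) (f' : ℝ → ℝ → ℝ) : Prop :=
  ∀ U η, 0 < η → ∀ᶠ n in atTop, ∀ τ ∈ Icc 0 U, ∀ x ∈ Icc 0 R, |f n τ x - f' τ x| ≤ η

/-- Stability of linear transport equations: locally uniform convergence of the coefficients implies
pointwise convergence of the solutions. -/
theorem IsTransport.tendsto {R K L : ℝ} {c a b v : ℝ → ℝ → ℝ} {cₙ aₙ bₙ vₙ : ℕ → ℝ → ℝ → ℝ}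
    (hc : IsAdmissible R K L c) (hcₙ : ∀ n, IsAdmissible R K L (cₙ n))
    (ha : ContStrip R a) (hb : ContStrip R b)
    (hcl : TendstoStrip R cₙ c) (hal : TendstoStrip R aₙ a) (hbl : TendstoStrip R bₙ b)
    (hv : IsTransport R c (fun u r => a u r * v u r + b u r) v)
    (hvₙ : ∀ n, IsTransport R (cₙ n) (fun u r => aₙ n u r * vₙ n u r + bₙ n u r) (vₙ n))
    (h0 : ∀ n, ∀ r ∈ Icc 0 R, vₙ n 0 r = v 0 r) {u r : ℝ} (hu : 0 ≤ u) (hr : r ∈ Icc 0 R) :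
    Tendsto (fun n => vₙ n u r) atTop (𝓝 (v u r)) := by
  obtain ⟨A, hA0, hA⟩ := ha.exists_bound u
  obtain ⟨V, hV0, hV⟩ := hv.cont.exists_bound u
  set C := (1 + 2 * (V + 1) * u) * Real.exp ((A + 2) * u) with hC
  have hC0 : 0 < C := by positivity
  obtain ⟨X, hX, eX⟩ := hc.exists_isChar hu hr
  rw [Metric.tendsto_atTop']
  intro η hη
  set ε := min 1 (η / 2 / C)
  have hε : 0 < ε := lt_min one_pos (by positivity)
  obtain ⟨d1, hd1, H1⟩ := ha.exists_unif_cont u hε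
  obtain ⟨d2, hd2, H2⟩ := hb.exists_unif_cont u hε
  obtain ⟨d3, hd3, H3⟩ := hv.cont.exists_unif_cont u hε
  set d := min d1 (min d2 d3) with hd
  have hdpos : 0 < d := by simp only [hd, lt_min_iff]; tauto
  set θ := d / 2 / ((u + 1) * Real.exp (K * u)) with hθ
  have hθ0 : 0 < θ := by positivity
  suffices h : ∀ᶠ n in atTop, dist (vₙ n u r) (v u r) < η by
    obtain ⟨N, hN⟩ := eventually_atTop.1 h
    exact ⟨N, fun n hn => hN n hn.le⟩
  filter_upwards [hcl u θ hθ0, hal u ε hε, hbl u ε hε] with n hn1 hn2 hn3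
  obtain ⟨Y, hY, eY⟩ := (hcₙ n).exists_isChar hu hr
  have hYX : ∀ τ ∈ Icc 0 u, |Y τ - X τ| < d := by
    intro τ hτ
    have h1 := hX.abs_sub_le_of_speed_le hc hY hθ0.le hn1 hτ
    rw [eX, eY, sub_self, abs_zero, zero_add] at h1
    refine h1.trans_lt ?_
    have h2 : Real.exp (K * (u - τ)) ≤ Real.exp (K * u) :=
      Real.exp_le_exp.2 (mul_le_mul_of_nonneg_left (by linarith [hτ.1]) hc.K_nonneg)
    calc θ * (u - τ) * Real.exp (K * (u - τ)) ≤ θ * (u + 1) * Real.exp (K * u) := by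
          have : 0 ≤ u - τ := by linarith [hτ.2]
          have : u - τ ≤ u + 1 := by linarith [hτ.1]
          gcongr
      _ = d / 2 := by rw [hθ]; field_simp
      _ < d := by linarith
  simp only [hd, lt_min_iff] at hYX
  set z : ℝ → ℝ := fun τ => vₙ n τ (Y τ) - v τ (X τ) with hz
  set z' : ℝ → ℝ := fun τ => aₙ n τ (Y τ) * vₙ n τ (Y τ) + bₙ n τ (Y τ)
    - (a τ (X τ) * v τ (X τ) + b τ (X τ)) with hz'
  have hzd : ∀ τ ∈ Icc 0 u, HasDerivWithinAt z (z' τ) (Icc 0 u) τ := fun τ hτ =>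
    ((hvₙ n).deriv u Y hY τ hτ).sub (hv.deriv u X hX τ hτ)
  have hε1 : ε ≤ 1 := min_le_left _ _
  have hz'b : ∀ τ ∈ Icc 0 u, |z' τ| ≤ (A + 2) * |z τ| + 2 * ε * (V + 1) := by
    intro τ hτ
    have m1 := hX.mem τ hτ
    have m2 := hY.mem τ hτ
    have E1 := abs_le.1 (H1 τ hτ _ m2 _ m1 (hYX τ hτ).1)
    have E2 := abs_le.1 (H2 τ hτ _ m2 _ m1 (hYX τ hτ).2.1)
    have F1 := abs_le.1 (hn2 τ hτ _ m2)
    have F2 := abs_le.1 (hn3 τ hτ _ m2)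
    have G1 : |aₙ n τ (Y τ) - a τ (X τ)| ≤ 2 * ε := by
      rw [abs_le]; constructor <;> linarith [E1.1, E1.2, F1.1, F1.2]
    have G2 : |bₙ n τ (Y τ) - b τ (X τ)| ≤ 2 * ε := by
      rw [abs_le]; constructor <;> linarith [E2.1, E2.2, F2.1, F2.2]
    have G3 : |aₙ n τ (Y τ)| ≤ A + 2 := by
      have x := abs_le.1 (hA τ hτ _ m1)
      have y := abs_le.1 G1
      rw [abs_le]; constructor <;> linarith [x.1, x.2, y.1, y.2]
    have key : z' τ = aₙ n τ (Y τ) * z τ + (aₙ n τ (Y τ) - a τ (X τ)) * v τ (X τ)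
        + (bₙ n τ (Y τ) - b τ (X τ)) := by simp only [hz, hz']; ring
    rw [key]
    refine (abs_add_three _ _ _).trans ?_
    rw [abs_mul, abs_mul]
    have t1 := mul_le_mul_of_nonneg_right G3 (abs_nonneg (z τ))
    have t2 := mul_le_mul G1 (hV τ hτ _ m1) (abs_nonneg _) (by positivity)
    linarith
  have hz0 : |z 0| ≤ ε := by
    have m0 : (0 : ℝ) ∈ Icc 0 u := left_mem_Icc.2 hu
    simp only [hz]
    rw [h0 n _ (hY.mem 0 m0)]
    exact H3 0 m0 _ (hY.mem 0 m0) _ (hX.mem 0 m0) (hYX 0 m0).2.2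
  have hgr := norm_le_gronwallBound_of_norm_deriv_right_le (f := z) (f' := z')
    (fun τ hτ => (hzd τ hτ).continuousWithinAt)
    (fun τ hτ => hasDerivWithinAt_Ici_of_Icc (hzd τ (Ico_subset_Icc_self hτ)) hτ) hz0
    (fun τ hτ => hz'b τ (Ico_subset_Icc_self hτ)) u (right_mem_Icc.2 hu)
  have hfin := hgr.trans (gronwallBound_le (by positivity) (by positivity) (by simpa using hu))
  have hzu : z u = vₙ n u r - v u r := by simp only [hz]; rw [eX, eY]
  rw [hzu, sub_zero] at hfin
  rw [Real.dist_eq]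
  refine lt_of_le_of_lt hfin ?_
  calc (ε + 2 * ε * (V + 1) * u) * Real.exp ((A + 2) * u) = ε * C := by rw [hC]; ring
    _ ≤ η / 2 / C * C := mul_le_mul_of_nonneg_right (min_le_right _ _) hC0.le
    _ = η / 2 := by field_simp
    _ < η := by linarith

/-! ### Functions with continuous partial derivatives on the strip -/

/-- `f` has the continuous partial derivatives `fu` and `fr` on the strip, one-sided on its
boundary. -/
structure HasPartials (R : ℝ) (f fu fr : ℝ → ℝ → ℝ) : Prop where
  cont_u : ContStrip R fu
  cont_r : ContStrip R fr
  deriv_u : ∀ u, 0 ≤ u → ∀ r ∈ Icc 0 R, HasDerivWithinAt (fun t => f t r) (fu u r) (Ici 0) u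
  deriv_r : ∀ u, 0 ≤ u → ∀ r ∈ Icc 0 R, HasDerivWithinAt (f u) (fr u r) (Icc 0 R) r

lemma HasPartials.hasFDerivWithinAt {R : ℝ} {f fu fr : ℝ → ℝ → ℝ} (h : HasPartials R f fu fr)
    {p : ℝ × ℝ} (hp : p ∈ strip R) :
    HasFDerivWithinAt (fun p : ℝ × ℝ => f p.1 p.2)
      (fu p.1 p.2 • ContinuousLinearMap.fst ℝ ℝ ℝ + fr p.1 p.2 • ContinuousLinearMap.snd ℝ ℝ ℝ)
      (strip R) p := by
  rw [hasFDerivWithinAt_iff_isLittleO, Asymptotics.isLittleO_iff]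
  intro η hη
  have hη2 : 0 < η / 2 := by positivity
  obtain ⟨d1, hd1, H1⟩ := Metric.continuousWithinAt_iff.1 (h.cont_u p hp) _ hη2
  obtain ⟨d2, hd2, H2⟩ := Metric.continuousWithinAt_iff.1 (h.cont_r p hp) _ hη2
  filter_upwards [self_mem_nhdsWithin, mem_nhdsWithin_of_mem_nhds (Metric.ball_mem_nhds p hd1),
    mem_nhdsWithin_of_mem_nhds (Metric.ball_mem_nhds p hd2)] with q hq hq1 hq2
  have hq1' : dist q.1 p.1 < d1 ∧ dist q.2 p.2 < d1 := by
    simpa [Prod.dist_eq] using hq1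
  have hq2' : dist q.1 p.1 < d2 ∧ dist q.2 p.2 < d2 := by
    simpa [Prod.dist_eq] using hq2
  have E1 := abs_sub_sub_mul_le (s := Ici 0 ∩ Metric.ball p.1 d1) (m := fu p.1 p.2) (ε := η / 2)
    (f := fun t => f t q.2)
    (fun t ht => (h.deriv_u t ht.1 q.2 hq.2).mono inter_subset_left)
    (fun t ht => (H1 (x := (t, q.2)) ⟨ht.1, hq.2⟩ (by
      simpa [Prod.dist_eq] using ⟨ht.2, hq1'.2⟩)).le)
    ((convex_Ici 0).inter (convex_ball _ _)) ⟨hp.1, Metric.mem_ball_self hd1⟩ ⟨hq.1, hq1'.1⟩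
  have E2 := abs_sub_sub_mul_le (s := Icc 0 R ∩ Metric.ball p.2 d2) (m := fr p.1 p.2) (ε := η / 2)
    (f := f p.1)
    (fun t ht => (h.deriv_r p.1 hp.1 t ht.1).mono inter_subset_left)
    (fun t ht => (H2 (x := (p.1, t)) ⟨hp.1, ht.1⟩ (by
      simpa [Prod.dist_eq, hd2] using ht.2)).le)
    ((convex_Icc 0 R).inter (convex_ball _ _)) ⟨hp.2, Metric.mem_ball_self hd2⟩ ⟨hq.2, hq2'.2⟩
  have N1 : |q.1 - p.1| ≤ ‖q - p‖ := norm_fst_le (q - p)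
  have N2 : |q.2 - p.2| ≤ ‖q - p‖ := norm_snd_le (q - p)
  have key : f q.1 q.2 - f p.1 p.2 -
      (fu p.1 p.2 • ContinuousLinearMap.fst ℝ ℝ ℝ
        + fr p.1 p.2 • ContinuousLinearMap.snd ℝ ℝ ℝ) (q - p)
      = (f q.1 q.2 - f p.1 q.2 - fu p.1 p.2 * (q.1 - p.1))
        + (f p.1 q.2 - f p.1 p.2 - fr p.1 p.2 * (q.2 - p.2)) := by
    simp; ring
  rw [key]
  refine (norm_add_le _ _).trans ?_
  have M1 := mul_le_mul_of_nonneg_left N1 hη2.le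
  have M2 := mul_le_mul_of_nonneg_left N2 hη2.le
  have E1' : ‖f q.1 q.2 - f p.1 q.2 - fu p.1 p.2 * (q.1 - p.1)‖ ≤ η / 2 * |q.1 - p.1| := E1
  have E2' : ‖f p.1 q.2 - f p.1 p.2 - fr p.1 p.2 * (q.2 - p.2)‖ ≤ η / 2 * |q.2 - p.2| := E2
  linarith

lemma HasPartials.contStrip {R : ℝ} {f fu fr : ℝ → ℝ → ℝ} (h : HasPartials R f fu fr) :
    ContStrip R f := fun _ hp => (h.hasFDerivWithinAt hp).continuousWithinAt

/-- Chain rule along characteristics. -/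
lemma HasPartials.hasDerivWithinAt_char {R u τ : ℝ} {c f fu fr : ℝ → ℝ → ℝ} {X : ℝ → ℝ}
    (h : HasPartials R f fu fr) (hX : IsChar R c u X) (hτ : τ ∈ Icc 0 u) :
    HasDerivWithinAt (fun t => f t (X t)) (fu τ (X τ) - c τ (X τ) * fr τ (X τ)) (Icc 0 u) τ := by
  have h1 : HasDerivWithinAt (fun t => (t, X t)) (1, -c τ (X τ)) (Icc 0 u) τ :=
    (hasDerivWithinAt_id τ _).prodMk (hX.deriv τ hτ)
  have h2 := h.hasFDerivWithinAt (p := (τ, X τ)) ⟨hτ.1, hX.mem τ hτ⟩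
  have hm : MapsTo (fun t => (t, X t)) (Icc 0 u) (strip R) := fun t ht => ⟨ht.1, hX.mem t ht⟩
  refine (h2.comp_hasDerivWithinAt τ h1 hm).congr_deriv ?_
  simp
  ring

/-! ### One step of the iteration -/

lemma IsTransport.congr {R : ℝ} {c c₁ S S₁ v : ℝ → ℝ → ℝ} (hv : IsTransport R c S v)
    (hc : ∀ u, 0 ≤ u → ∀ r ∈ Icc 0 R, c u r = c₁ u r)
    (hS : ∀ u, 0 ≤ u → ∀ r ∈ Icc 0 R, S u r = S₁ u r) : IsTransport R c₁ S₁ v where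
  cont := hv.cont
  deriv u X hX τ hτ := by
    have hX' : IsChar R c u X := ⟨hX.mem, fun t ht => by
      rw [hc t ht.1 _ (hX.mem t ht)]; exact hX.deriv t ht⟩
    rw [← hS τ hτ.1 _ (hX.mem τ hτ)]
    exact hv.deriv u X hX' τ hτ

/-- The constant `C*` of the global bound `‖h‖_X ≤ (1 + C*) ‖h₀‖_X`. -/
noncomputable def growthConst (κ Λ R ε : ℝ) : ℝ :=
  ((R * pMax κ Λ R ε / Λ)⁻¹ + 2 * pMax κ Λ R ε) * (R * pMax κ Λ R ε / Λ + 4 * R)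

/-- Parameters beyond the cosmological horizon, with a smallness threshold `ε` for `|∂_r h|`. -/
structure IsSetting (κ Λ R ε : ℝ) : Prop where
  kappa : 0 < κ
  lambda : 0 < Λ
  radius : 0 < R
  horizon : 3 < Λ * R ^ 2
  small : IsSmall κ Λ R ε

section Setting

variable {κ Λ R ε : ℝ}

lemma IsSetting.pMax_pos (hs : IsSetting κ Λ R ε) : 0 < pMax κ Λ R ε :=
  BondiScalar.pMax_pos hs.kappa hs.lambda

lemma IsSetting.one_le_growthConst (hs : IsSetting κ Λ R ε) : 1 ≤ growthConst κ Λ R ε := by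
  have h1 := hs.pMax_pos
  have h2 := hs.radius
  have h3 := hs.lambda
  have h4 : 0 < R * pMax κ Λ R ε / Λ := by positivity
  have h5 : 0 < 2 * pMax κ Λ R ε := by positivity
  calc (1 : ℝ) = (R * pMax κ Λ R ε / Λ)⁻¹ * (R * pMax κ Λ R ε / Λ) := by field_simp
    _ ≤ _ := by
      unfold growthConst
      gcongr <;> linarith

/-- A continuous field on the strip bounded by `ε`, to be used for the coefficients. -/
structure IsSmallField (R ε : ℝ) (v : ℝ → ℝ → ℝ) : Prop where
  cont : ContStrip R v
  bound : ∀ u, 0 ≤ u → ∀ r ∈ Icc 0 R, |v u r| ≤ ε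

lemma IsSmallField.isAdmissible {v : ℝ → ℝ → ℝ} (hs : IsSetting κ Λ R ε)
    (hv : IsSmallField R ε v) :
    IsAdmissible R (R * pMax κ Λ R ε) (gMax κ R ε * (1 + Λ * R ^ 2))
      (fun u r => speed κ Λ (v u) r) where
  pos := hs.radius
  K_nonneg := mul_nonneg hs.radius.le hs.pMax_pos.le
  L_nonneg := mul_nonneg gMax_pos.le (by have := hs.lambda; positivity)
  cont := ContStrip.speed hs.radius.le hv.cont
  lipschitz u hu r hr s hs' :=
    Convex.norm_image_sub_le_of_norm_hasDerivWithin_le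
      (fun x hx => hasDerivWithinAt_speed κ Λ hs.radius (hv.cont.slice hu) hx)
      (fun x hx => abs_id_mul_metricM_le hs.kappa hs.lambda hs.radius.le (hv.cont.slice hu)
        (hv.bound u hu) hx) (convex_Icc 0 R) hs' hr
  bound u hu r hr := abs_speed_le hs.kappa hs.lambda hs.radius.le (hv.cont.slice hu)
    (hv.bound u hu) hr
  inner u _ := by rw [speed_zero]; norm_num
  outer u hu := by
    have := speed_outer_le hs.kappa hs.lambda hs.radius hs.small (hv.cont.slice hu) (hv.bound u hu)
    linarith [hs.horizon]

lemma id_mul_metricM_nonpos {v : ℝ → ℝ → ℝ} (hs : IsSetting κ Λ R ε)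
    (hv : IsSmallField R ε v) {u r : ℝ} (hu : 0 ≤ u) (hr : r ∈ Icc 0 R) :
    r * metricM κ Λ (v u) r ≤ 0 := by
  have := metricM_le_neg hs.kappa hs.lambda hs.radius.le hs.small (hv.cont.slice hu)
    (hv.bound u hu) hr
  exact mul_nonpos_of_nonneg_of_nonpos hr.1 (by linarith [hs.lambda])

/-- `h`, with radial derivative `v`, solves `∂_u h - c ∂_r h = G (h - f̄)` on the strip, where the
coefficients `c` and `G` are those of the field `f` with radial derivative `φ`. -/
def Evolves (κ Λ R : ℝ) (f φ h v : ℝ → ℝ → ℝ) : Prop :=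
  HasPartials R h (fun u r => speed κ Λ (φ u) r * v u r
    + r * metricM κ Λ (φ u) r * (h u r - moment 0 (f u) r)) v

/-- Initial data `h₀` with derivative `v₀`, bounded by `X` and `V`, and small enough for the
threshold `ε`. -/
structure IsData (κ Λ R ε X V : ℝ) (h₀ v₀ : ℝ → ℝ) : Prop where
  slice : IsSlice R h₀ v₀
  bound_h : ∀ r ∈ Icc 0 R, |h₀ r| ≤ X
  bound_v : ∀ r ∈ Icc 0 R, |v₀ r| ≤ V
  small : growthConst κ Λ R ε * (X + V) ≤ ε

/-- The properties preserved by the iteration. -/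
structure IsIterate (κ Λ R ε X V : ℝ) (h₀ v₀ : ℝ → ℝ) (h v : ℝ → ℝ → ℝ) : Prop where
  partials : ∃ hu, HasPartials R h hu v
  bound_h : ∀ u, 0 ≤ u → ∀ r ∈ Icc 0 R, |h u r| ≤ X
  bound_v : ∀ u, 0 ≤ u → ∀ r ∈ Icc 0 R, |v u r| ≤ growthConst κ Λ R ε * (X + V)
  init_h : ∀ r ∈ Icc 0 R, h 0 r = h₀ r
  init_v : ∀ r ∈ Icc 0 R, v 0 r = v₀ r

variable {X V : ℝ} {h₀ v₀ : ℝ → ℝ} {h v : ℝ → ℝ → ℝ}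

lemma IsIterate.isSmallField (hd : IsData κ Λ R ε X V h₀ v₀)
    (h1 : IsIterate κ Λ R ε X V h₀ v₀ h v) : IsSmallField R ε v where
  cont := h1.partials.choose_spec.cont_r
  bound u hu r hr := (h1.bound_v u hu r hr).trans hd.small

lemma IsIterate.isSlice (h1 : IsIterate κ Λ R ε X V h₀ v₀ h v) {u : ℝ} (hu : 0 ≤ u) :
    IsSlice R (h u) (v u) :=
  ⟨h1.partials.choose_spec.cont_r.slice hu, h1.partials.choose_spec.deriv_r u hu⟩

lemma IsIterate.contStrip (h1 : IsIterate κ Λ R ε X V h₀ v₀ h v) : ContStrip R h :=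
  h1.partials.choose_spec.contStrip

lemma IsIterate.abs_moment_le (h1 : IsIterate κ Λ R ε X V h₀ v₀ h v) {u r : ℝ} (hu : 0 ≤ u)
    (hr : r ∈ Icc 0 R) : |moment 0 (h u) r| ≤ X := by
  simpa using BondiScalar.abs_moment_le (h1.isSlice hu).continuousOn_fun 0 hr (h1.bound_h u hu)

lemma IsData.isIterate (hs : IsSetting κ Λ R ε) (hd : IsData κ Λ R ε X V h₀ v₀) :
    IsIterate κ Λ R ε X V h₀ v₀ (fun _ => h₀) (fun _ => v₀) where
  partials := ⟨fun _ _ => 0, contStrip_radial R continuous_const,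
    ContStrip.of_slice hd.slice.continuousOn, fun _ _ _ _ => hasDerivWithinAt_const _ _ _,
    fun _ _ => hd.slice.hasDeriv⟩
  bound_h _ _ := hd.bound_h
  bound_v _ _ r hr := by
    have h1 := hs.one_le_growthConst
    have h2 := (abs_nonneg _).trans (hd.bound_h r hr)
    have h3 := (abs_nonneg _).trans (hd.bound_v r hr)
    have h4 := hd.bound_v r hr
    calc |v₀ r| ≤ 1 * (X + V) := by linarith
      _ ≤ _ := mul_le_mul_of_nonneg_right h1 (by linarith)
  init_h _ _ := rfl
  init_v _ _ := rfl

/-- Solving the linear equation with the coefficients of an iterate gives a new iterate. Since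
`G ≤ 0`, the sup norm does not increase, and the weight `barrier` controls the derivative. -/
theorem IsIterate.exists_step (hs : IsSetting κ Λ R ε) (hd : IsData κ Λ R ε X V h₀ v₀)
    {f φ : ℝ → ℝ → ℝ} (hf : IsIterate κ Λ R ε X V h₀ v₀ f φ) :
    ∃ h v, IsIterate κ Λ R ε X V h₀ v₀ h v ∧ Evolves κ Λ R f φ h v ∧
      IsTransport R (fun u r => speed κ Λ (φ u) r)
        (fun u r => 2 * (r * metricM κ Λ (φ u) r) * v u r +
          (derivG κ Λ (φ u) r * (h u r - f u r) + forcing κ Λ (φ u) r)) v := by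
  have hR := hs.radius
  have hφ := hf.isSmallField hd
  have hc := hφ.isAdmissible hs
  have hP := hs.pMax_pos
  have hG : ContStrip R (fun u r => r * metricM κ Λ (φ u) r) :=
    ContStrip.id_mul_metricM hR.le hφ.cont
  have hG' : ContStrip R (fun u r => derivG κ Λ (φ u) r) := ContStrip.derivG hR.le hφ.cont
  have hQ := ContStrip.meanSlope hR.le hφ.cont
  have hm := hf.contStrip.moment hR.le 0
  obtain ⟨h, hh, hh0⟩ := hc.exists_isTransport hG (hG.mul hm).neg hd.slice.continuousOn_fun
  have hb' : ContStrip R (fun u r => -(derivG κ Λ (φ u) r * moment 0 (f u) r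
      + r * metricM κ Λ (φ u) r * meanSlope (φ u) r)) := ((hG'.mul hm).add (hG.mul hQ)).neg
  obtain ⟨v, hv, hv0⟩ := hc.exists_isTransport (hG.const_mul 2)
    ((hG'.mul hh.cont).add hb') hd.slice.continuousOn
  have hGd : ∀ u, 0 ≤ u → ∀ r ∈ Icc 0 R, HasDerivWithinAt (fun s => s * metricM κ Λ (φ u) s)
      (derivG κ Λ (φ u) r) (Icc 0 R) r := fun u hu r hr =>
    hasDerivWithinAt_id_mul_metricM κ Λ hR (hφ.cont.slice hu) hr
  have hvd : ∀ u, 0 ≤ u → ∀ r ∈ Icc 0 R, HasDerivWithinAt (h u) (v u r) (Icc 0 R) r := by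
    intro u hu r hr
    refine IsTransport.hasDerivWithinAt hc hG
      (fun u hu r hr => hasDerivWithinAt_speed κ Λ hR (hφ.cont.slice hu) hr)
      hG hG' hGd hb' (fun u hu r hr =>
        ((hGd u hu r hr).mul ((hf.isSlice hu).hasDerivWithinAt_moment hR hr)).neg) hh
      (hv.congr (fun _ _ _ _ => rfl) fun u hu r hr => by ring) (fun r hr => ?_) hu hr
    rw [hv0 r hr]
    exact (hd.slice.hasDeriv r hr).congr hh0 (hh0 r hr)
  have hhu : ∀ u, 0 ≤ u → ∀ r ∈ Icc 0 R, HasDerivWithinAt (fun t => h t r)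
      (speed κ Λ (φ u) r * v u r + r * metricM κ Λ (φ u) r * (h u r - moment 0 (f u) r))
      (Ici 0) u := fun u hu r hr => by
    refine (IsTransport.hasDerivWithinAt_time hc ?_ hh hv.cont hvd hu hr).congr_deriv (by ring)
    exact (hG.mul hh.cont).add (hG.mul hm).neg
  have hpart : Evolves κ Λ R f φ h v :=
    ⟨(hc.cont.mul hv.cont).add (hG.mul (hh.cont.sub hm)), hv.cont, hhu, hvd⟩
  have hX0 : 0 ≤ X := (abs_nonneg _).trans (hd.bound_h 0 (left_mem_Icc.2 hR.le))
  have hV0 : 0 ≤ V := (abs_nonneg _).trans (hd.bound_v 0 (left_mem_Icc.2 hR.le))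
  have hbh : ∀ u, 0 ≤ u → ∀ r ∈ Icc 0 R, |h u r| ≤ X := by
    intro u hu r hr
    obtain ⟨Y, hY, eY⟩ := hc.exists_isChar hu hr
    have := abs_le_of_linear_ode (B := fun _ => X) (B' := fun _ => 0) (hh.deriv u Y hY)
      (fun τ _ => hasDerivWithinAt_const _ _ _)
      (fun τ hτ => id_mul_metricM_nonpos hs hφ hτ.1 (hY.mem τ hτ))
      (fun τ hτ => ?_) ?_ (right_mem_Icc.2 hu)
    · simpa [eY] using this
    · have hn := id_mul_metricM_nonpos hs hφ hτ.1 (hY.mem τ hτ)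
      have hm := hf.abs_moment_le hτ.1 (hY.mem τ hτ)
      rw [abs_neg, abs_mul, abs_of_nonpos hn]
      have := mul_le_mul_of_nonneg_left hm (neg_nonneg.2 hn)
      linarith
    · have m0 := hY.mem 0 (left_mem_Icc.2 hu)
      rw [hh0 _ m0]
      exact hd.bound_h _ m0
  set φ₀ := R * pMax κ Λ R ε / Λ with hφ₀
  have hφ₀pos : 0 < φ₀ := by have := hs.lambda; positivity
  -- `m * barrier` dominates the data, as `barrier ≥ φ₀`, and `m` dominates the source of the
  -- equation of `v`
  set m := (φ₀⁻¹ + 2 * pMax κ Λ R ε) * (X + V) with hmdef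
  have hm1 : 2 * pMax κ Λ R ε * X ≤ m := by
    have h1 : 0 ≤ φ₀⁻¹ * (X + V) := by positivity
    have h2 : 0 ≤ 2 * pMax κ Λ R ε * V := by positivity
    rw [hmdef]; linarith
  have hm2 : V ≤ m * φ₀ := by
    have h1 : 0 ≤ 2 * pMax κ Λ R ε * (X + V) * φ₀ := by positivity
    have h2 : m * φ₀ = (X + V) + 2 * pMax κ Λ R ε * (X + V) * φ₀ := by
      rw [hmdef]; field_simp
    linarith
  have hm0 : 0 ≤ m := by positivity
  have hbv : ∀ u, 0 ≤ u → ∀ r ∈ Icc 0 R, |v u r| ≤ growthConst κ Λ R ε * (X + V) := by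
    intro u hu r hr
    obtain ⟨Y, hY, eY⟩ := hc.exists_isChar hu hr
    have := abs_le_of_linear_ode (B := fun τ => m * barrier κ Λ R ε (Y τ))
      (B' := fun τ => m * (4 * speed κ Λ (φ τ) (Y τ))) (hv.deriv u Y hY)
      (fun τ hτ => ?_)
      (fun τ hτ => by linarith [id_mul_metricM_nonpos hs hφ hτ.1 (hY.mem τ hτ)])
      (fun τ hτ => ?_) ?_ (right_mem_Icc.2 hu)
    · rw [eY] at this
      refine this.trans ?_
      calc m * barrier κ Λ R ε r ≤ m * (φ₀ + 4 * R) :=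
            mul_le_mul_of_nonneg_left (barrier_le hr) hm0
        _ = _ := by rw [hmdef, growthConst]; ring
    · refine ((((hY.deriv τ hτ).const_sub R).const_mul 4).const_add φ₀ |>.const_mul m).congr_deriv ?_
      ring
    · have mY := hY.mem τ hτ
      have hcont := hφ.cont.slice hτ.1
      have k1 := one_le_barrier_term hs.kappa hs.lambda hR hs.small hcont (hφ.bound τ hτ.1) mY
      have k2 := abs_derivG_le hs.kappa hs.lambda hR.le hcont (hφ.bound τ hτ.1) mY
      have k3 := abs_metricM_le hs.kappa hs.lambda hR.le hcont (hφ.bound τ hτ.1) mY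
      have k4 := (hf.isSlice hτ.1).sub_moment mY
      have k5 := abs_le.1 (hf.abs_moment_le hτ.1 mY)
      have k6 := abs_le.1 (hf.bound_h τ hτ.1 _ mY)
      have k7 := abs_le.1 (hbh τ hτ.1 _ mY)
      have k8 : |f τ (Y τ) - moment 0 (f τ) (Y τ)| ≤ 2 * X := by
        rw [abs_le]; constructor <;> linarith [k5.1, k5.2, k6.1, k6.2]
      have k9 : |h τ (Y τ) - moment 0 (f τ) (Y τ)| ≤ 2 * X := by
        rw [abs_le]; constructor <;> linarith [k5.1, k5.2, k7.1, k7.2]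
      have e : derivG κ Λ (φ τ) (Y τ) * h τ (Y τ) + -(derivG κ Λ (φ τ) (Y τ)
          * moment 0 (f τ) (Y τ) + Y τ * metricM κ Λ (φ τ) (Y τ) * meanSlope (φ τ) (Y τ))
          = derivG κ Λ (φ τ) (Y τ) * (h τ (Y τ) - moment 0 (f τ) (Y τ))
            - metricM κ Λ (φ τ) (Y τ) * (f τ (Y τ) - moment 0 (f τ) (Y τ)) := by
        rw [k4]; ring
      have k10 : |derivG κ Λ (φ τ) (Y τ) * h τ (Y τ) + -(derivG κ Λ (φ τ) (Y τ)
          * moment 0 (f τ) (Y τ) + Y τ * metricM κ Λ (φ τ) (Y τ) * meanSlope (φ τ) (Y τ))|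
          ≤ 2 * pMax κ Λ R ε * X := by
        rw [e]
        refine (abs_sub _ _).trans ?_
        rw [abs_mul, abs_mul]
        have i1 := mul_le_mul k2 k9 (abs_nonneg _) (by positivity)
        have i2 := mul_le_mul k3 k8 (abs_nonneg _) (by positivity)
        linarith
      have k11 := mul_le_mul_of_nonneg_left k1 hm0
      linarith
    · have m0 := hY.mem 0 (left_mem_Icc.2 hu)
      rw [hv0 _ m0]
      exact (hd.bound_v _ m0).trans (hm2.trans (mul_le_mul_of_nonneg_left (barrier_ge m0) hm0))
  refine ⟨h, v, ⟨⟨_, hpart⟩, hbh, hbv, hh0, hv0⟩, hpart, hv.congr (fun _ _ _ _ => rfl)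
    fun u hu r hr => ?_⟩
  have := (hf.isSlice hu).sub_moment hr
  simp only [forcing, ← this, derivG]
  linear_combination (metricM κ Λ (φ u) r) * this

/-! ### The difference of two solutions -/

/-- Stability estimate in weighted sup norms for the difference of two fields evolving in different
backgrounds. Only the first background has to be small; the derivative of `h₂` enters as a
coefficient. -/
theorem exists_difference_estimate (hs : IsSetting κ Λ R ε) {B : ℝ} (E : ℝ) (hB : 0 ≤ B) :
    ∃ C, 0 < C ∧ ∀ (f₁ φ₁ f₂ φ₂ h₁ v₁ h₂ v₂ : ℝ → ℝ → ℝ) (U N N' W l : ℝ), 0 < l →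
      IsSmallField R ε φ₁ → Evolves κ Λ R f₁ φ₁ h₁ v₁ → Evolves κ Λ R f₂ φ₂ h₂ v₂ →
      (∀ u ∈ Icc 0 U, IsClosePair R E (N * Real.exp (l * u)) (f₁ u) (f₂ u) (φ₁ u) (φ₂ u)) →
      (∀ u ∈ Icc 0 U, ∀ r ∈ Icc 0 R, |v₂ u r| ≤ B) →
      (∀ u ∈ Icc 0 U, ∀ r ∈ Icc 0 R, |h₂ u r - moment 0 (f₂ u) r| ≤ B) →
      (∀ u ∈ Icc 0 U, ∀ r ∈ Icc 0 R, |h₁ u r - h₂ u r| ≤ N' * Real.exp (l * u)) →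
      (∀ r ∈ Icc 0 R, |h₁ 0 r - h₂ 0 r| ≤ W) →
      ∀ u ∈ Icc 0 U, ∀ r ∈ Icc 0 R,
        |h₁ u r - h₂ u r| ≤ (W + C * (N + N') / l) * Real.exp (l * u) := by
  have hR := hs.radius
  obtain ⟨L, hL, hLip⟩ := exists_coefficient_lipschitz κ Λ R E hs.kappa hs.lambda hR.le
  have hP := pMax_pos (R := R) (ε := ε) hs.kappa hs.lambda
  refine ⟨R * pMax κ Λ R ε + 2 * L * B, by positivity, ?_⟩
  intro f₁ φ₁ f₂ φ₂ h₁ v₁ h₂ v₂ U N N' W l hl hφ₁ hev₁ hev₂ hclose hv₂ hh₂ hN' hW u hu r hr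
  set C := R * pMax κ Λ R ε + 2 * L * B with hC
  have hc := hφ₁.isAdmissible hs
  obtain ⟨Y, hY, eY⟩ := hc.exists_isChar hu.1 hr
  have hsub : ∀ {τ}, τ ∈ Icc 0 u → τ ∈ Icc 0 U := fun hτ => ⟨hτ.1, hτ.2.trans hu.2⟩
  have hm0 : (0 : ℝ) ∈ Icc 0 u := left_mem_Icc.2 hu.1
  have hN0 : 0 ≤ N := by
    have := (abs_nonneg _).trans ((hclose u hu).close r hr)
    exact nonneg_of_mul_nonneg_left this (Real.exp_pos _)
  have hN'0 : 0 ≤ N' :=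
    nonneg_of_mul_nonneg_left ((abs_nonneg _).trans (hN' u hu r hr)) (Real.exp_pos _)
  have hW0 : 0 ≤ W := (abs_nonneg _).trans (hW r hr)
  set z : ℝ → ℝ := fun τ => h₁ τ (Y τ) - h₂ τ (Y τ) with hz
  have hzd := fun τ (hτ : τ ∈ Icc 0 u) =>
    (hev₁.hasDerivWithinAt_char hY hτ).sub (hev₂.hasDerivWithinAt_char hY hτ)
  set B₁ : ℝ → ℝ := fun τ => W + C * (N + N') / l * (Real.exp (l * τ) - 1) with hB₁
  have hB₁d : ∀ τ, HasDerivAt B₁ (C * (N + N') * Real.exp (l * τ)) τ := fun τ => by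
    have h1 : HasDerivAt (fun τ => Real.exp (l * τ)) (Real.exp (l * τ) * l) τ := by
      simpa using ((hasDerivAt_id τ).const_mul l).exp
    refine (((h1.sub_const 1).const_mul (C * (N + N') / l)).const_add W).congr_deriv ?_
    field_simp
  have key := image_norm_le_of_norm_deriv_right_le_deriv_boundary (f := z) (a := 0) (b := u)
    (B := B₁) (B' := fun τ => C * (N + N') * Real.exp (l * τ))
    (fun τ hτ => (hzd τ hτ).continuousWithinAt)
    (fun τ hτ => hasDerivWithinAt_Ici_of_Icc (hzd τ (Ico_subset_Icc_self hτ)) hτ)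
    (by
      simp only [hz, hB₁, mul_zero, Real.exp_zero, sub_self, add_zero]
      exact hW _ (hY.mem 0 hm0))
    hB₁d (fun τ hτ' => ?_) (right_mem_Icc.2 hu.1)
  · simp only [hz, eY] at key
    refine (show |h₁ u r - h₂ u r| ≤ B₁ u from key).trans ?_
    have h1 : 1 ≤ Real.exp (l * u) := Real.one_le_exp (mul_nonneg hl.le hu.1)
    have h2 : 0 ≤ C * (N + N') / l := by
      have : 0 ≤ C := by positivity
      positivity
    have h3 := mul_le_mul_of_nonneg_left h1 hW0
    simp only [hB₁]
    linarith
  · have hτ := Ico_subset_Icc_self hτ'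
    have mY := hY.mem τ hτ
    have hcl := hclose τ (hsub hτ)
    obtain ⟨l1, l2, -⟩ := hLip _ _ _ _ _ hcl _ mY
    have b1 := abs_id_mul_metricM_le hs.kappa hs.lambda hR.le (hφ₁.cont.slice hτ.1)
      (hφ₁.bound τ hτ.1) mY
    have b2 := hcl.abs_moment_sub_le mY
    have b3 := hv₂ τ (hsub hτ) _ mY
    have b4 := hh₂ τ (hsub hτ) _ mY
    have b5 := hN' τ (hsub hτ) _ mY
    set e := Real.exp (l * τ)
    have he : 0 < e := Real.exp_pos _
    have hRP : 0 ≤ R * pMax κ Λ R ε := by positivity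
    have i1 := mul_le_mul b1 b5 (abs_nonneg _) hRP
    have i2 := mul_le_mul l2 b4 (abs_nonneg _) (by positivity)
    have i3 := mul_le_mul b1 b2 (abs_nonneg _) hRP
    have i4 := mul_le_mul l1 b3 (abs_nonneg _) (by positivity)
    rw [← abs_mul] at i1 i2 i3 i4
    have i5 : 0 ≤ 2 * L * B * (N' * e) := by positivity
    rw [abs_le] at i1 i2 i3 i4
    rw [Real.norm_eq_abs, abs_le]
    constructor
    · rw [hC]; linarith [i1.1, i2.1, i3.2, i4.1]
    · rw [hC]; linarith [i1.2, i2.2, i3.1, i4.2]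

end Setting

/-! ### Convergence of the iteration -/

lemma TendstoStrip.tendsto {R : ℝ} {f : ℕ → ℝ → ℝ → ℝ} {f' : ℝ → ℝ → ℝ}
    (h : TendstoStrip R f f') {u r : ℝ} (hu : 0 ≤ u) (hr : r ∈ Icc 0 R) :
    Tendsto (fun n => f n u r) atTop (𝓝 (f' u r)) := by
  rw [Metric.tendsto_nhds]
  intro η hη
  filter_upwards [h u (η / 2) (by positivity)] with n hn
  exact (hn u (right_mem_Icc.2 hu) r hr).trans_lt (by linarith)

lemma TendstoStrip.contStrip {R : ℝ} {f : ℕ → ℝ → ℝ → ℝ} {f' : ℝ → ℝ → ℝ}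
    (h : TendstoStrip R f f') (hf : ∀ n, ContStrip R (f n)) : ContStrip R f' := by
  rintro ⟨u, r⟩ hp
  have h1 : TendstoUniformlyOn (fun n (p : ℝ × ℝ) => f n p.1 p.2) (fun p => f' p.1 p.2) atTop
      (Icc 0 (u + 1) ×ˢ Icc 0 R) := by
    rw [Metric.tendstoUniformlyOn_iff]
    intro η hη
    filter_upwards [h (u + 1) (η / 2) (by positivity)] with n hn p hp
    rw [dist_comm]
    exact (hn p.1 hp.1 p.2 hp.2).trans_lt (by linarith)
  have h2 := h1.continuousOn (Frequently.of_forall fun n => (hf n).continuousOn_Icc (u + 1))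
  have hu : u ∈ Icc 0 (u + 1) := ⟨hp.1, by linarith⟩
  refine (h2 (u, r) ⟨hu, hp.2⟩).mono_of_mem_nhdsWithin ?_
  have h3 : {p : ℝ × ℝ | p.1 < u + 1} ∈ 𝓝 (u, r) :=
    (isOpen_lt continuous_fst continuous_const).mem_nhds (by simp)
  filter_upwards [self_mem_nhdsWithin, mem_nhdsWithin_of_mem_nhds h3] with p hp1 hp2
  exact ⟨⟨hp1.1, le_of_lt hp2⟩, hp1.2⟩

lemma exists_tendstoStrip {R D l : ℝ} {f : ℕ → ℝ → ℝ → ℝ} (hl : 0 ≤ l) (hD : 0 ≤ D)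
    (h : ∀ n u, 0 ≤ u → ∀ r ∈ Icc 0 R,
      |f (n + 1) u r - f n u r| ≤ D * (1 / 2) ^ n * Real.exp (l * u)) :
    ∃ f', TendstoStrip R f f' := by
  have h' : ∀ u, 0 ≤ u → ∀ r ∈ Icc 0 R, ∀ n,
      dist (f n u r) (f (n + 1) u r) ≤ D * Real.exp (l * u) * (1 / 2) ^ n := fun u hu r hr n => by
    rw [dist_comm, Real.dist_eq]
    exact (h n u hu r hr).trans_eq (by ring)
  have hlim : ∀ u r, ∃ a, 0 ≤ u → r ∈ Icc 0 R → Tendsto (fun n => f n u r) atTop (𝓝 a) := by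
    intro u r
    by_cases hur : 0 ≤ u ∧ r ∈ Icc 0 R
    · obtain ⟨a, ha⟩ := cauchySeq_tendsto_of_complete
        (cauchySeq_of_le_geometric (1 / 2) _ (by norm_num) (h' u hur.1 r hur.2))
      exact ⟨a, fun _ _ => ha⟩
    · exact ⟨0, fun a b => absurd ⟨a, b⟩ hur⟩
  choose f' hf' using hlim
  refine ⟨f', fun U η hη => ?_⟩
  have h0 : Tendsto (fun n : ℕ => D * Real.exp (l * U) * (1 / 2) ^ n / (1 - 1 / 2)) atTop (𝓝 0) := by
    have := ((tendsto_pow_atTop_nhds_zero_of_lt_one (r := (1 / 2 : ℝ)) (by norm_num)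
      (by norm_num)).const_mul (D * Real.exp (l * U))).div_const (1 - 1 / 2)
    simpa using this
  filter_upwards [h0.eventually_le_const hη] with n hn τ hτ x hx
  have h1 := dist_le_of_le_geometric_of_tendsto (1 / 2) _ (by norm_num) (h' τ hτ.1 x hx)
    (hf' τ x hτ.1 hx) n
  rw [Real.dist_eq] at h1
  refine h1.trans (le_trans ?_ hn)
  have : Real.exp (l * τ) ≤ Real.exp (l * U) :=
    Real.exp_le_exp.2 (mul_le_mul_of_nonneg_left hτ.2 hl)
  have h3 : (0 : ℝ) ≤ 1 - 1 / 2 := by norm_num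
  gcongr

/-- Pointwise limits of functions and of their derivatives, with a uniform bound on the latter. -/
lemma hasDerivWithinAt_of_tendsto {T B : ℝ} {f f' : ℕ → ℝ → ℝ} {F F' : ℝ → ℝ}
    (hd : ∀ n, ∀ x ∈ Icc 0 T, HasDerivWithinAt (f n) (f' n x) (Icc 0 T) x)
    (hc : ∀ n, ContinuousOn (f' n) (Icc 0 T)) (hB : ∀ n, ∀ x ∈ Icc 0 T, |f' n x| ≤ B)
    (hF : ∀ x ∈ Icc 0 T, Tendsto (fun n => f n x) atTop (𝓝 (F x)))
    (hF' : ∀ x ∈ Icc 0 T, Tendsto (fun n => f' n x) atTop (𝓝 (F' x)))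
    (hFc : ContinuousOn F' (Icc 0 T)) {x : ℝ} (hx : x ∈ Icc 0 T) :
    HasDerivWithinAt F (F' x) (Icc 0 T) x := by
  have key : ∀ y ∈ Icc 0 T, F y = F 0 + ∫ s in (0 : ℝ)..y, F' s := by
    intro y hy
    have hsub : Icc 0 y ⊆ Icc 0 T := Icc_subset_Icc_right hy.2
    have h1 : ∀ n, ∫ s in (0 : ℝ)..y, f' n s = f n y - f n 0 := fun n =>
      intervalIntegral.integral_eq_sub_of_hasDeriv_right_of_le hy.1
        (fun s hs => ((hd n s (hsub hs)).continuousWithinAt).mono hsub)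
        (fun s hs => ((hd n s (hsub (Ioo_subset_Icc_self hs))).mono hsub |>.hasDerivAt
          (Icc_mem_nhds hs.1 hs.2)).hasDerivWithinAt)
        (ContinuousOn.intervalIntegrable (by rw [uIcc_of_le hy.1]; exact (hc n).mono hsub))
    have h2 : Tendsto (fun n => ∫ s in (0 : ℝ)..y, f' n s) atTop
        (𝓝 (∫ s in (0 : ℝ)..y, F' s)) := by
      refine intervalIntegral.tendsto_integral_filter_of_dominated_convergence (fun _ => B)
        (Eventually.of_forall fun n => ?_) (Eventually.of_forall fun n => ?_) (by simp) ?_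
      · rw [uIoc_of_le hy.1]
        exact (((hc n).mono hsub).mono Ioc_subset_Icc_self).aestronglyMeasurable measurableSet_Ioc
      · refine Eventually.of_forall fun s hs => ?_
        rw [uIoc_of_le hy.1] at hs
        exact hB n s (hsub (Ioc_subset_Icc_self hs))
      · refine Eventually.of_forall fun s hs => ?_
        rw [uIoc_of_le hy.1] at hs
        exact hF' s (hsub (Ioc_subset_Icc_self hs))
    have h0 : (0 : ℝ) ∈ Icc 0 T := left_mem_Icc.2 (hy.1.trans hy.2)
    have h3 := tendsto_nhds_unique h2
      (((hF y hy).sub (hF 0 h0)).congr fun n => (h1 n).symm)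
    rw [h3]; ring
  exact ((hasDerivWithinAt_integral hFc hx).const_add (F 0)).congr key (key x hx)

/-- The weighted sup norm `sup exp (-l u) |w|` over `[0, U] × [0, R]`, characterised as the least
admissible bound. -/
lemma exists_least_weighted_bound {R U l B : ℝ} {w : ℝ → ℝ → ℝ} (hR : 0 ≤ R) (hU : 0 ≤ U)
    (hl : 0 ≤ l) (hw : ∀ u ∈ Icc 0 U, ∀ r ∈ Icc 0 R, |w u r| ≤ B) :
    ∃ m, (∀ u ∈ Icc 0 U, ∀ r ∈ Icc 0 R, |w u r| ≤ m * Real.exp (l * u)) ∧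
      ∀ m', (∀ u ∈ Icc 0 U, ∀ r ∈ Icc 0 R, |w u r| ≤ m' * Real.exp (l * u)) → m ≤ m' := by
  set S : Set ℝ := {x | ∃ u ∈ Icc 0 U, ∃ r ∈ Icc 0 R, x = |w u r| / Real.exp (l * u)}
  have hne : S.Nonempty :=
    ⟨_, 0, left_mem_Icc.2 hU, 0, left_mem_Icc.2 hR, rfl⟩
  have hbd : BddAbove S := by
    refine ⟨B, ?_⟩
    rintro x ⟨u, hu, r, hr, rfl⟩
    have h1 : 1 ≤ Real.exp (l * u) := Real.one_le_exp (mul_nonneg hl hu.1)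
    exact (div_le_self (abs_nonneg _) h1).trans (hw u hu r hr)
  refine ⟨sSup S, fun u hu r hr => ?_, fun m' hm' => csSup_le hne ?_⟩
  · rw [← div_le_iff₀ (Real.exp_pos _)]
    exact le_csSup hbd ⟨u, hu, r, hr, rfl⟩
  · rintro x ⟨u, hu, r, hr, rfl⟩
    rw [div_le_iff₀ (Real.exp_pos _)]
    exact hm' u hu r hr

section Setting

variable {κ Λ R ε X V : ℝ} {h₀ v₀ : ℝ → ℝ}

/-- Global existence of `C¹` solutions for small data. The radial derivative is moreover a solution,
in the sense of characteristics, of the differentiated equation. -/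
theorem IsData.exists_solution (hs : IsSetting κ Λ R ε) (hd : IsData κ Λ R ε X V h₀ v₀) :
    ∃ h v, IsIterate κ Λ R ε X V h₀ v₀ h v ∧ Evolves κ Λ R h v h v ∧
      IsTransport R (fun u r => speed κ Λ (v u) r)
        (fun u r => 2 * (r * metricM κ Λ (v u) r) * v u r + forcing κ Λ (v u) r) v := by
  have hR := hs.radius
  have hP := hs.pMax_pos
  have hX0 : 0 ≤ X := (abs_nonneg _).trans (hd.bound_h 0 (left_mem_Icc.2 hR.le))
  have hε := hs.small.pos
  have hstep : ∀ p : {p : (ℝ → ℝ → ℝ) × (ℝ → ℝ → ℝ) // IsIterate κ Λ R ε X V h₀ v₀ p.1 p.2},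
      ∃ q : {p : (ℝ → ℝ → ℝ) × (ℝ → ℝ → ℝ) // IsIterate κ Λ R ε X V h₀ v₀ p.1 p.2},
        Evolves κ Λ R p.1.1 p.1.2 q.1.1 q.1.2 ∧
        IsTransport R (fun u r => speed κ Λ (p.1.2 u) r)
          (fun u r => 2 * (r * metricM κ Λ (p.1.2 u) r) * q.1.2 u r +
          (derivG κ Λ (p.1.2 u) r * (q.1.1 u r - p.1.1 u r) + forcing κ Λ (p.1.2 u) r)) q.1.2 := by
    rintro ⟨⟨f, φ⟩, hf⟩
    obtain ⟨h, v, h1, h2⟩ := hf.exists_step hs hd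
    exact ⟨⟨⟨h, v⟩, h1⟩, h2⟩
  choose next hnext using hstep
  set seq : ℕ → {p : (ℝ → ℝ → ℝ) × (ℝ → ℝ → ℝ) // IsIterate κ Λ R ε X V h₀ v₀ p.1 p.2} :=
    fun n => Nat.rec ⟨(fun _ => h₀, fun _ => v₀), hd.isIterate hs⟩ (fun _ => next) n with hseq
  set H : ℕ → ℝ → ℝ → ℝ := fun n => (seq n).1.1 with hH
  set W : ℕ → ℝ → ℝ → ℝ := fun n => (seq n).1.2 with hW
  have hit : ∀ n, IsIterate κ Λ R ε X V h₀ v₀ (H n) (W n) := fun n => (seq n).2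
  have hev : ∀ n, Evolves κ Λ R (H n) (W n) (H (n + 1)) (W (n + 1)) := fun n =>
    (hnext (seq n)).1
  have htr : ∀ n, IsTransport R (fun u r => speed κ Λ (W n u) r)
      (fun u r => 2 * (r * metricM κ Λ (W n u) r) * W (n + 1) u r +
        (derivG κ Λ (W n u) r * (H (n + 1) u r - H n u r) + forcing κ Λ (W n u) r))
      (W (n + 1)) := fun n => (hnext (seq n)).2
  have hsm : ∀ n, IsSmallField R ε (W n) := fun n => (hit n).isSmallField hd
  obtain ⟨C, hC, hdiff⟩ := exists_difference_estimate hs ε (B := max ε (2 * X))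
    (le_max_of_le_left hε.le)
  -- with this rate the contraction factor of the weighted norm is at most `1 / 2`
  set l := 4 * C with hl
  have hl0 : 0 < l := by positivity
  have hcontr : ∀ n, ∀ u, 0 ≤ u → ∀ r ∈ Icc 0 R,
      |H (n + 1) u r - H n u r| ≤ 2 * X * (1 / 2) ^ n * Real.exp (l * u) := by
    have hapr : ∀ n, ∀ u, 0 ≤ u → ∀ r ∈ Icc 0 R, |H (n + 1) u r - H n u r| ≤ 2 * X :=
      fun n u hu r hr => by
        have h1 := (hit (n + 1)).bound_h u hu r hr
        have h2 := (hit n).bound_h u hu r hr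
        exact (abs_sub _ _).trans (by linarith)
    intro n
    induction n with
    | zero =>
      intro u hu r hr
      have h1 : 1 ≤ Real.exp (l * u) := Real.one_le_exp (by positivity)
      have := mul_le_mul_of_nonneg_left h1 (by positivity : 0 ≤ 2 * X)
      rw [pow_zero, mul_one]
      linarith [hapr 0 u hu r hr]
    | succ n ih =>
      intro u hu r hr
      obtain ⟨m, hm, hleast⟩ := exists_least_weighted_bound (U := u) hR.le hu hl0.le
        (fun τ hτ x hx => hapr (n + 1) τ hτ.1 x hx)
      have h1 := hdiff (H (n + 1)) (W (n + 1)) (H n) (W n) (H (n + 2)) (W (n + 2)) (H (n + 1))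
        (W (n + 1)) u (2 * X * (1 / 2) ^ n) m 0 l hl0 (hsm (n + 1)) (hev (n + 1)) (hev n)
        (fun τ hτ => ⟨(hit (n + 1)).isSlice hτ.1, (hit n).isSlice hτ.1,
          (hsm (n + 1)).bound τ hτ.1, (hsm n).bound τ hτ.1, ih τ hτ.1⟩)
        (fun τ hτ x hx => ((hsm (n + 1)).bound τ hτ.1 x hx).trans (le_max_left _ _))
        (fun τ hτ x hx => (abs_sub _ _).trans (le_max_of_le_right (by
          linarith [(hit (n + 1)).bound_h τ hτ.1 x hx, (hit n).abs_moment_le hτ.1 hx])))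
        hm (fun x hx => by
          rw [(hit (n + 2)).init_h x hx, (hit (n + 1)).init_h x hx]; simp)
      have h2 := hleast _ h1
      have h3 : C * (2 * X * (1 / 2) ^ n + m) / l = (2 * X * (1 / 2) ^ n + m) / 4 := by
        rw [hl]; field_simp
      rw [h3, zero_add] at h2
      have h4 : 0 ≤ 2 * X * (1 / 2 : ℝ) ^ n := by positivity
      have h5 : m ≤ 2 * X * (1 / 2) ^ (n + 1) := by rw [pow_succ]; linarith
      exact (hm u (right_mem_Icc.2 hu) r hr).trans
        (mul_le_mul_of_nonneg_right h5 (Real.exp_pos _).le)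
  -- only `h` and the coefficients converge by contraction; `∂_r h` is treated afterwards
  obtain ⟨L, hL, hLip⟩ := exists_coefficient_lipschitz κ Λ R ε hs.kappa hs.lambda hR.le
  have hclose : ∀ n u, 0 ≤ u → IsClosePair R ε (2 * X * (1 / 2) ^ n * Real.exp (l * u))
      (H (n + 1) u) (H n u) (W (n + 1) u) (W n u) := fun n u hu =>
    ⟨(hit (n + 1)).isSlice hu, (hit n).isSlice hu, (hsm (n + 1)).bound u hu, (hsm n).bound u hu,
      hcontr n u hu⟩
  obtain ⟨h, hh⟩ := exists_tendstoStrip hl0.le (by positivity : 0 ≤ 2 * X) hcontr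
  obtain ⟨c, hcl⟩ := exists_tendstoStrip (R := R) (f := fun n u r => speed κ Λ (W n u) r)
    (D := L * (2 * X)) hl0.le (by positivity) (fun n u hu r hr =>
      (hLip _ _ _ _ _ (hclose n u hu) r hr).1.trans_eq (by ring))
  obtain ⟨a, hal⟩ := exists_tendstoStrip (R := R)
    (f := fun n u r => 2 * (r * metricM κ Λ (W n u) r))
    (D := 2 * (L * (2 * X))) hl0.le (by positivity) (fun n u hu r hr => by
      have := (hLip _ _ _ _ _ (hclose n u hu) r hr).2.1
      rw [← mul_sub, abs_mul, abs_two]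
      exact (mul_le_mul_of_nonneg_left this zero_le_two).trans_eq (by ring))
  obtain ⟨F, hFl⟩ := exists_tendstoStrip (R := R) (f := fun n u r => forcing κ Λ (W n u) r)
    (D := L * (2 * X)) hl0.le (by positivity) (fun n u hu r hr =>
      (hLip _ _ _ _ _ (hclose n u hu) r hr).2.2.trans_eq (by ring))
  have hhc : ContStrip R h := hh.contStrip fun n => (hit n).contStrip
  have hcc : ContStrip R c := hcl.contStrip fun n => ContStrip.speed hR.le (hsm n).cont
  have hac : ContStrip R a := hal.contStrip fun n =>
    (ContStrip.id_mul_metricM hR.le (hsm n).cont).const_mul 2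
  have hFc : ContStrip R F := hFl.contStrip fun n => ContStrip.forcing hR.le (hsm n).cont
  have hadm := fun n => (hsm n).isAdmissible hs
  have hcadm : IsAdmissible R (R * pMax κ Λ R ε) (gMax κ R ε * (1 + Λ * R ^ 2)) c :=
    { pos := hR
      K_nonneg := (hadm 0).K_nonneg
      L_nonneg := (hadm 0).L_nonneg
      cont := hcc
      lipschitz := fun u hu r hr s hs' =>
        le_of_tendsto ((hcl.tendsto hu hr).sub (hcl.tendsto hu hs')).abs
          (Eventually.of_forall fun n => (hadm n).lipschitz u hu r hr s hs')
      bound := fun u hu r hr =>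
        le_of_tendsto (hcl.tendsto hu hr).abs (Eventually.of_forall fun n =>
          (hadm n).bound u hu r hr)
      inner := fun u hu => by
        have h1 := hcl.tendsto hu (left_mem_Icc.2 hR.le)
        have h2 : (1 / 2 : ℝ) = c u 0 :=
          tendsto_nhds_unique (tendsto_const_nhds.congr fun n => (speed_zero κ Λ (W n u)).symm) h1
        rw [← h2]; norm_num
      outer := fun u hu => by
        have h1 := le_of_tendsto (hcl.tendsto hu (right_mem_Icc.2 hR.le))
          (Eventually.of_forall fun n => speed_outer_le hs.kappa hs.lambda hR hs.small
            ((hsm n).cont.slice hu) ((hsm n).bound u hu))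
        linarith [hs.horizon] }
  -- the derivatives of the iterates converge to the solution `w` of the limit of their equations
  obtain ⟨w, hw, hw0⟩ := hcadm.exists_isTransport hac hFc hd.slice.continuousOn
  have hbl : TendstoStrip R (fun n u r => derivG κ Λ (W n u) r * (H (n + 1) u r - H n u r)
      + forcing κ Λ (W n u) r) F := by
    intro U η hη
    have h0 : Tendsto (fun n : ℕ => 5 / 6 * pMax κ Λ R ε * (2 * X * (1 / 2) ^ n * Real.exp (l * U)))
        atTop (𝓝 0) := by
      have := (((tendsto_pow_atTop_nhds_zero_of_lt_one (r := (1 / 2 : ℝ)) (by norm_num)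
        (by norm_num)).const_mul (2 * X)).mul_const (Real.exp (l * U))).const_mul
          (5 / 6 * pMax κ Λ R ε)
      simpa using this
    filter_upwards [hFl U (η / 2) (by positivity), h0.eventually_le_const (half_pos hη)]
      with n hn1 hn2 τ hτ x hx
    have h1 := hn1 τ hτ x hx
    have h2 := abs_derivG_le hs.kappa hs.lambda hR.le ((hsm n).cont.slice hτ.1)
      ((hsm n).bound τ hτ.1) hx
    have h3 := hcontr n τ hτ.1 x hx
    have h4 : Real.exp (l * τ) ≤ Real.exp (l * U) :=
      Real.exp_le_exp.2 (mul_le_mul_of_nonneg_left hτ.2 hl0.le)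
    have h5 : |derivG κ Λ (W n τ) x * (H (n + 1) τ x - H n τ x)| ≤ η / 2 := by
      rw [abs_mul]
      refine le_trans ?_ hn2
      refine mul_le_mul h2 (h3.trans ?_) (abs_nonneg _) (by positivity)
      exact mul_le_mul_of_nonneg_left h4 (by positivity)
    rw [add_sub_assoc]
    exact (abs_add_le _ _).trans (by linarith)
  have hWl : ∀ u, 0 ≤ u → ∀ r ∈ Icc 0 R, Tendsto (fun n => W n u r) atTop (𝓝 (w u r)) := by
    intro u hu r hr
    rw [← tendsto_add_atTop_iff_nat 1]
    exact IsTransport.tendsto hcadm hadm hac hFc hcl hal hbl hw htr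
      (fun n r hr => by rw [(hit (n + 1)).init_v r hr, hw0 r hr]) hu hr
  have hwb : ∀ u, 0 ≤ u → ∀ r ∈ Icc 0 R, |w u r| ≤ growthConst κ Λ R ε * (X + V) :=
    fun u hu r hr => le_of_tendsto (hWl u hu r hr).abs
      (Eventually.of_forall fun n => (hit n).bound_v u hu r hr)
  have hhb : ∀ u, 0 ≤ u → ∀ r ∈ Icc 0 R, |h u r| ≤ X :=
    fun u hu r hr => le_of_tendsto (hh.tendsto hu hr).abs
      (Eventually.of_forall fun n => (hit n).bound_h u hu r hr)
  have hwsm : IsSmallField R ε w := ⟨hw.cont, fun u hu r hr => (hwb u hu r hr).trans hd.small⟩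
  have hslice : ∀ u, 0 ≤ u → IsSlice R (h u) (w u) := fun u hu =>
    ⟨hw.cont.slice hu, fun r hr => hasDerivWithinAt_of_tendsto
      (fun n => ((hit n).isSlice hu).hasDeriv) (fun n => ((hit n).isSlice hu).continuousOn)
      (fun n => (hsm n).bound u hu) (fun x hx => hh.tendsto hu hx) (hWl u hu)
      (hw.cont.slice hu) hr⟩
  -- the limits of the coefficients are the coefficients of the limit
  have hcoef : ∀ u, 0 ≤ u → ∀ η, 0 < η → ∀ᶠ n in atTop, ∀ r ∈ Icc 0 R,
      |speed κ Λ (W n u) r - speed κ Λ (w u) r| ≤ L * η ∧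
      |r * metricM κ Λ (W n u) r - r * metricM κ Λ (w u) r| ≤ L * η ∧
      |forcing κ Λ (W n u) r - forcing κ Λ (w u) r| ≤ L * η ∧
      |moment 0 (H n u) r - moment 0 (h u) r| ≤ η := by
    intro u hu η hη
    filter_upwards [hh u η hη] with n hn r hr
    have hp : IsClosePair R ε η (H n u) (h u) (W n u) (w u) :=
      ⟨(hit n).isSlice hu, hslice u hu, (hsm n).bound u hu, hwsm.bound u hu,
        hn u (right_mem_Icc.2 hu)⟩
    obtain ⟨p1, p2, p3⟩ := hLip _ _ _ _ _ hp r hr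
    exact ⟨p1, p2, p3, hp.abs_moment_sub_le hr⟩
  have hlim : ∀ {s : ℕ → ℝ} {t : ℝ}, (∀ η, 0 < η → ∀ᶠ n in atTop, |s n - t| ≤ L * η) →
      Tendsto s atTop (𝓝 t) := by
    intro s t hst
    rw [Metric.tendsto_nhds]
    intro η hη
    filter_upwards [hst (η / (L + 1)) (by positivity)] with n hn
    refine hn.trans_lt ?_
    rw [← mul_div_assoc, div_lt_iff₀ (by positivity)]
    linarith
  have l1 : ∀ u, 0 ≤ u → ∀ r ∈ Icc 0 R,
      Tendsto (fun n => speed κ Λ (W n u) r) atTop (𝓝 (speed κ Λ (w u) r)) := fun u hu r hr =>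
    hlim fun η hη => (hcoef u hu η hη).mono fun n hn => (hn r hr).1
  have l2 : ∀ u, 0 ≤ u → ∀ r ∈ Icc 0 R,
      Tendsto (fun n => r * metricM κ Λ (W n u) r) atTop (𝓝 (r * metricM κ Λ (w u) r)) :=
    fun u hu r hr => hlim fun η hη => (hcoef u hu η hη).mono fun n hn => (hn r hr).2.1
  have l3 : ∀ u, 0 ≤ u → ∀ r ∈ Icc 0 R,
      Tendsto (fun n => forcing κ Λ (W n u) r) atTop (𝓝 (forcing κ Λ (w u) r)) :=
    fun u hu r hr => hlim fun η hη => (hcoef u hu η hη).mono fun n hn => (hn r hr).2.2.1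
  have l4 : ∀ u, 0 ≤ u → ∀ r ∈ Icc 0 R,
      Tendsto (fun n => moment 0 (H n u) r) atTop (𝓝 (moment 0 (h u) r)) := by
    intro u hu r hr
    rw [Metric.tendsto_nhds]
    intro η hη
    filter_upwards [hcoef u hu (η / 2) (by positivity)] with n hn
    exact (hn r hr).2.2.2.trans_lt (by linarith)
  have hwt : IsTransport R (fun u r => speed κ Λ (w u) r)
      (fun u r => 2 * (r * metricM κ Λ (w u) r) * w u r + forcing κ Λ (w u) r) w := by
    refine hw.congr (fun u hu r hr => tendsto_nhds_unique (hcl.tendsto hu hr) (l1 u hu r hr))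
      fun u hu r hr => ?_
    rw [tendsto_nhds_unique (hal.tendsto hu hr) ((l2 u hu r hr).const_mul 2),
      tendsto_nhds_unique (hFl.tendsto hu hr) (l3 u hu r hr)]
  -- passing to the limit in the integrated equation
  have hrhs : ContStrip R (fun u r => speed κ Λ (w u) r * w u r
      + r * metricM κ Λ (w u) r * (h u r - moment 0 (h u) r)) :=
    ((ContStrip.speed hR.le hw.cont).mul hw.cont).add
      ((ContStrip.id_mul_metricM hR.le hw.cont).mul (hhc.sub (hhc.moment hR.le 0)))
  have hut : ∀ u, 0 ≤ u → ∀ r ∈ Icc 0 R, HasDerivWithinAt (fun t => h t r)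
      (speed κ Λ (w u) r * w u r + r * metricM κ Λ (w u) r * (h u r - moment 0 (h u) r))
      (Ici 0) u := by
    intro u hu r hr
    have hsub : Icc 0 (u + 1) ⊆ Ici 0 := Icc_subset_Ici_self
    refine HasDerivWithinAt.mono_of_mem_nhdsWithin (t := Icc 0 (u + 1)) ?_ ?_
    · refine hasDerivWithinAt_of_tendsto (T := u + 1)
        (F' := fun t => speed κ Λ (w t) r * w t r
          + r * metricM κ Λ (w t) r * (h t r - moment 0 (h t) r))
        (B := gMax κ R ε * (1 + Λ * R ^ 2) * ε + R * pMax κ Λ R ε * (2 * X))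
        (fun n t ht => ((hev n).deriv_u t ht.1 r hr).mono hsub)
        (fun n => ((hev n).cont_u.slice_left hr).mono hsub)
        (fun n t ht => ?_) (fun t ht => ?_)
        (fun t ht => ?_) ((hrhs.slice_left hr).mono hsub) ⟨hu, by linarith⟩
      · have b1 := (hadm n).bound t ht.1 r hr
        have b2 := (hsm (n + 1)).bound t ht.1 r hr
        have b3 := abs_id_mul_metricM_le hs.kappa hs.lambda hR.le ((hsm n).cont.slice ht.1)
          ((hsm n).bound t ht.1) hr
        have b4 : |H (n + 1) t r - moment 0 (H n t) r| ≤ 2 * X := (abs_sub _ _).trans (by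
          linarith [(hit (n + 1)).bound_h t ht.1 r hr, (hit n).abs_moment_le ht.1 hr])
        refine (abs_add_le _ _).trans (add_le_add ?_ ?_)
        · rw [abs_mul]
          exact mul_le_mul b1 b2 (abs_nonneg _) (hadm n).L_nonneg
        · rw [abs_mul]
          exact mul_le_mul b3 b4 (abs_nonneg _) (hadm n).K_nonneg
      · exact (tendsto_add_atTop_iff_nat 1).2 (hh.tendsto ht.1 hr)
      · exact ((l1 t ht.1 r hr).mul ((tendsto_add_atTop_iff_nat 1).2 (hWl t ht.1 r hr))).add
          ((l2 t ht.1 r hr).mul (((tendsto_add_atTop_iff_nat 1).2 (hh.tendsto ht.1 hr)).sub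
            (l4 t ht.1 r hr)))
    · have : Iio (u + 1) ∈ 𝓝 u := Iio_mem_nhds (by linarith)
      filter_upwards [self_mem_nhdsWithin, mem_nhdsWithin_of_mem_nhds this] with t ht1 ht2
      exact ⟨ht1, le_of_lt ht2⟩
  have hpart : Evolves κ Λ R h w h w := ⟨hrhs, hw.cont, hut, fun u hu => (hslice u hu).hasDeriv⟩
  refine ⟨h, w, ⟨⟨_, hpart⟩, hhb, hwb, fun r hr => ?_, hw0⟩, hpart, hwt⟩
  exact tendsto_nhds_unique (hh.tendsto le_rfl hr)
    (tendsto_const_nhds.congr fun n => ((hit n).init_h r hr).symm)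

end Setting

/-! ### Higher regularity on the strip -/

/-- `f` is of class `C^m` up to the boundary of the strip. -/
def SmoothStrip (R : ℝ) (m : ℕ) (f : ℝ → ℝ → ℝ) : Prop :=
  ContDiffOn ℝ m (fun p : ℝ × ℝ => f p.1 p.2) (strip R)

lemma uniqueDiffOn_strip {R : ℝ} (hR : 0 < R) : UniqueDiffOn ℝ (strip R) :=
  (uniqueDiffOn_Ici 0).prod (uniqueDiffOn_Icc hR)

section Calculus

variable {R : ℝ} {m : ℕ} {f k fu fr : ℝ → ℝ → ℝ}

lemma smoothStrip_zero : SmoothStrip R 0 f ↔ ContStrip R f := by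
  unfold SmoothStrip ContStrip
  rw [Nat.cast_zero, contDiffOn_zero]

lemma SmoothStrip.mono {n : ℕ} (hf : SmoothStrip R m f) (h : n ≤ m) : SmoothStrip R n f :=
  ContDiffOn.of_le hf (by exact_mod_cast h)

lemma SmoothStrip.contStrip (hf : SmoothStrip R m f) : ContStrip R f := ContDiffOn.continuousOn hf

lemma SmoothStrip.congr (hf : SmoothStrip R m f)
    (h : ∀ u, 0 ≤ u → ∀ r ∈ Icc 0 R, k u r = f u r) : SmoothStrip R m k :=
  ContDiffOn.congr hf fun p hp => h p.1 hp.1 p.2 hp.2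

lemma SmoothStrip.add (hf : SmoothStrip R m f) (hk : SmoothStrip R m k) :
    SmoothStrip R m (fun u r => f u r + k u r) := ContDiffOn.add hf hk

lemma SmoothStrip.sub (hf : SmoothStrip R m f) (hk : SmoothStrip R m k) :
    SmoothStrip R m (fun u r => f u r - k u r) := ContDiffOn.sub hf hk

lemma SmoothStrip.mul (hf : SmoothStrip R m f) (hk : SmoothStrip R m k) :
    SmoothStrip R m (fun u r => f u r * k u r) := ContDiffOn.mul hf hk

lemma SmoothStrip.const_mul (c : ℝ) (hf : SmoothStrip R m f) :
    SmoothStrip R m (fun u r => c * f u r) := ContDiffOn.mul contDiffOn_const hf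

lemma smoothStrip_radial (R : ℝ) (m : ℕ) {φ : ℝ → ℝ} (hφ : ContDiff ℝ m φ) :
    SmoothStrip R m (fun _ r => φ r) := (hφ.comp contDiff_snd).contDiffOn

lemma SmoothStrip.id_mul (hf : SmoothStrip R m f) : SmoothStrip R m (fun u r => r * f u r) :=
  (smoothStrip_radial R m contDiff_id).mul hf

/-- A function whose partial derivatives are of class `C^m` is of class `C^(m+1)`. -/
lemma HasPartials.smoothStrip_succ (hR : 0 < R) (h : HasPartials R f fu fr) (hu : SmoothStrip R m fu)
    (hr : SmoothStrip R m fr) : SmoothStrip R (m + 1) f := by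
  unfold SmoothStrip
  push_cast
  refine (contDiffOn_succ_iff_hasFDerivWithinAt_of_uniqueDiffOn (uniqueDiffOn_strip hR)).2
    ⟨by simp, fun p : ℝ × ℝ => fu p.1 p.2 • ContinuousLinearMap.fst ℝ ℝ ℝ
      + fr p.1 p.2 • ContinuousLinearMap.snd ℝ ℝ ℝ, ?_, fun p hp => h.hasFDerivWithinAt hp⟩
  exact (hu.smul contDiffOn_const).add (hr.smul contDiffOn_const)

lemma SmoothStrip.exists_hasPartials (hR : 0 < R) (hf : SmoothStrip R (m + 1) f) :
    ∃ fu fr, SmoothStrip R m fu ∧ SmoothStrip R m fr ∧ HasPartials R f fu fr := by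
  have hf' : ContDiffOn ℝ ((m : WithTop ℕ∞) + 1) (fun p : ℝ × ℝ => f p.1 p.2) (strip R) := by
    have := hf
    unfold SmoothStrip at this
    exact_mod_cast this
  obtain ⟨hd, -, hc⟩ := (contDiffOn_succ_iff_fderivWithin (uniqueDiffOn_strip hR)).1 hf'
  set F := fderivWithin ℝ (fun p : ℝ × ℝ => f p.1 p.2) (strip R)
  have h1 : SmoothStrip R m fun u r => F (u, r) (1, 0) := hc.clm_apply contDiffOn_const
  have h2 : SmoothStrip R m fun u r => F (u, r) (0, 1) := hc.clm_apply contDiffOn_const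
  refine ⟨_, _, h1, h2, h1.contStrip, h2.contStrip, fun u hu r hr => ?_, fun u hu r hr => ?_⟩
  · exact (hd (u, r) ⟨hu, hr⟩).hasFDerivWithinAt.comp_hasDerivWithinAt u
      ((hasDerivWithinAt_id u _).prodMk (hasDerivWithinAt_const u _ r)) fun t ht => (⟨ht, hr⟩ : (t, r) ∈ strip R)
  · exact (hd (u, r) ⟨hu, hr⟩).hasFDerivWithinAt.comp_hasDerivWithinAt r
      ((hasDerivWithinAt_const r _ u).prodMk (hasDerivWithinAt_id r _)) fun t ht => (⟨hu, ht⟩ : (u, t) ∈ strip R)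

lemma ContStrip.exists_unif_cont_time (hf : ContStrip R f) (U : ℝ) {ε : ℝ} (hε : 0 < ε) :
    ∃ d, 0 < d ∧ ∀ s ∈ Icc 0 U, ∀ t ∈ Icc 0 U, |s - t| < d → ∀ x ∈ Icc 0 R,
      |f s x - f t x| ≤ ε := by
  have h := (isCompact_Icc.prod isCompact_Icc).uniformContinuousOn_of_continuous
    (hf.continuousOn_Icc U)
  obtain ⟨d, hd, H⟩ := Metric.uniformContinuousOn_iff.1 h ε hε
  refine ⟨d, hd, fun s hs t ht hst x hx => ?_⟩
  exact (H (s, x) ⟨hs, hx⟩ (t, x) ⟨ht, hx⟩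
    (by simpa [Prod.dist_eq, Real.dist_eq, hd] using hst)).le

/-- Differentiation under the integral sign. -/
lemma hasDerivWithinAt_moment_time (hf : ContStrip R f) (hfu : ContStrip R fu)
    (hd : ∀ u, 0 ≤ u → ∀ r ∈ Icc 0 R, HasDerivWithinAt (fun t => f t r) (fu u r) (Ici 0) u)
    (n : ℕ) {u r : ℝ} (hu : 0 ≤ u) (hr : r ∈ Icc 0 R) :
    HasDerivWithinAt (fun t => moment n (f t) r) (moment n (fu u) r) (Ici 0) u := by
  refine hasDerivWithinAt_of_forall fun η hη => ?_
  obtain ⟨d, hd0, H⟩ := hfu.exists_unif_cont_time (u + 1) hη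
  refine ⟨min d 1, lt_min hd0 one_pos, fun y hy hyu => ?_⟩
  have hy0 : 0 ≤ y := hy
  have hy1 := abs_lt.1 (hyu.trans_le (min_le_right _ _))
  have key : ∀ x ∈ Icc 0 R, |f y x - f u x - (y - u) * fu u x| ≤ η * |y - u| := by
    intro x hx
    rw [mul_comm (y - u)]
    refine abs_sub_sub_mul_le (s := Icc 0 (u + 1) ∩ Metric.ball u (min d 1))
      (f := fun t => f t x) (f' := fun t => fu t x)
      (fun t ht => (hd t ht.1.1 x hx).mono fun z hz => hz.1.1)
      (fun t ht => H t ht.1 u ⟨hu, by linarith⟩ (lt_of_lt_of_le ht.2 (min_le_left _ _)) x hx)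
      ((convex_Icc _ _).inter (convex_ball _ _))
      ⟨⟨hu, by linarith⟩, Metric.mem_ball_self (lt_min hd0 one_pos)⟩
      ⟨⟨hy0, by linarith⟩, hyu⟩
  have hcy := hf.slice hy0
  have hcu := hf.slice hu
  have hcd : ContinuousOn (fun x => (y - u) * fu u x) (Icc 0 R) :=
    continuousOn_const.mul (hfu.slice hu)
  have hm : (y - u) * moment n (fu u) r = moment n (fun x => (y - u) * fu u x) r := by
    unfold moment
    rw [← intervalIntegral.integral_const_mul]
    congr 1; ext t; ring
  have hb := abs_moment_le ((hcy.sub hcu).sub hcd) n hr key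
  rw [mul_comm (moment n (fu u) r), hm, ← moment_sub hcy hcu n hr,
    ← moment_sub (f := fun x => f y x - f u x) (hcy.sub hcu) hcd n hr]
  refine hb.trans (div_le_self (by positivity) ?_)
  have : (0 : ℝ) ≤ n := Nat.cast_nonneg n
  linarith

lemma SmoothStrip.moment (hR : 0 < R) (hf : SmoothStrip R m f) (n : ℕ) :
    SmoothStrip R m (fun u r => moment n (f u) r) := by
  induction m generalizing f n with
  | zero => exact smoothStrip_zero.2 ((smoothStrip_zero.1 hf).moment hR.le n)
  | succ m ih =>
    obtain ⟨fu, fr, hfu, hfr, hp⟩ := hf.exists_hasPartials hR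
    have h1 := ih hfu n
    have h2 := ih hfr (n + 1)
    exact HasPartials.smoothStrip_succ hR ⟨h1.contStrip, h2.contStrip,
      fun u hu r hr => hasDerivWithinAt_moment_time hf.contStrip hp.cont_u hp.deriv_u n hu hr,
      fun u hu r hr => hasDerivWithinAt_moment hR (hp.cont_r.slice hu) (hp.deriv_r u hu) n hr⟩
      h1 h2

/-- Functions `q` of class `C^m` such that `r q` is of class `C^(m+1)`. Quotients by `r` of
functions vanishing at the center have this form; the coefficients of the equation are built from
them without a loss of derivatives. -/
structure IsCentered (R : ℝ) (m : ℕ) (q : ℝ → ℝ → ℝ) : Prop where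
  smooth : SmoothStrip R m q
  id_mul : SmoothStrip R (m + 1) (fun u r => r * q u r)

/-- The gain of one derivative for `r q` extends to products, because
`r q₁ q₂ = (r q₁) (r q₂) / r`. -/
lemma IsCentered.id_mul_mul {q₁ q₂ : ℝ → ℝ → ℝ} (hR : 0 < R) (h₁ : IsCentered R m q₁)
    (h₂ : IsCentered R m q₂) : SmoothStrip R (m + 1) (fun u r => r * (q₁ u r * q₂ u r)) := by
  obtain ⟨a, a', ha, ha', hpa⟩ := h₁.id_mul.exists_hasPartials hR
  obtain ⟨b, b', hb, hb', hpb⟩ := h₂.id_mul.exists_hasPartials hR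
  have s1 := (ha.mul h₂.smooth).add (h₁.smooth.mul hb)
  have s2 := (ha'.mul h₂.smooth).add (h₁.smooth.mul (hb'.sub h₂.smooth))
  refine HasPartials.smoothStrip_succ hR ⟨s1.contStrip, s2.contStrip, fun u hu r hr => ?_,
    fun u hu r hr => ?_⟩ s1 s2
  · rcases eq_or_ne r 0 with rfl | h0
    · have z : ∀ {q d : ℝ → ℝ → ℝ}, HasDerivWithinAt (fun t => 0 * q t 0) (d u 0) (Ici 0) u →
          d u 0 = 0 := fun {q d} h => by
        simp only [zero_mul] at h
        exact (uniqueDiffOn_Ici 0 u hu).eq_deriv _ h (hasDerivWithinAt_const u (Ici 0) 0)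
      rw [z (hpa.deriv_u u hu 0 hr), z (hpb.deriv_u u hu 0 hr)]
      simpa using hasDerivWithinAt_const u (Ici 0) (0 : ℝ)
    · have h := ((hpa.deriv_u u hu r hr).mul (hpb.deriv_u u hu r hr)).div_const r
      refine (h.congr_deriv ?_).congr (fun t _ => ?_) ?_
      · field_simp
      · simp only [Pi.mul_apply]; field_simp
      · simp only [Pi.mul_apply]; field_simp
  · rcases eq_or_ne r 0 with rfl | h0
    · -- at the center both sides are the limit `q₁ q₂` of the difference quotient
      have z : ∀ {q : ℝ → ℝ → ℝ}, ContStrip R q →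
          HasDerivWithinAt (fun s => s * q u s) (q u 0) (Icc 0 R) 0 := fun {q} hq => by
        rw [hasDerivWithinAt_iff_tendsto_slope]
        refine ((hq.slice hu 0 hr).tendsto.mono_left (nhdsWithin_mono _ sdiff_subset)).congr' ?_
        filter_upwards [self_mem_nhdsWithin] with x hx
        have hx0 : x ≠ 0 := hx.2
        simp [slope_def_field, hx0]
      have e : ∀ {q d : ℝ → ℝ → ℝ}, ContStrip R q →
          HasDerivWithinAt (fun s => s * q u s) (d u 0) (Icc 0 R) 0 → d u 0 = q u 0 :=
        fun {q d} hq h => (uniqueDiffOn_Icc hR 0 hr).eq_deriv _ h (z hq)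
      have ea := e h₁.smooth.contStrip (hpa.deriv_r u hu 0 hr)
      have eb := e h₂.smooth.contStrip (hpb.deriv_r u hu 0 hr)
      refine (z (h₁.smooth.contStrip.mul h₂.smooth.contStrip)).congr_deriv ?_
      rw [ea, eb]
      ring
    · have hev : ∀ s ∈ Icc 0 R, s ≠ 0 →
          s * (q₁ u s * q₂ u s) = s * q₁ u s * (s * q₂ u s) * s⁻¹ := fun s _ hs => by
        field_simp
      have h := ((hpa.deriv_r u hu r hr).mul (hpb.deriv_r u hu r hr)).mul
        (hasDerivAt_inv h0).hasDerivWithinAt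
      refine (h.congr_of_eventuallyEq ?_ (hev r hr h0)).congr_deriv ?_
      · filter_upwards [self_mem_nhdsWithin,
          mem_nhdsWithin_of_mem_nhds (isOpen_ne.mem_nhds h0)] with x hx hx0 using hev x hx hx0
      · simp only [Pi.mul_apply]
        field_simp
        ring

lemma IsCentered.sub_const_mul {q₁ q₂ : ℝ → ℝ → ℝ} (a b : ℝ) (h₁ : IsCentered R m q₁)
    (h₂ : IsCentered R m q₂) : IsCentered R m (fun u r => a * q₁ u r - b * q₂ u r) where
  smooth := (h₁.smooth.const_mul a).sub (h₂.smooth.const_mul b)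
  id_mul := ((h₁.id_mul.const_mul a).sub (h₂.id_mul.const_mul b)).congr
    fun _ _ _ _ => by ring

end Calculus

section Coefficients

variable {κ Λ R : ℝ} {m : ℕ} {h v : ℝ → ℝ → ℝ}

lemma isCentered_meanSlope (hR : 0 < R) (hs : ∀ u, 0 ≤ u → IsSlice R (h u) (v u))
    (hh : SmoothStrip R (m + 1) h) (hv : SmoothStrip R m v) :
    IsCentered R m (fun u r => meanSlope (v u) r) where
  smooth := hv.moment hR 1
  id_mul := (hh.sub (hh.moment hR 0)).congr fun u hu _ hr => ((hs u hu).sub_moment hr).symm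

lemma smoothStrip_metricG (hR : 0 < R) (hq : IsCentered R m (fun u r => meanSlope (v u) r)) :
    SmoothStrip R (m + 1) (fun u r => metricG κ (v u) r) := by
  have h1 := (hq.id_mul_mul hR hq).congr (k := fun u r => r * meanSlope (v u) r ^ 2)
    fun _ _ _ _ => by ring
  exact ContDiffOn.exp ((h1.moment hR 0).id_mul.const_mul (κ / 2))

lemma isCentered_metricP (hR : 0 < R) (hq : IsCentered R m (fun u r => meanSlope (v u) r)) :
    IsCentered R m (fun u r => metricP κ Λ (v u) r) := by
  have hg := smoothStrip_metricG (κ := κ) hR hq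
  have hw : ∀ j, SmoothStrip R j (fun _ r => 1 - Λ * r ^ 2) := fun j =>
    smoothStrip_radial R j (by fun_prop)
  have hc : ∀ j, SmoothStrip R j (fun _ _ => 2 * Λ) := fun j =>
    smoothStrip_radial R j contDiff_const
  refine ⟨?_, ?_⟩
  · exact ((((hq.smooth.mul hq.smooth).const_mul (κ / 2)).mul (hw m)).sub (hc m)).mul
      (hg.mono m.le_succ) |>.congr fun _ _ _ _ => by unfold metricP; ring
  · exact ((((hq.id_mul_mul hR hq).const_mul (κ / 2)).mul (hw _)).sub (hc _).id_mul).mul hg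
      |>.congr fun _ _ _ _ => by unfold metricP; ring

lemma isCentered_metricM (hR : 0 < R) (hq : IsCentered R m (fun u r => meanSlope (v u) r)) :
    IsCentered R m (fun u r => metricM κ Λ (v u) r) := by
  have hP := isCentered_metricP (κ := κ) (Λ := Λ) hR hq
  refine ⟨(hP.smooth.moment hR 2).const_mul _, ?_⟩
  refine ((hP.id_mul.moment hR 1).const_mul (1 / 2)).congr fun u hu r hr => ?_
  rw [moment_id_mul, metricM]
  ring

lemma smoothStrip_speed (hR : 0 < R) (hq : IsCentered R m (fun u r => meanSlope (v u) r)) :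
    SmoothStrip R (m + 1) (fun u r => speed κ Λ (v u) r) :=
  (((smoothStrip_metricG hR hq).mul
    (smoothStrip_radial R (m + 1) (by fun_prop))).moment hR 0).const_mul _

lemma smoothStrip_forcing (hR : 0 < R) (hq : IsCentered R m (fun u r => meanSlope (v u) r)) :
    SmoothStrip R (m + 1) (fun u r => forcing κ Λ (v u) r) :=
  (((isCentered_metricP hR hq).sub_const_mul (1 / 2) 3 (isCentered_metricM hR hq)).id_mul_mul
    hR hq).congr fun _ _ _ _ => by unfold forcing; ring

end Coefficients

section Transport

variable {R K L : ℝ} {c c' : ℝ → ℝ → ℝ}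

/-- Solutions of linear transport equations are as smooth as the coefficients and the data. -/
theorem IsTransport.smoothStrip (hc : IsAdmissible R K L c)
    (hcd : ∀ u, 0 ≤ u → ∀ r ∈ Icc 0 R, HasDerivWithinAt (c u) (c' u r) (Icc 0 R) r) {m : ℕ}
    (hcm : SmoothStrip R m c) (hcm' : SmoothStrip R m c') {a b v : ℝ → ℝ → ℝ}
    (ha : SmoothStrip R m a) (hb : SmoothStrip R m b)
    (hv : IsTransport R c (fun u r => a u r * v u r + b u r) v)
    (hv₀ : ContDiffOn ℝ m (v 0) (Icc 0 R)) : SmoothStrip R m v := by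
  have hR := hc.pos
  induction m generalizing a b v with
  | zero => exact smoothStrip_zero.2 hv.cont
  | succ m ih =>
    have hc1 := hcm.mono m.le_succ
    have hc1' := hcm'.mono m.le_succ
    have ha1 := ha.mono m.le_succ
    have hb1 := hb.mono m.le_succ
    have hv1 : SmoothStrip R m v := ih hc1 hc1' ha1 hb1 hv (hv₀.of_le (by exact_mod_cast m.le_succ))
    obtain ⟨_, ar, -, har, hpa⟩ := ha.exists_hasPartials hR
    obtain ⟨_, br, -, hbr, hpb⟩ := hb.exists_hasPartials hR
    have hv₀' : ContDiffOn ℝ ((m : WithTop ℕ∞) + 1) (v 0) (Icc 0 R) := by exact_mod_cast hv₀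
    obtain ⟨hd, -, hdc⟩ := (contDiffOn_succ_iff_derivWithin (uniqueDiffOn_Icc hR)).1 hv₀'
    have ha' := ha1.add hc1'
    have hb' := (har.mul hv1).add hbr
    obtain ⟨w, hw, hw0⟩ := hc.exists_isTransport ha'.contStrip hb'.contStrip hdc.continuousOn
    have hwm : SmoothStrip R m w := ih hc1 hc1' ha' hb' hw (hdc.congr hw0)
    have hvw : ∀ u, 0 ≤ u → ∀ r ∈ Icc 0 R, HasDerivWithinAt (v u) (w u r) (Icc 0 R) r :=
      fun u hu r hr => hv.hasDerivWithinAt hc hc1'.contStrip hcd ha.contStrip har.contStrip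
        hpa.deriv_r hbr.contStrip hpb.deriv_r hw
        (fun s hs => by rw [hw0 s hs]; exact (hd s hs).hasDerivWithinAt) hu hr
    have hS := (ha1.mul hv1).add hb1
    have hvu := (hc1.mul hwm).add hS
    exact HasPartials.smoothStrip_succ hR ⟨hvu.contStrip, hwm.contStrip,
      fun u hu r hr => IsTransport.hasDerivWithinAt_time hc hS.contStrip hv hwm.contStrip hvw hu hr,
      hvw⟩ hvu hwm

end Transport

/-- The solution is as smooth as its initial data: `v = ∂_r h` solves a linear transport equation
whose coefficients are as smooth as `h`. -/
theorem Evolves.smoothStrip {κ Λ R ε : ℝ} {h v : ℝ → ℝ → ℝ} (hs : IsSetting κ Λ R ε)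
    (hsm : IsSmallField R ε v) (hev : Evolves κ Λ R h v h v)
    (hv : IsTransport R (fun u r => speed κ Λ (v u) r)
      (fun u r => 2 * (r * metricM κ Λ (v u) r) * v u r + forcing κ Λ (v u) r) v)
    {m : ℕ} (hv₀ : ContDiffOn ℝ m (v 0) (Icc 0 R)) :
    SmoothStrip R (m + 1) h ∧ SmoothStrip R m v := by
  have hR := hs.radius
  have hsl : ∀ u, 0 ≤ u → IsSlice R (h u) (v u) := fun u hu => ⟨hsm.cont.slice hu, hev.deriv_r u hu⟩
  induction m with
  | zero =>
    have hv0 := smoothStrip_zero.2 hsm.cont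
    exact ⟨HasPartials.smoothStrip_succ hR hev (smoothStrip_zero.2 hev.cont_u) hv0, hv0⟩
  | succ m ih =>
    obtain ⟨hh, hvm⟩ := ih (hv₀.of_le (by exact_mod_cast m.le_succ))
    have hq := isCentered_meanSlope hR hsl hh hvm
    have hM := (isCentered_metricM (κ := κ) (Λ := Λ) hR hq).id_mul
    have hc := smoothStrip_speed (κ := κ) (Λ := Λ) hR hq
    have hv' := IsTransport.smoothStrip (hsm.isAdmissible hs)
      (fun u hu r hr => hasDerivWithinAt_speed κ Λ hR (hsm.cont.slice hu) hr) hc hM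
      (hM.const_mul 2) (smoothStrip_forcing hR hq) hv hv₀
    exact ⟨HasPartials.smoothStrip_succ hR hev
      ((hc.mul hv').add (hM.mul (hh.sub (hh.moment hR 0)))) hv', hv'⟩

/-! ### Solutions of the nonlinear problem, uniqueness and stability -/

section Reformulation

variable {κ Λ R : ℝ} {k : ℕ} {h₀ : ℝ → ℝ} {h v : ℝ → ℝ → ℝ}

/-- Solutions of `Dh = G (h - h̄)` solve the equation with the nonsingular coefficients. -/
lemma IsSolution.evolves (hR : 0 < R) (hk : 1 ≤ k) (hh : IsSolution κ Λ R k h₀ h) :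
    Evolves κ Λ R h (partialR R h) h (partialR R h) := by
  have h1 : SmoothStrip R (0 + 1) h := SmoothStrip.mono (m := k) hh.contDiffOn hk
  obtain ⟨fu, fr, -, -, hp⟩ := h1.exists_hasPartials hR
  have er : ∀ u, 0 ≤ u → ∀ r ∈ Icc 0 R, partialR R h u r = fr u r := fun u hu r hr =>
    (hp.deriv_r u hu r hr).derivWithin (uniqueDiffOn_Icc hR r hr)
  have eu : ∀ u, 0 ≤ u → ∀ r ∈ Icc 0 R, partialU h u r = fu u r := fun u hu r hr =>
    (hp.deriv_u u hu r hr).derivWithin (uniqueDiffOn_Ici 0 u hu)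
  have hvc : ContStrip R (partialR R h) := hp.cont_r.congr er
  have hs : ∀ u, 0 ≤ u → IsSlice R (h u) (partialR R h u) := fun u hu =>
    ⟨hvc.slice hu, fun r hr => (hp.deriv_r u hu r hr).congr_deriv (er u hu r hr).symm⟩
  have key : ∀ u, 0 ≤ u → ∀ r ∈ Icc 0 R, speed κ Λ (partialR R h u) r * partialR R h u r
      + r * metricM κ Λ (partialR R h u) r * (h u r - moment 0 (h u) r) = fu u r := by
    intro u hu r hr
    have := hh.equation u hu r hr
    rw [D, (hs u hu).gTilde_eq κ Λ hr, (hs u hu).G_eq κ Λ hR hr, avg_eq_moment, eu u hu r hr] at this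
    linarith
  exact ⟨hp.cont_u.congr key, hvc,
    fun u hu r hr => (hp.deriv_u u hu r hr).congr_deriv (key u hu r hr).symm,
    fun u hu => (hs u hu).hasDeriv⟩

lemma Evolves.isSlice (hev : Evolves κ Λ R h v h v) {u : ℝ} (hu : 0 ≤ u) :
    IsSlice R (h u) (v u) := ⟨hev.cont_r.slice hu, hev.deriv_r u hu⟩

lemma Evolves.partialR_eq (hev : Evolves κ Λ R h v h v) (hR : 0 < R) {u r : ℝ} (hu : 0 ≤ u)
    (hr : r ∈ Icc 0 R) : partialR R h u r = v u r :=
  (hev.deriv_r u hu r hr).derivWithin (uniqueDiffOn_Icc hR r hr)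

lemma Evolves.isSolution (hR : 0 < R) (hev : Evolves κ Λ R h v h v) (hk : SmoothStrip R k h)
    (h0 : ∀ r ∈ Icc 0 R, h 0 r = h₀ r) : IsSolution κ Λ R k h₀ h where
  contDiffOn := hk
  initial := h0
  equation u hu r hr := by
    have hu' : 0 ≤ u := hu
    have e : partialU h u r = _ := (hev.deriv_u u hu' r hr).derivWithin (uniqueDiffOn_Ici 0 u hu)
    rw [D, e, hev.partialR_eq hR hu' hr, (hev.isSlice hu').gTilde_eq κ Λ hr,
      (hev.isSlice hu').G_eq κ Λ hR hr, avg_eq_moment]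
    ring

end Reformulation

section Stability

variable {κ Λ R ε : ℝ}

/-- Continuous dependence on the data in the sup norm. The difference of two solutions is bounded by
its own weighted norm times `1 / 2`, once the weight `exp (-l u)` decays fast enough. -/
theorem exists_stability (hs : IsSetting κ Λ R ε) {B : ℝ} (hB : ε ≤ B) :
    ∃ l, 0 < l ∧ ∀ (h₁ v₁ h₂ v₂ : ℝ → ℝ → ℝ) (U W : ℝ), IsSmallField R ε v₁ →
      Evolves κ Λ R h₁ v₁ h₁ v₁ → Evolves κ Λ R h₂ v₂ h₂ v₂ →
      (∀ u ∈ Icc 0 U, ∀ r ∈ Icc 0 R, |v₂ u r| ≤ B) →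
      (∀ u ∈ Icc 0 U, ∀ r ∈ Icc 0 R, |h₂ u r - moment 0 (h₂ u) r| ≤ B) →
      (∀ r ∈ Icc 0 R, |h₁ 0 r - h₂ 0 r| ≤ W) →
      ∀ u ∈ Icc 0 U, ∀ r ∈ Icc 0 R, |h₁ u r - h₂ u r| ≤ 2 * W * Real.exp (l * u) := by
  have hR := hs.radius
  obtain ⟨C, hC, H⟩ := exists_difference_estimate hs B (hs.small.pos.le.trans hB)
  refine ⟨4 * C, by positivity, fun h₁ v₁ h₂ v₂ U W hsm hev₁ hev₂ hv₂ hh₂ hW u hu r hr => ?_⟩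
  obtain ⟨B', -, hB'⟩ := (hev₁.contStrip.sub hev₂.contStrip).exists_bound U
  obtain ⟨m, hm, hleast⟩ := exists_least_weighted_bound (w := fun u r => h₁ u r - h₂ u r)
    (l := 4 * C) hR.le (hu.1.trans hu.2) (by positivity) hB'
  have h1 := H h₁ v₁ h₂ v₂ h₁ v₁ h₂ v₂ U m m W (4 * C) (by positivity) hsm hev₁ hev₂
    (fun τ hτ => ⟨hev₁.isSlice hτ.1, hev₂.isSlice hτ.1,
      fun s hs' => (hsm.bound τ hτ.1 s hs').trans hB, hv₂ τ hτ, hm τ hτ⟩) hv₂ hh₂ hm hW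
  have h2 : m ≤ 2 * W := by
    have h3 := hleast _ h1
    have h4 : C * (m + m) / (4 * C) = m / 2 := by field_simp; ring
    linarith
  exact (hm u hu r hr).trans (mul_le_mul_of_nonneg_right h2 (Real.exp_pos _).le)

/-- A solution with small radial derivative is the only one with its data. -/
theorem IsSolution.eq_of_isSmallField {k : ℕ} {h₀ : ℝ → ℝ} {h v h' : ℝ → ℝ → ℝ}
    (hs : IsSetting κ Λ R ε) (hk : 1 ≤ k) (hsm : IsSmallField R ε v) (hev : Evolves κ Λ R h v h v)
    (h0 : ∀ r ∈ Icc 0 R, h 0 r = h₀ r) (hh' : IsSolution κ Λ R k h₀ h') {u r : ℝ} (hu : 0 ≤ u)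
    (hr : r ∈ Icc 0 R) : h' u r = h u r := by
  have hR := hs.radius
  have hev' := hh'.evolves hR hk
  obtain ⟨B₁, -, hB₁⟩ := hev'.cont_r.exists_bound u
  obtain ⟨B₂, -, hB₂⟩ := (hev'.contStrip.sub (hev'.contStrip.moment hR.le 0)).exists_bound u
  obtain ⟨l, -, H⟩ := exists_stability hs (le_max_left ε (max B₁ B₂))
  have h1 := H h v h' (partialR R h') u 0 hsm hev hev'
    (fun τ hτ x hx => (hB₁ τ hτ x hx).trans (le_max_of_le_right (le_max_left _ _)))
    (fun τ hτ x hx => (hB₂ τ hτ x hx).trans (le_max_of_le_right (le_max_right _ _)))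
    (fun x hx => by rw [h0 x hx, hh'.initial x hx, sub_self, abs_zero])
    u (right_mem_Icc.2 hu) r hr
  rw [mul_zero, zero_mul] at h1
  exact (sub_eq_zero.1 (abs_nonpos_iff.1 h1)).symm

end Stability

section Norms

variable {R : ℝ}

lemma normC0_le_iff {f : ℝ → ℝ} {C : ℝ} (hC : 0 ≤ C) :
    normC0 R f ≤ ENNReal.ofReal C ↔ ∀ r ∈ Icc 0 R, |f r| ≤ C := by
  simp only [normC0, iSup_le_iff, ENNReal.ofReal_le_ofReal_iff hC]

lemma normC0Strip_le_iff {I : Set ℝ} {f : ℝ → ℝ → ℝ} {C : ℝ} (hC : 0 ≤ C) :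
    normC0Strip I R f ≤ ENNReal.ofReal C ↔ ∀ u ∈ I, ∀ r ∈ Icc 0 R, |f u r| ≤ C := by
  simp only [normC0Strip, iSup_le_iff, ENNReal.ofReal_le_ofReal_iff hC]

lemma abs_le_toReal_normC0 {f : ℝ → ℝ} (hf : normC0 R f ≠ ⊤) {r : ℝ} (hr : r ∈ Icc 0 R) :
    |f r| ≤ (normC0 R f).toReal :=
  (normC0_le_iff ENNReal.toReal_nonneg).1 (ENNReal.ofReal_toReal hf).ge r hr

lemma normC0_ne_top {f : ℝ → ℝ} (hf : ContinuousOn f (Icc 0 R)) : normC0 R f ≠ ⊤ := by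
  obtain ⟨C, hC0, hC⟩ := (ContStrip.of_slice hf).exists_bound 0
  exact ne_top_of_le_ne_top ENNReal.ofReal_ne_top
    ((normC0_le_iff hC0).2 (hC 0 (left_mem_Icc.2 le_rfl)))

lemma normC0_le_normC0Strip {I : Set ℝ} {f : ℝ → ℝ → ℝ} {u : ℝ} (hu : u ∈ I) :
    normC0 R (f u) ≤ normC0Strip I R f := le_iSup₂_of_le u hu le_rfl

lemma normC0_congr {f k : ℝ → ℝ} (h : ∀ r ∈ Icc 0 R, f r = k r) : normC0 R f = normC0 R k :=
  iSup_congr fun r => iSup_congr fun hr => by rw [h r hr]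

end Norms

section Existence

variable {κ Λ R ε : ℝ} {k : ℕ} {h₀ : ℝ → ℝ}

lemma normC0_ne_top_of_contDiffOn (hR : 0 < R) (hk : 1 ≤ k) (hh₀ : ContDiffOn ℝ k h₀ (Icc 0 R)) :
    normC0 R h₀ ≠ ⊤ ∧ normC0 R (derivWithin h₀ (Icc 0 R)) ≠ ⊤ :=
  ⟨BondiScalar.normC0_ne_top hh₀.continuousOn, BondiScalar.normC0_ne_top
    (hh₀.continuousOn_derivWithin (uniqueDiffOn_Icc hR) (by exact_mod_cast hk))⟩

lemma isData_of_normX_le (hs : IsSetting κ Λ R ε) (hk : 1 ≤ k)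
    (hh₀ : ContDiffOn ℝ k h₀ (Icc 0 R))
    (hx : normX R h₀ ≤ ENNReal.ofReal (ε / (1 + growthConst κ Λ R ε) ^ 2)) :
    IsData κ Λ R ε (normC0 R h₀).toReal (normC0 R (derivWithin h₀ (Icc 0 R))).toReal h₀
      (derivWithin h₀ (Icc 0 R)) := by
  have hR := hs.radius
  have hC := hs.one_le_growthConst
  obtain ⟨t1, t2⟩ := normC0_ne_top_of_contDiffOn hR hk hh₀
  refine ⟨⟨hh₀.continuousOn_derivWithin (uniqueDiffOn_Icc hR) (by exact_mod_cast hk),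
    fun r hr => ((hh₀.differentiableOn (by exact_mod_cast (by omega : k ≠ 0))) r hr
      ).hasDerivWithinAt⟩, fun r hr => abs_le_toReal_normC0 t1 hr,
    fun r hr => abs_le_toReal_normC0 t2 hr, ?_⟩
  have hε := hs.small.pos
  have h1 := ENNReal.toReal_le_of_le_ofReal (by positivity) hx
  rw [normX, ENNReal.toReal_add t1 t2, le_div_iff₀ (by positivity)] at h1
  set S := (normC0 R h₀).toReal + (normC0 R (derivWithin h₀ (Icc 0 R))).toReal
  have hS : 0 ≤ S := add_nonneg ENNReal.toReal_nonneg ENNReal.toReal_nonneg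
  have h2 : growthConst κ Λ R ε * S ≤ (1 + growthConst κ Λ R ε) ^ 2 * S :=
    mul_le_mul_of_nonneg_right (by nlinarith) hS
  linarith

/-- Global existence for small data, with the bounds on `h` and `∂_r h` and the regularity of the
data. -/
theorem exists_global_solution (hs : IsSetting κ Λ R ε) (hk : 1 ≤ k)
    (hh₀ : ContDiffOn ℝ k h₀ (Icc 0 R))
    (hx : normX R h₀ ≤ ENNReal.ofReal (ε / (1 + growthConst κ Λ R ε) ^ 2)) :
    ∃ h v, IsIterate κ Λ R ε (normC0 R h₀).toReal (normC0 R (derivWithin h₀ (Icc 0 R))).toReal h₀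
      (derivWithin h₀ (Icc 0 R)) h v ∧ IsSmallField R ε v ∧ Evolves κ Λ R h v h v ∧
      IsSolution κ Λ R k h₀ h := by
  have hd := isData_of_normX_le hs hk hh₀ hx
  obtain ⟨h, v, hit, hev, hv⟩ := hd.exists_solution hs
  obtain ⟨m, rfl⟩ : ∃ m, k = m + 1 := ⟨k - 1, by omega⟩
  refine ⟨h, v, hit, hit.isSmallField hd, hev, hev.isSolution hs.radius ?_ hit.init_h⟩
  have hh₀' : ContDiffOn ℝ ((m : WithTop ℕ∞) + 1) h₀ (Icc 0 R) := by exact_mod_cast hh₀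
  have h1 := ((contDiffOn_succ_iff_derivWithin (uniqueDiffOn_Icc hs.radius)).1 hh₀').2.2
  exact (hev.smoothStrip hs (hit.isSmallField hd) hv (h1.congr hit.init_v)).1

end Existence

end BondiScalar

theorem theorem3 (κ Λ R : ℝ) (hκ : 0 < κ) (hΛ : 0 < Λ) (hR : Real.sqrt (3 / Λ) < R) :
    ∃ xstar Cstar : ℝ, 0 < xstar ∧ 0 < Cstar ∧
      (∀ (k : ℕ), 1 ≤ k → ∀ (h₀ : ℝ → ℝ), ContDiffOn ℝ k h₀ (Icc 0 R) →
        BondiScalar.normX R h₀ ≤ ENNReal.ofReal (xstar / (1 + Cstar) ^ 2) →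
        ∃ h : ℝ → ℝ → ℝ, BondiScalar.IsSolution κ Λ R k h₀ h ∧
          (∀ h' : ℝ → ℝ → ℝ, BondiScalar.IsSolution κ Λ R k h₀ h' →
            ∀ u ∈ Ici (0 : ℝ), ∀ r ∈ Icc (0 : ℝ) R, h' u r = h u r) ∧
          BondiScalar.normC0Strip (Ici 0) R h = BondiScalar.normC0 R h₀ ∧
          BondiScalar.normXStrip (Ici 0) R h
            ≤ ENNReal.ofReal (1 + Cstar) * BondiScalar.normX R h₀) ∧
      (∀ U : ℝ, 0 < U → ∃ C : ℝ, 0 < C ∧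
        ∀ (k : ℕ), 1 ≤ k → ∀ (h₀₁ h₀₂ : ℝ → ℝ),
          ContDiffOn ℝ k h₀₁ (Icc 0 R) → ContDiffOn ℝ k h₀₂ (Icc 0 R) →
          BondiScalar.normX R h₀₁ ≤ ENNReal.ofReal (xstar / (1 + Cstar) ^ 2) →
          BondiScalar.normX R h₀₂ ≤ ENNReal.ofReal (xstar / (1 + Cstar) ^ 2) →
          ∀ h₁ h₂ : ℝ → ℝ → ℝ,
            BondiScalar.IsSolution κ Λ R k h₀₁ h₁ → BondiScalar.IsSolution κ Λ R k h₀₂ h₂ →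
            BondiScalar.normC0Strip (Icc 0 U) R (fun u r => h₁ u r - h₂ u r)
              ≤ ENNReal.ofReal C * BondiScalar.normC0 R (fun r => h₀₁ r - h₀₂ r)) := by
  have hR0 : 0 < R := (Real.sqrt_nonneg _).trans_lt hR
  have h3 : 3 < Λ * R ^ 2 := by
    have h := (Real.sqrt_lt' hR0).1 hR
    rw [div_lt_iff₀ hΛ] at h
    linarith
  obtain ⟨ε, hε⟩ := BondiScalar.exists_isSmall κ hΛ hR0 h3
  have hs : BondiScalar.IsSetting κ Λ R ε := ⟨hκ, hΛ, hR0, h3, hε⟩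
  have hC1 := hs.one_le_growthConst
  refine ⟨ε, BondiScalar.growthConst κ Λ R ε, hε.pos, by linarith, ?_, ?_⟩
  · intro k hk h₀ hh₀ hx
    obtain ⟨t1, t2⟩ := BondiScalar.normC0_ne_top_of_contDiffOn hR0 hk hh₀
    obtain ⟨h, v, hit, hsm, hev, hsol⟩ := BondiScalar.exists_global_solution hs hk hh₀ hx
    have hle : BondiScalar.normC0Strip (Ici 0) R h ≤ BondiScalar.normC0 R h₀ := by
      rw [← ENNReal.ofReal_toReal t1]
      exact (BondiScalar.normC0Strip_le_iff ENNReal.toReal_nonneg).2 hit.bound_h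
    refine ⟨h, hsol, fun h' hh' u hu r hr => hh'.eq_of_isSmallField hs hk hsm hev hit.init_h hu hr,
      hle.antisymm ?_, ?_⟩
    · rw [← BondiScalar.normC0_congr hit.init_h]
      exact BondiScalar.normC0_le_normC0Strip (mem_Ici.2 le_rfl)
    · set X := (BondiScalar.normC0 R h₀).toReal
      set V := (BondiScalar.normC0 R (derivWithin h₀ (Icc 0 R))).toReal
      have hX : 0 ≤ X := ENNReal.toReal_nonneg
      have hV : 0 ≤ V := ENNReal.toReal_nonneg
      have hCX : 0 ≤ BondiScalar.growthConst κ Λ R ε * (X + V) := by positivity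
      have e : BondiScalar.normX R h₀ = ENNReal.ofReal (X + V) := by
        rw [BondiScalar.normX, ENNReal.ofReal_add hX hV, ENNReal.ofReal_toReal t1,
          ENNReal.ofReal_toReal t2]
      have hv : BondiScalar.normC0Strip (Ici 0) R (BondiScalar.partialR R h)
          ≤ ENNReal.ofReal (BondiScalar.growthConst κ Λ R ε * (X + V)) :=
        (BondiScalar.normC0Strip_le_iff hCX).2 fun u hu r hr => by
          rw [hev.partialR_eq hR0 hu hr]; exact hit.bound_v u hu r hr
      rw [BondiScalar.normXStrip, e, ← ENNReal.ofReal_mul (by linarith)]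
      refine (add_le_add (hle.trans_eq (ENNReal.ofReal_toReal t1).symm) hv).trans ?_
      rw [← ENNReal.ofReal_add hX hCX]
      exact ENNReal.ofReal_le_ofReal (by linarith)
  · intro U hU
    obtain ⟨l, hl, H⟩ := BondiScalar.exists_stability hs (by linarith [hε.pos] : ε ≤ 2 * ε)
    refine ⟨2 * Real.exp (l * U), by positivity, ?_⟩
    intro k hk h₀₁ h₀₂ hc₁ hc₂ hx₁ hx₂ h₁ h₂ hs₁ hs₂
    -- the given solutions are the small ones, by uniqueness, so their bounds depend only on `ε`
    obtain ⟨H₁, V₁, hit₁, hsm₁, hev₁, -⟩ := BondiScalar.exists_global_solution hs hk hc₁ hx₁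
    obtain ⟨H₂, V₂, hit₂, hsm₂, hev₂, -⟩ := BondiScalar.exists_global_solution hs hk hc₂ hx₂
    have hX₂ : (BondiScalar.normC0 R h₀₂).toReal ≤ ε := by
      refine le_trans ?_ (BondiScalar.isData_of_normX_le hs hk hc₂ hx₂).small
      have p1 : 0 ≤ (BondiScalar.normC0 R h₀₂).toReal := ENNReal.toReal_nonneg
      have p2 : 0 ≤ (BondiScalar.normC0 R (derivWithin h₀₂ (Icc 0 R))).toReal :=
        ENNReal.toReal_nonneg
      nlinarith
    have tW : BondiScalar.normC0 R (fun r => h₀₁ r - h₀₂ r) ≠ ⊤ :=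
      BondiScalar.normC0_ne_top (hc₁.continuousOn.sub hc₂.continuousOn)
    rw [← ENNReal.ofReal_toReal tW, ← ENNReal.ofReal_mul (by positivity)]
    set W := (BondiScalar.normC0 R (fun r => h₀₁ r - h₀₂ r)).toReal with hW
    have hW0 : 0 ≤ W := ENNReal.toReal_nonneg
    refine (BondiScalar.normC0Strip_le_iff (by positivity)).2 fun u hu r hr => ?_
    rw [hs₁.eq_of_isSmallField hs hk hsm₁ hev₁ hit₁.init_h hu.1 hr,
      hs₂.eq_of_isSmallField hs hk hsm₂ hev₂ hit₂.init_h hu.1 hr]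
    refine (H H₁ V₁ H₂ V₂ U W hsm₁ hev₁ hev₂
      (fun τ hτ x hx => (hsm₂.bound τ hτ.1 x hx).trans (by linarith [hε.pos]))
      (fun τ hτ x hx => (abs_sub _ _).trans
        (by linarith [hit₂.bound_h τ hτ.1 x hx, hit₂.abs_moment_le hτ.1 hx]))
      (fun x hx => ?_) u hu r hr).trans ?_
    · rw [hit₁.init_h x hx, hit₂.init_h x hx]
      exact BondiScalar.abs_le_toReal_normC0 tW hx
    · have : Real.exp (l * u) ≤ Real.exp (l * U) :=
        Real.exp_le_exp.2 (mul_le_mul_of_nonneg_left hu.2 hl.le)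
      nlinarith
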